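/- **Setting.** On Minkowski space $\mathbb R^4$, with metric $\eta=\mathrm{diag}(1,-1,-1,-1)$, let $h_{\mu\nu}=h_{\nu\mu}$ (Bose) and $u_\mu,\tilde u_\mu$ (Fermi) be massless free fields whose non-zero two-point functions are $$\langle\Omega,h_{\mu\nu}(x_1)h_{\rho\sigma}(x_2)\Omega\rangle=-\tfrac i2(\eta_{\mu\rho}\eta_{\nu\sigma}+\eta_{\nu\rho}\eta_{\mu\sigma}-\eta_{\mu\nu}\eta_{\rho\sigma})D_0^{(+)}(x_1-x_2),$$ $$\langle\Omega,u_\mu(x_1)\tilde u_\nu(x_2)\Omega\rangle=i\eta_{\mu\nu}D_0^{(+)}(x_1-x_2),\qquad \langle\Omega,\tilde u_\mu(x_1)u_\nu(x_2)\Omega\rangle=-i\eta_{\mu\nu}D_0^{(+)}(x_1-x_2),$$ where $D_0^{(+)}(x)=i(2\pi)^{-3}\int \frac{d^3p}{2|p|}e^{ip\cdot x}$, $p_0=|p|$. Let $d_Q=[Q,\cdot\,]$ be the graded commutator with the gauge charge, i.e. the odd derivation commuting with $\partial_\mu$ such that $$d_Qh_{\mu\nu}=-\tfrac i2(\partial_\mu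 u_\nu+\partial_\nu u_\mu-\eta_{\mu\nu}\partial_\rho u^\rho),\qquad d_Qu_\mu=0,\qquad d_Q\tilde u_\mu=i\partial^\nu h_{\mu\nu}.$$ For $\kappa\in\mathbb R$ and $h=\eta^{\mu\nu}h_{\mu\nu}$, let $T$ be the (normally ordered) interaction Lagrangian $$\begin{aligned}T=\kappa\big[&-h_{\mu\nu}\partial^\mu h\,\partial^\nu h+2h^{\mu\nu}\partial_\mu h_{\rho\sigma}\partial_\nu h^{\rho\sigma}+4h_{\mu\nu}\partial_\rho h^{\mu\sigma}\partial_\sigma h^{\nu\rho}+2h_{\mu\nu}\partial_\rho h^{\mu\nu}\partial^\rho h-4h_{\mu\nu}\partial_\rho h^{\mu\sigma}\partial^\rho h^{\nu}{}_{\sigma}\\&-4u^\mu\partial_\rho\tilde u_\sigma\partial_\mu h^{\rho\sigma}+4\partial_\nu u^\rho\partial_\mu\tilde u_\rho h^{\mu\nu}-4\partial^\rho u_\rho\,\partial_\mu\tilde u_\nu h^{\mu\nu}+4\partial_\mu u^\rho\partial_\rho\tilde u_\nu h^{\mu\nu}\big].\end{aligned}$$ Let $D_{(1)}(T(x_1),T(x_2))$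 be the one-loop part of $[T(x_1),T(x_2)]$: the terms with exactly two contractions in the Wick expansion of $T(x_1)T(x_2)-T(x_2)T(x_1)$. Put $d_2(x)=\frac12[D_0^{(+)}(x)^2-D_0^{(+)}(-x)^2]$ and $d_2^{(+)}=\frac12(D_0^{(+)})^2$. A *Feynman propagator* of $d_2$ is a distribution $d_2^F=d_2^{\rm ret}+d_2^{(+)}$, where $d_2=d_2^{\rm adv}-d_2^{\rm ret}$ with $d_2^{\rm adv}$, $d_2^{\rm ret}$ supported in the closed forward, respectively backward, light cone. A *cochain* is an expression $C=\sum_jp_j(\partial)d_2(x_1-x_2)\,W_j(x_1,x_2)$ (finite sum) with $p_j$ polynomials and $W_j$ Wick monomials in the fields and their derivatives at $x_1,x_2$; $C^F$ is the expression obtained from it by replacing $d_2$ by $d_2^F$. The expression $D_{(1)}(T(x_1),T(x_2))$ is of this form, and the one-loop chronological product $T_{(1)}(T(x_1),T(x_2))$ belonging to $d_2^F$ is obtained from it by the same replacement. **Theorem.** For every $\kappa\in\mathbb R$, the expression $D_{(1)}(T(x_1),T(x_2))$ is a relative coboundary: there are cochains $B$ and $B^{\mu}$ such that $$D_{(1)}(T(x_1),T(x_2))=d_QB(x_1,x_2)+i\big[\partial^1_\mu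 B^\mu(x_1,x_2)-(1\leftrightarrow2)\big].$$ With $\tilde B^{\mu}(x_1,x_2):=-B^\mu(x_2,x_1)$, written as a cochain, so that the bracket is $\partial^1_\mu B^\mu+\partial^2_\mu\tilde B^\mu$, one has, for every Feynman propagator $d_2^F$ of $d_2$, $$T_{(1)}(T(x_1),T(x_2))=d_QB^F(x_1,x_2)+i\big[\partial^1_\mu B^{F,\mu}(x_1,x_2)+\partial^2_\mu\tilde B^{F,\mu}(x_1,x_2)\big],$$ so that $T_{(1)}(T(x_1),T(x_2))$ is a relative coboundary, too. If $d_2^F(-x)=d_2^F(x)$, then $\tilde B^{F,\mu}(x_1,x_2)=B^{F,\mu}(x_2,x_1)$, i.e. the bracket is $\partial^1_\mu B^{F,\mu}+(1\leftrightarrow2)$. -/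

import Mathlib

noncomputable section

open scoped SchwartzMap TensorProduct
open MeasureTheory

namespace MasslessGravity

/-! ## Minkowski space and tempered distributions on it -/

/-- Minkowski space `ℝ⁴`, with coordinates `x⁰, x¹, x², x³`. -/
abbrev Minkowski := EuclideanSpace ℝ (Fin 4)

/-- The diagonal entries `1, -1, -1, -1` of the Minkowski metric. All tensors below are written
with lower indices, so that a contracted pair of indices `μ` carries a factor `ε μ`. -/
def ε (μ : Fin 4) : ℂ := if μ = 0 then 1 else -1

/-- The Minkowski metric `η_{μν}`. -/
def η (μ ν : Fin 4) : ℂ := if μ = ν then ε μ else 0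

/-- Complex-valued tempered distributions on Minkowski space; in what follows they depend on the
difference variable `x₁ - x₂`. -/
abbrev Distr := 𝓢'(Minkowski, ℂ)

/-- The partial derivative `∂_μ = ∂/∂x^μ` of distributions. -/
def partialD (μ : Fin 4) : Module.End ℂ Distr :=
  (LineDeriv.lineDerivOpCLM ℂ Distr (EuclideanSpace.single μ (1 : ℝ) : Minkowski)).toLinearMap

/-- The reflection `d(x) ↦ d(-x)` of distributions. -/
def reflect : Distr →ₗ[ℂ] Distr :=
  (PointwiseConvergenceCLM.precomp ℂ
    (SchwartzMap.compCLMOfContinuousLinearEquiv ℂ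
      (ContinuousLinearEquiv.neg ℝ : Minkowski ≃L[ℝ] Minkowski) :
        𝓢(Minkowski, ℂ) →L[ℂ] 𝓢(Minkowski, ℂ))).toLinearMap

/-- The linear map `p ↦ p(∂) d`, for polynomials `p` in the four partial derivatives. -/
def diffOp (d : Distr) : MvPolynomial (Fin 4) ℂ →ₗ[ℂ] Distr :=
  (MvPolynomial.basisMonomials (Fin 4) ℂ).constr ℂ fun α : Fin 4 →₀ ℕ =>
    (partialD 0 ^ α 0 * partialD 1 ^ α 1 * partialD 2 ^ α 2 * partialD 3 ^ α 3) d

/-- The closed forward light cone. -/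
def forwardCone : Set Minkowski :=
  {x | 0 ≤ x 0 ∧ (x 1) ^ 2 + (x 2) ^ 2 + (x 3) ^ 2 ≤ (x 0) ^ 2}

/-- The closed backward light cone. -/
def backwardCone : Set Minkowski :=
  {x | x 0 ≤ 0 ∧ (x 1) ^ 2 + (x 2) ^ 2 + (x 3) ^ 2 ≤ (x 0) ^ 2}

/-! ## Products of two derivatives of `D₀⁽⁺⁾`

The positive frequency part of the massless Pauli-Jordan distribution is
`D₀⁽⁺⁾(x) = i (2π)⁻³ ∫ d⁴p θ(p₀) δ(p²) e^{i p·x} = i (2π)⁻³ ∫ d³p / (2|p|) e^{i p·x}`, where in the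
last integral `p₀ = |p|`. Its Fourier transform is carried by the forward light cone, so products
of its derivatives are defined as convolutions of their Fourier transforms. -/

/-- Momentum three-space. -/
abbrev Mom := EuclideanSpace ℝ (Fin 3)

/-- The lower components `(p₀, p₁, p₂, p₃)` of the light-like momentum with spatial part `p`; thus
`p·x = ∑ μ, onShell p μ * x μ = |p| x⁰ - p¹x¹ - p²x² - p³x³`. -/
def onShell (p : Mom) : Minkowski := !₂[‖p‖, -p 0, -p 1, -p 2]

/-- The factor `∏_μ (i p_μ)^{γ_μ}` that the derivative `∂^γ` produces on `e^{i p·x}`. -/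
def momFactor (γ : Fin 4 →₀ ℕ) (p : Mom) : ℂ :=
  ∏ μ : Fin 4, (Complex.I * (onShell p μ : ℂ)) ^ γ μ

/-- The weight of the two-particle phase-space integral. -/
def loopWeight (γ₁ γ₂ : Fin 4 →₀ ℕ) (z : Mom × Mom) : ℂ :=
  momFactor γ₁ z.1 * momFactor γ₂ z.2 / ((2 * ‖z.1‖ : ℝ) * (2 * ‖z.2‖ : ℝ) : ℂ)

/-- The argument at which the Mathlib Fourier transform is evaluated: since
`𝓕 f ξ = ∫ f(x) e^{-2πi ⟪x, ξ⟫} dx`, one has `∫ f(x) e^{i (p+q)·x} dx = 𝓕 f (loopArg (p, q))`. -/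
def loopArg (z : Mom × Mom) : Minkowski :=
  (-(2 * Real.pi)⁻¹ : ℝ) • (onShell z.1 + onShell z.2)

theorem abs_onShell_le (p : Mom) (μ : Fin 4) : |onShell p μ| ≤ ‖p‖ := by
  have h (i : Fin 3) : |p i| ≤ ‖p‖ := by simpa using PiLp.norm_apply_le p i
  fin_cases μ
  · simp [onShell]
  · simpa [onShell] using h 0
  · simpa [onShell] using h 1
  · simpa [onShell] using h 2

theorem norm_momFactor_le (γ : Fin 4 →₀ ℕ) (p : Mom) :
    ‖momFactor γ p‖ ≤ ‖p‖ ^ (∑ μ, γ μ) := by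
  rw [momFactor, norm_prod, ← Finset.prod_pow_eq_pow_sum]
  refine Finset.prod_le_prod (fun _ _ => norm_nonneg _) fun μ _ => ?_
  rw [norm_pow, norm_mul, Complex.norm_I, one_mul, Complex.norm_real]
  exact pow_le_pow_left₀ (norm_nonneg _) (abs_onShell_le p μ) _

theorem continuous_onShell : Continuous onShell := by
  unfold onShell
  refine (PiLp.continuous_toLp 2 _).comp (continuous_pi fun μ => ?_)
  fin_cases μ <;> simp <;> fun_prop

theorem norm_add_norm_le (z : Mom × Mom) :
    ‖z.1‖ + ‖z.2‖ ≤ (2 * Real.pi) * ‖loopArg z‖ := by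
  have h : |loopArg z 0| ≤ ‖loopArg z‖ := by simpa using PiLp.norm_apply_le (loopArg z) 0
  have h2 : loopArg z 0 = -(2 * Real.pi)⁻¹ * (‖z.1‖ + ‖z.2‖) := by
    simp [loopArg, onShell]
    ring
  have hpi : 0 < 2 * Real.pi := by positivity
  rw [h2, abs_mul, abs_neg, abs_of_pos (inv_pos.mpr hpi), abs_of_nonneg (by positivity)] at h
  calc ‖z.1‖ + ‖z.2‖ = (2 * Real.pi) * ((2 * Real.pi)⁻¹ * (‖z.1‖ + ‖z.2‖)) := by
        field_simp
    _ ≤ _ := by gcongr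

/-- A one-particle phase-space integral converges. -/
theorem integrable_onePart (n : ℕ) :
    Integrable (fun p : Mom => ‖p‖ ^ n / (2 * ‖p‖) * ((1 + ‖p‖) ^ (n + 3))⁻¹) := by
  have := (integrable_fun_norm_addHaar (E := Mom) volume
    (f := fun y : ℝ => y ^ n / (2 * y) * ((1 + y) ^ (n + 3))⁻¹)).mpr ?_
  · exact this
  have hint : IntegrableOn (fun y : ℝ => (1 + ‖y‖) ^ (-(2 : ℝ))) (Set.Ioi 0) :=
    (integrable_one_add_norm (E := ℝ) (μ := volume) (r := 2) (by simp)).integrableOn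
  refine hint.mono' (by fun_prop) ?_
  refine (ae_restrict_iff' measurableSet_Ioi).mpr (Filter.Eventually.of_forall fun y hy => ?_)
  have hy : 0 < y := hy
  rw [Real.norm_of_nonneg hy.le, finrank_euclideanSpace_fin, smul_eq_mul,
    Real.norm_of_nonneg (by positivity), Real.rpow_neg (by positivity)]
  have e : (1 + y) ^ (2 : ℝ) = (1 + y) ^ 2 := by norm_cast
  rw [e]
  have h1 : y ^ (3 - 1) * (y ^ n / (2 * y) * ((1 + y) ^ (n + 3))⁻¹)
      = (y ^ (n + 1) / (1 + y) ^ (n + 1)) * (1 / 2) * ((1 + y) ^ 2)⁻¹ := by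
    field_simp
    ring
  rw [h1]
  have h2 : y ^ (n + 1) / (1 + y) ^ (n + 1) ≤ 1 := by
    rw [← div_pow]
    exact pow_le_one₀ (by positivity) ((div_le_one (by positivity)).mpr (by linarith))
  have h3 : 0 ≤ y ^ (n + 1) / (1 + y) ^ (n + 1) := by positivity
  calc _ ≤ (1 : ℝ) * ((1 + y) ^ 2)⁻¹ := by
        gcongr
        linarith
    _ = _ := one_mul _

/-- The dominating function of the two-particle phase-space integral. -/
def loopDom (m n : ℕ) (z : Mom × Mom) : ℝ :=
  (‖z.1‖ ^ m / (2 * ‖z.1‖) * ((1 + ‖z.1‖) ^ (m + 3))⁻¹) *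
    (‖z.2‖ ^ n / (2 * ‖z.2‖) * ((1 + ‖z.2‖) ^ (n + 3))⁻¹)

theorem integrable_loopDom (m n : ℕ) : Integrable (loopDom m n) :=
  (integrable_onePart m).mul_prod (integrable_onePart n)

theorem norm_loop_le (γ₁ γ₂ : Fin 4 →₀ ℕ) (g : 𝓢(Minkowski, ℂ)) (z : Mom × Mom) :
    ‖loopWeight γ₁ γ₂ z * g (loopArg z)‖ ≤
      loopDom (∑ μ, γ₁ μ) (∑ μ, γ₂ μ) z *
        ((2 * Real.pi) ^ ((∑ μ, γ₁ μ) + 3 + ((∑ μ, γ₂ μ) + 3)) *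
          (2 ^ ((∑ μ, γ₁ μ) + 3 + ((∑ μ, γ₂ μ) + 3)) *
            (Finset.Iic ((∑ μ, γ₁ μ) + 3 + ((∑ μ, γ₂ μ) + 3), 0)).sup
              (schwartzSeminormFamily ℂ Minkowski ℂ) g)) := by
  set m := ∑ μ, γ₁ μ
  set n := ∑ μ, γ₂ μ
  set S := (2 : ℝ) ^ (m + 3 + (n + 3)) * (Finset.Iic (m + 3 + (n + 3), 0)).sup
    (schwartzSeminormFamily ℂ Minkowski ℂ) g with hS
  have hg : (1 + ‖loopArg z‖) ^ (m + 3 + (n + 3)) * ‖g (loopArg z)‖ ≤ S := by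
    have h := SchwartzMap.one_add_le_sup_seminorm_apply (𝕜 := ℂ) (m := (m + 3 + (n + 3), 0))
      (k := m + 3 + (n + 3)) (n := 0) le_rfl le_rfl g (loopArg z)
    rw [norm_iteratedFDeriv_zero] at h
    exact h
  have hpi : 1 ≤ 2 * Real.pi := by linarith [Real.pi_gt_three]
  have hA := norm_add_norm_le z
  have h1 : 1 + ‖z.1‖ ≤ 2 * Real.pi * (1 + ‖loopArg z‖) := by
    nlinarith [norm_nonneg z.2, norm_nonneg (loopArg z)]
  have h2 : 1 + ‖z.2‖ ≤ 2 * Real.pi * (1 + ‖loopArg z‖) := by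
    nlinarith [norm_nonneg z.1, norm_nonneg (loopArg z)]
  have h3 : (1 + ‖z.1‖) ^ (m + 3) * (1 + ‖z.2‖) ^ (n + 3) ≤
      (2 * Real.pi) ^ (m + 3 + (n + 3)) * (1 + ‖loopArg z‖) ^ (m + 3 + (n + 3)) := by
    rw [← mul_pow, pow_add _ (m + 3)]
    gcongr
  have h4 : ‖g (loopArg z)‖ ≤ ((1 + ‖z.1‖) ^ (m + 3))⁻¹ * ((1 + ‖z.2‖) ^ (n + 3))⁻¹ *
      ((2 * Real.pi) ^ (m + 3 + (n + 3)) * S) := by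
    rw [← mul_inv, inv_mul_eq_div, le_div_iff₀ (by positivity), mul_comm]
    calc _ ≤ (2 * Real.pi) ^ (m + 3 + (n + 3)) * (1 + ‖loopArg z‖) ^ (m + 3 + (n + 3)) *
          ‖g (loopArg z)‖ := by gcongr
      _ = (2 * Real.pi) ^ (m + 3 + (n + 3)) *
          ((1 + ‖loopArg z‖) ^ (m + 3 + (n + 3)) * ‖g (loopArg z)‖) := by ring
      _ ≤ _ := by gcongr
  have h5 : ‖loopWeight γ₁ γ₂ z‖ ≤ ‖z.1‖ ^ m / (2 * ‖z.1‖) * (‖z.2‖ ^ n / (2 * ‖z.2‖)) := by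
    rw [loopWeight, norm_div, norm_mul, norm_mul, Complex.norm_real, Complex.norm_real,
      Real.norm_of_nonneg (by positivity), Real.norm_of_nonneg (by positivity),
      div_mul_div_comm]
    gcongr
    · exact norm_momFactor_le γ₁ z.1
    · exact norm_momFactor_le γ₂ z.2
  rw [norm_mul]
  calc _ ≤ ‖z.1‖ ^ m / (2 * ‖z.1‖) * (‖z.2‖ ^ n / (2 * ‖z.2‖)) *
        (((1 + ‖z.1‖) ^ (m + 3))⁻¹ * ((1 + ‖z.2‖) ^ (n + 3))⁻¹ *
          ((2 * Real.pi) ^ (m + 3 + (n + 3)) * S)) := by gcongr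
    _ = _ := by rw [loopDom]; ring

theorem integrable_loop (γ₁ γ₂ : Fin 4 →₀ ℕ) (g : 𝓢(Minkowski, ℂ)) :
    Integrable (fun z : Mom × Mom => loopWeight γ₁ γ₂ z * g (loopArg z)) := by
  refine ((integrable_loopDom (∑ μ, γ₁ μ) (∑ μ, γ₂ μ)).mul_const _).mono' ?_
    (Filter.Eventually.of_forall fun z => norm_loop_le γ₁ γ₂ g z)
  have hc := continuous_onShell
  have ha : Continuous loopArg := by unfold loopArg; fun_prop
  have hm (γ : Fin 4 →₀ ℕ) : Continuous (momFactor γ) := by unfold momFactor; fun_prop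
  have hw : Measurable (loopWeight γ₁ γ₂) := by
    unfold loopWeight
    have h1 : Measurable fun z : Mom × Mom => momFactor γ₁ z.1 :=
      ((hm γ₁).comp continuous_fst).measurable
    have h2 : Measurable fun z : Mom × Mom => momFactor γ₂ z.2 :=
      ((hm γ₂).comp continuous_snd).measurable
    fun_prop
  exact hw.aestronglyMeasurable.mul (g.continuous.comp ha).aestronglyMeasurable

/-- The two-particle phase-space integral
`g ↦ (i (2π)⁻³)² ∫∫ d³p/(2|p|) d³q/(2|q|) (ip)^{γ₁} (iq)^{γ₂} g(loopArg (p, q))`. -/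
def phaseSpace (γ₁ γ₂ : Fin 4 →₀ ℕ) : 𝓢(Minkowski, ℂ) →L[ℂ] ℂ :=
  SchwartzMap.mkCLMtoNormedSpace
    (fun g => (Complex.I / (2 * Real.pi) ^ 3) ^ 2 *
      ∫ z : Mom × Mom, loopWeight γ₁ γ₂ z * g (loopArg z))
    (fun f g => by
      rw [← mul_add, ← integral_add (integrable_loop γ₁ γ₂ f) (integrable_loop γ₁ γ₂ g)]
      simp only [add_apply, mul_add])
    (fun a f => by
      simp only [smul_apply, smul_eq_mul, RingHom.id_apply]
      rw [mul_left_comm a, ← integral_const_mul a]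
      congr 2
      funext z
      ring)
    (by
      set N := (∑ μ, γ₁ μ) + 3 + ((∑ μ, γ₂ μ) + 3)
      refine ⟨Finset.Iic (N, 0), ‖(Complex.I / (2 * Real.pi) ^ 3) ^ 2‖ *
        ((∫ z, loopDom (∑ μ, γ₁ μ) (∑ μ, γ₂ μ) z) * ((2 * Real.pi) ^ N * 2 ^ N)), ?_, ?_⟩
      · have : 0 ≤ ∫ z, loopDom (∑ μ, γ₁ μ) (∑ μ, γ₂ μ) z :=
          integral_nonneg fun z => by unfold loopDom; positivity
        positivity
      · intro f
        rw [norm_mul, mul_assoc]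
        gcongr
        refine (norm_integral_le_integral_norm _).trans ?_
        refine (integral_mono (integrable_loop γ₁ γ₂ f).norm
          ((integrable_loopDom _ _).mul_const _) fun z => norm_loop_le γ₁ γ₂ f z).trans ?_
        rw [integral_mul_const, mul_assoc, mul_assoc])

/-- The distribution `∂^{γ₁}D₀⁽⁺⁾(x) ∂^{γ₂}D₀⁽⁺⁾(x)`, that is
`f ↦ (i (2π)⁻³)² ∫∫ d³p/(2|p|) d³q/(2|q|) (ip)^{γ₁} (iq)^{γ₂} ∫ f(x) e^{i (p+q)·x} dx`. -/
def prodDplus (γ₁ γ₂ : Fin 4 →₀ ℕ) : Distr :=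
  ContinuousLinearMap.toPointwiseConvergenceCLM _ _ _ _
    ((phaseSpace γ₁ γ₂).comp (SchwartzMap.fourierTransformCLM ℂ))

/-- The distribution `d₂⁽⁺⁾(x) = ½ D₀⁽⁺⁾(x)²`. -/
def d₂plus : Distr := (1 / 2 : ℂ) • prodDplus 0 0

/-- The basic causal distribution `d₂(x) = ½ [D₀⁽⁺⁾(x)² - D₀⁽⁺⁾(-x)²]` of one-loop graphs. -/
def d₂ : Distr := (1 / 2 : ℂ) • (prodDplus 0 0 - reflect (prodDplus 0 0))

/-- `dF` is a Feynman propagator of `d₂`: there is a causal splitting `d₂ = adv - ret` into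
distributions supported in the closed forward and backward cones, and `dF = ret + d₂⁽⁺⁾`. -/
def IsFeynman (dF : Distr) : Prop :=
  ∃ adv ret : Distr, d₂ = adv - ret ∧ Distribution.dsupport adv ⊆ forwardCone ∧
    Distribution.dsupport ret ⊆ backwardCone ∧ dF = ret + d₂plus

/-! ## Wick polynomials in the free fields

The Fock space is generated from the vacuum by the massless free fields `h_{μν}`, `u_μ`, `ũ_μ`.
A Wick (normally ordered) polynomial in these fields and their derivatives at the points `x₁, x₂` is
handled through its symbol: inside a normally ordered product the fields commute up to Fermi signs,
they satisfy the wave equation, `h` is symmetric, and there are no other relations. -/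

/-- The components (with lower indices) of the basic fields: the graviton field `h_{μν}` and the
ghost fields `u_μ`, `ũ_μ`. -/
inductive FieldComp
  | h (μ ν : Fin 4)
  | u (μ : Fin 4)
  | ut (μ : Fin 4)

/-- The Fermi parity: `0` for `h`, `1` for the ghosts. -/
def FieldComp.parity : FieldComp → ℕ
  | .h _ _ => 0
  | .u _ => 1
  | .ut _ => 1

/-- A derivative `∂^α φ` of a field component. -/
structure Jet where
  field : FieldComp
  deriv : Fin 4 →₀ ℕ

/-- A derivative of a field component, at the point `x₁` (index `0`) or `x₂` (index `1`). -/
abbrev Gen := Fin 2 × Jet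

/-- The Fermi parity of a generator. -/
def Gen.parity (a : Gen) : ℕ := a.2.field.parity

/-- The relations between the (derivatives of the) fields inside a normally ordered product:
symmetry of `h`, the wave equation, and graded commutativity. -/
inductive WickRel : FreeAlgebra ℂ Gen → FreeAlgebra ℂ Gen → Prop
  | symm (k : Fin 2) (μ ν : Fin 4) (α : Fin 4 →₀ ℕ) :
      WickRel (FreeAlgebra.ι ℂ ((k, ⟨.h μ ν, α⟩) : Gen)) (FreeAlgebra.ι ℂ ((k, ⟨.h ν μ, α⟩) : Gen))
  | wave (k : Fin 2) (φ : FieldComp) (α : Fin 4 →₀ ℕ) :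
      WickRel (∑ μ, ε μ • FreeAlgebra.ι ℂ ((k, ⟨φ, α + Finsupp.single μ 2⟩) : Gen)) 0
  | comm (a b : Gen) :
      WickRel (FreeAlgebra.ι ℂ a * FreeAlgebra.ι ℂ b)
        ((-1 : ℂ) ^ (a.parity * b.parity) • (FreeAlgebra.ι ℂ b * FreeAlgebra.ι ℂ a))

/-- The algebra of Wick polynomials `W(x₁, x₂)`, with the normally ordered product. -/
def Wick : Type := RingQuot WickRel

instance : Ring Wick := inferInstanceAs (Ring (RingQuot WickRel))

instance : Algebra ℂ Wick := inferInstanceAs (Algebra ℂ (RingQuot WickRel))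

/-- The quotient map from the free algebra. -/
def toWick : FreeAlgebra ℂ Gen →ₐ[ℂ] Wick := RingQuot.mkAlgHom ℂ WickRel

theorem toWick_rel {x y : FreeAlgebra ℂ Gen} (h : WickRel x y) : toWick x = toWick y :=
  RingQuot.mkAlgHom_rel ℂ h

/-- The generator `∂^α φ(x_k)`. -/
def gen (a : Gen) : Wick := toWick (FreeAlgebra.ι ℂ a)

theorem gen_symm (k : Fin 2) (μ ν : Fin 4) (α : Fin 4 →₀ ℕ) :
    gen (k, ⟨.h μ ν, α⟩) = gen (k, ⟨.h ν μ, α⟩) :=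
  toWick_rel (WickRel.symm k μ ν α)

theorem gen_wave (k : Fin 2) (φ : FieldComp) (α : Fin 4 →₀ ℕ) :
    ∑ μ, ε μ • gen (k, ⟨φ, α + Finsupp.single μ 2⟩) = 0 := by
  simpa [gen] using toWick_rel (WickRel.wave k φ α)

theorem gen_comm (a b : Gen) :
    gen a * gen b = (-1 : ℂ) ^ (a.parity * b.parity) • (gen b * gen a) := by
  simpa [gen] using toWick_rel (WickRel.comm a b)

/-- Algebra homomorphisms out of the Wick algebra are given by values on the generators that
respect the relations. -/
def wickLift {A : Type} [Ring A] [Algebra ℂ A] (v : Gen → A)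
    (hsymm : ∀ k μ ν α, v (k, ⟨.h μ ν, α⟩) = v (k, ⟨.h ν μ, α⟩))
    (hwave : ∀ k φ α, ∑ μ, ε μ • v (k, ⟨φ, α + Finsupp.single μ 2⟩) = 0)
    (hcomm : ∀ a b : Gen, v a * v b = (-1 : ℂ) ^ (a.parity * b.parity) • (v b * v a)) :
    Wick →ₐ[ℂ] A :=
  RingQuot.liftAlgHom ℂ ⟨FreeAlgebra.lift ℂ v, by
    intro x y h
    cases h with
    | symm k μ ν α => simpa using hsymm k μ ν α
    | wave k φ α => simpa using hwave k φ α
    | comm a b => simpa using hcomm a b⟩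

theorem wickLift_gen {A : Type} [Ring A] [Algebra ℂ A] (v : Gen → A) (h₁ h₂ h₃) (a : Gen) :
    wickLift v h₁ h₂ h₃ (gen a) = v a := by
  exact (RingQuot.liftAlgHom_mkAlgHom_apply ℂ _ _ _).trans (FreeAlgebra.lift_ι_apply v a)

/-- The homomorphism `A ↦ ((-1)^{s|A|} A, D A; 0, A)` whose off-diagonal entry is the derivation
`D` with values `v` on the generators. -/
def wickDerHom (s : ℕ) (v : Gen → Wick)
    (hsymm : ∀ k μ ν α, v (k, ⟨.h μ ν, α⟩) = v (k, ⟨.h ν μ, α⟩))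
    (hwave : ∀ k φ α, ∑ μ, ε μ • v (k, ⟨φ, α + Finsupp.single μ 2⟩) = 0)
    (hcomm : ∀ a b : Gen, gen a * v b = (-1 : ℂ) ^ (a.parity * (b.parity + s)) • (v b * gen a)) :
    Wick →ₐ[ℂ] Matrix (Fin 2) (Fin 2) Wick :=
  wickLift (A := Matrix (Fin 2) (Fin 2) Wick)
    (fun a => !![(-1 : ℂ) ^ (s * a.parity) • gen a, v a; 0, gen a])
    (by
      intro k μ ν α
      have h := gen_symm k μ ν α
      simp only [h, hsymm k μ ν α]
      rfl)
    (by
      intro k φ α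
      have h := gen_wave k φ α
      ext i j
      fin_cases i <;> fin_cases j
      · simp only [Gen.parity, Matrix.sum_apply, Matrix.smul_apply]
        simp [smul_comm (ε _), ← Finset.smul_sum, h]
      · simpa [Matrix.sum_apply] using hwave k φ α
      · simp [Matrix.sum_apply]
      · simpa [Matrix.sum_apply] using h)
    (by
      intro a b
      have h := gen_comm a b
      ext i j
      fin_cases i <;> fin_cases j
      · simp [Matrix.mul_apply, Fin.sum_univ_two, h, smul_smul]
        ring_nf
      · have h1 := hcomm a b
        have h2 := hcomm b a
        simp only [Fin.zero_eta, Fin.mk_one, Matrix.mul_apply, Fin.sum_univ_two, Matrix.smul_apply]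
        simp only [Matrix.of_apply, Matrix.cons_val', Matrix.cons_val_zero, Matrix.cons_val_one,
          Matrix.cons_val_fin_one, smul_mul_assoc, h1, h2, smul_add, smul_smul, ← pow_add]
        have e1 : s * a.parity + a.parity * (b.parity + s) =
            a.parity * b.parity + 2 * (s * a.parity) := by ring
        have e2 : a.parity * b.parity + (s * b.parity + b.parity * (a.parity + s)) =
            2 * (a.parity * b.parity + s * b.parity) := by ring
        rw [e1, e2, pow_add, pow_mul, pow_mul]
        simp [add_comm]
      · simp [Matrix.mul_apply, Fin.sum_univ_two]
      · simp [Matrix.mul_apply, Fin.sum_univ_two, h])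

/-- The unique linear map `D` on the Wick algebra with `D (gen a) = v a` and the Leibniz rule
`D (A B) = D A · B + (-1)^{s|A|} A · D B`, where `s = 0` for even and `s = 1` for odd derivations. -/
def wickDer (s : ℕ) (v : Gen → Wick)
    (hsymm : ∀ k μ ν α, v (k, ⟨.h μ ν, α⟩) = v (k, ⟨.h ν μ, α⟩))
    (hwave : ∀ k φ α, ∑ μ, ε μ • v (k, ⟨φ, α + Finsupp.single μ 2⟩) = 0)
    (hcomm : ∀ a b : Gen, gen a * v b = (-1 : ℂ) ^ (a.parity * (b.parity + s)) • (v b * gen a)) :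
    Wick →ₗ[ℂ] Wick :=
  Matrix.entryLinearMap ℂ Wick (0 : Fin 2) (1 : Fin 2) ∘ₗ
    (wickDerHom s v hsymm hwave hcomm).toLinearMap

theorem wickDer_gen (s : ℕ) (v : Gen → Wick) (h₁ h₂ h₃) (a : Gen) :
    wickDer s v h₁ h₂ h₃ (gen a) = v a := by
  simp [wickDer, wickDerHom, wickLift_gen]

theorem wick_hom_ext {A : Type} [Ring A] [Algebra ℂ A] {f g : Wick →ₐ[ℂ] A}
    (h : ∀ a, f (gen a) = g (gen a)) : f = g :=
  RingQuot.ringQuot_ext' ℂ f g (FreeAlgebra.hom_ext (funext h))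

theorem wick_induction {p : Wick → Prop} (h0 : ∀ c : ℂ, p (algebraMap ℂ Wick c))
    (hg : ∀ a, p (gen a)) (hmul : ∀ A B, p A → p B → p (A * B))
    (hadd : ∀ A B, p A → p B → p (A + B)) (A : Wick) : p A := by
  obtain ⟨x, rfl⟩ : ∃ x, toWick x = A := RingQuot.mkAlgHom_surjective ℂ WickRel A
  induction x using FreeAlgebra.induction with
  | grade0 r => simpa using h0 r
  | grade1 a => exact hg a
  | mul a b ha hb => simpa using hmul _ _ ha hb
  | add a b ha hb => simpa using hadd _ _ ha hb

/-- The Leibniz rule. -/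
theorem wickDer_gen_mul (s : ℕ) (v : Gen → Wick) (h₁ h₂ h₃) (a : Gen) (B : Wick) :
    wickDer s v h₁ h₂ h₃ (gen a * B) =
      v a * B + (-1 : ℂ) ^ (s * a.parity) • (gen a * wickDer s v h₁ h₂ h₃ B) := by
  have key : ∀ B : Wick, wickDerHom s v h₁ h₂ h₃ B 1 0 = 0 ∧ wickDerHom s v h₁ h₂ h₃ B 1 1 = B := by
    intro B
    induction B using wick_induction with
    | h0 c => simp [Matrix.algebraMap_matrix_apply]
    | hg a => simp [wickDerHom, wickLift_gen]
    | hmul A B hA hB => simp [Matrix.mul_apply, Fin.sum_univ_two, hA, hB]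
    | hadd A B hA hB => simp [hA, hB]
  simp only [wickDer, LinearMap.comp_apply, AlgHom.toLinearMap_apply, map_mul,
    Matrix.entryLinearMap_apply, Matrix.mul_apply, Fin.sum_univ_two, (key B).2]
  simp [wickDerHom, wickLift_gen, add_comm]

/-- The partial derivative `∂_μ` with respect to the point `x_k` on Wick polynomials. -/
def wickPartial (k : Fin 2) (μ : Fin 4) : Wick →ₗ[ℂ] Wick :=
  wickDer 0
    (fun a => if a.1 = k then gen (a.1, ⟨a.2.field, a.2.deriv + Finsupp.single μ 1⟩) else 0)
    (by
      intro l ρ σ α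
      simp only
      rw [gen_symm])
    (by
      intro l φ α
      by_cases hl : l = k
      · have h := gen_wave l φ (α + Finsupp.single μ 1)
        simp only [add_right_comm α (Finsupp.single μ 1)] at h
        simpa [hl] using hl ▸ h
      · simp [hl])
    (by
      intro a b
      by_cases hb : b.1 = k
      · simp only [hb, if_true]
        rw [gen_comm]
        rfl
      · simp [hb])

/-- The values of `d_Q` on the derivatives of the basic fields, that is
`[Q, h_{μν}] = -(i/2) (∂_μ u_ν + ∂_ν u_μ - η_{μν} ∂_ρ u^ρ)`, `[Q, u_μ] = 0` and
`[Q, ũ_μ] = i ∂^ν h_{μν}`. -/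
def brstGen (a : Gen) : Wick :=
  match a.2.field with
  | .h μ ν => (-(Complex.I / 2)) •
      (gen (a.1, ⟨.u ν, a.2.deriv + Finsupp.single μ 1⟩) +
        gen (a.1, ⟨.u μ, a.2.deriv + Finsupp.single ν 1⟩) -
        η μ ν • ∑ ρ, ε ρ • gen (a.1, ⟨.u ρ, a.2.deriv + Finsupp.single ρ 1⟩))
  | .u _ => 0
  | .ut μ => Complex.I • ∑ ν, ε ν • gen (a.1, ⟨.h μ ν, a.2.deriv + Finsupp.single ν 1⟩)

/-- The graded commutator `d_Q = [Q, ·]` with the gauge charge, on Wick polynomials: the odd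
derivation with the values `brstGen` on the fields, commuting with the partial derivatives. -/
def wickBRST : Wick →ₗ[ℂ] Wick :=
  wickDer 1 brstGen
    (by
      intro k μ ν α
      have hη : η μ ν = η ν μ := by
        unfold η
        by_cases h : μ = ν
        · subst h; rfl
        · simp [h, Ne.symm h]
      simp only [brstGen, hη]
      rw [add_comm (gen _)])
    (by
      intro k φ α
      have h (ψ : FieldComp) (ρ : Fin 4) :
          ∑ μ, ε μ • gen (k, ⟨ψ, α + Finsupp.single μ 2 + Finsupp.single ρ 1⟩) = 0 := by
        have := gen_wave k ψ (α + Finsupp.single ρ 1)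
        simpa only [add_right_comm α (Finsupp.single ρ 1)] using this
      cases φ with
      | h ρ σ =>
        simp only [brstGen, smul_add, smul_sub, Finset.sum_add_distrib, Finset.sum_sub_distrib,
          smul_comm (ε _) (-(Complex.I / 2)), smul_comm (ε _) (η ρ σ), ← Finset.smul_sum, h]
        simp only [Finset.smul_sum]
        rw [Finset.sum_comm]
        simp_rw [smul_comm (ε _) (ε _), ← Finset.smul_sum]
        simp [h]
      | u ρ => simp [brstGen]
      | ut ρ =>
        simp only [brstGen, smul_comm (ε _) Complex.I, ← Finset.smul_sum]
        simp only [Finset.smul_sum]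
        rw [Finset.sum_comm]
        simp_rw [smul_comm (ε _) (ε _), ← Finset.smul_sum]
        simp [h])
    (by
      rintro ⟨k, φ, α⟩ ⟨l, ψ, β⟩
      cases φ <;> cases ψ <;>
        simp [brstGen, Gen.parity, FieldComp.parity, mul_add, add_mul, mul_sub, sub_mul,
          Finset.mul_sum, Finset.sum_mul, gen_comm (k, _)]
      all_goals
        simp only [smul_add, smul_sub]
        abel)

/-- The exchange `W(x₁, x₂) ↦ W(x₂, x₁)` of Wick polynomials. -/
def wickSwap : Wick →ₐ[ℂ] Wick :=
  wickLift (fun a => gen (a.1.rev, a.2))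
    (fun _ _ _ _ => gen_symm _ _ _ _) (fun _ _ _ => gen_wave _ _ _) (fun _ _ => gen_comm _ _)

/-! ## Translation invariant two-point expressions -/

/-- The expressions `∑_j c_j(x₁ - x₂) W_j(x₁, x₂)` with distributions `c_j` and Wick
polynomials `W_j`. -/
abbrev Op := Distr ⊗[ℂ] Wick

/-- The partial derivative `∂/∂x₁^μ` (for `k = 0`) or `∂/∂x₂^μ` (for `k = 1`), acting by the Leibniz
rule on `c(x₁ - x₂) W(x₁, x₂)`. -/
def opPartial (k : Fin 2) (μ : Fin 4) : Op →ₗ[ℂ] Op :=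
  (-1 : ℂ) ^ (k : ℕ) • TensorProduct.map (partialD μ) LinearMap.id +
    TensorProduct.map LinearMap.id (wickPartial k μ)

/-- The graded commutator `d_Q = [Q, ·]` on two-point expressions. -/
def opBRST : Op →ₗ[ℂ] Op := TensorProduct.map LinearMap.id wickBRST

/-- The exchange `(1 ↔ 2)` of the two points:
`c(x₁ - x₂) W(x₁, x₂) ↦ c(x₂ - x₁) W(x₂, x₁)`. -/
def opSwap : Op →ₗ[ℂ] Op := TensorProduct.map reflect wickSwap.toLinearMap

/-- The formal expressions `∑_j p_j(∂) ⊗ W_j`. -/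
abbrev Cochain := MvPolynomial (Fin 4) ℂ ⊗[ℂ] Wick

/-- The expression `∑_j p_j(∂) d(x₁ - x₂) W_j(x₁, x₂)` given by a formal expression
`∑_j p_j(∂) ⊗ W_j` and a distribution `d`. -/
def cochainAt (d : Distr) : Cochain →ₗ[ℂ] Op := TensorProduct.map (diffOp d) LinearMap.id

/-! ## The one-loop part of the causal commutator -/

/-- A Wick monomial at a single point, written as the list of its factors. -/
abbrev Word := List Jet

/-- The Fermi parity of a list of factors. -/
def wordParity (w : Word) : ℕ := (w.map fun j => j.field.parity).sum

/-- The Wick monomial at the point `x_k`. -/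
def wordAt (k : Fin 2) (w : Word) : Wick := (w.map fun j => gen (k, j)).prod

/-- The numbers `G` in the two-point functions
`⟨Ω, φ(x₁) ψ(x₂) Ω⟩ = G D₀⁽⁺⁾(x₁ - x₂)` of the basic fields. -/
def twoPoint : FieldComp → FieldComp → ℂ
  | .h μ ν, .h ρ σ => -(Complex.I / 2) * (η μ ρ * η ν σ + η ν ρ * η μ σ - η μ ν * η ρ σ)
  | .u μ, .ut ν => Complex.I * η μ ν
  | .ut μ, .u ν => -Complex.I * η μ ν
  | _, _ => 0

/-- The numerical factor of the contraction of the `i`-th factor of `a(x₁)` with the `j`-th factor of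
`b(x₂)` in the operator product `a(x₁) b(x₂)`: the Fermi sign for moving the two factors next to each
other between the remaining ones, and the number `± G` in
`⟨Ω, ∂^α φ(x₁) ∂^β ψ(x₂) Ω⟩ = (-1)^{|β|} G (∂^{α+β} D₀⁽⁺⁾)(x₁ - x₂)`. -/
def contractionFactor (a b : Word) (i : Fin a.length) (j : Fin b.length) : ℂ :=
  (-1) ^ ((a.get i).field.parity * wordParity (a.drop (i + 1)) +
      (b.get j).field.parity * wordParity (b.take j)) *
    ((-1) ^ (∑ μ, (b.get j).deriv μ) * twoPoint (a.get i).field (b.get j).field)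

/-- The terms with exactly two contractions in the Wick expansion of the operator product
`a(x₁) b(x₂)`. The two contractions are chosen one after the other, so that each pair of
contractions occurs twice; this is compensated by the factor `1/2`. -/
def oneLoopProduct (a b : Word) : Op :=
  (1 / 2 : ℂ) • ∑ i : Fin a.length, ∑ j : Fin b.length,
    ∑ k : Fin (a.eraseIdx i).length, ∑ l : Fin (b.eraseIdx j).length,
      (contractionFactor a b i j * contractionFactor (a.eraseIdx i) (b.eraseIdx j) k l) •
        (prodDplus ((a.get i).deriv + (b.get j).deriv)
            (((a.eraseIdx i).get k).deriv + ((b.eraseIdx j).get l).deriv) ⊗ₜ[ℂ]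
          (wordAt 0 ((a.eraseIdx i).eraseIdx k) * wordAt 1 ((b.eraseIdx j).eraseIdx l)))

/-- The one-loop part `D₍₁₎(A(x₁), B(x₂))` of the causal (graded) commutator
`A(x₁) B(x₂) - (-1)^{|A||B|} B(x₂) A(x₁)`, bilinear in the linear combinations of Wick monomials
`A` and `B`. -/
def oneLoopCommutator : (Word →₀ ℂ) →ₗ[ℂ] (Word →₀ ℂ) →ₗ[ℂ] Op :=
  Finsupp.linearCombination ℂ fun a => Finsupp.linearCombination ℂ fun b =>
    oneLoopProduct a b - (-1 : ℂ) ^ (wordParity a * wordParity b) • opSwap (oneLoopProduct b a)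

/-- `t` is the one-loop chronological product `T₍₁₎(A(x₁), B(x₂))` belonging to the Feynman
propagator `dF`: it arises from `D₍₁₎(A(x₁), B(x₂)) = ∑_j p_j(∂) d₂(x₁ - x₂) W_j(x₁, x₂)` by
replacing `d₂` by `dF`. -/
def IsOneLoopChronological (A B : Word →₀ ℂ) (dF : Distr) (t : Op) : Prop :=
  ∃ C : Cochain, oneLoopCommutator A B = cochainAt d₂ C ∧ t = cochainAt dF C

/-! ## The interaction Lagrangian of massless gravity -/

/-- The field `h_{μν}`. -/
def hJ (μ ν : Fin 4) : Jet := ⟨.h μ ν, 0⟩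

/-- The derivative `∂_ρ h_{μν}`. -/
def dhJ (ρ μ ν : Fin 4) : Jet := ⟨.h μ ν, Finsupp.single ρ 1⟩

/-- The field `u_μ`. -/
def uJ (μ : Fin 4) : Jet := ⟨.u μ, 0⟩

/-- The derivative `∂_ρ u_μ`. -/
def duJ (ρ μ : Fin 4) : Jet := ⟨.u μ, Finsupp.single ρ 1⟩

/-- The derivative `∂_ρ ũ_μ`. -/
def dutJ (ρ μ : Fin 4) : Jet := ⟨.ut μ, Finsupp.single ρ 1⟩

/-- `T₁ = - h_{μν} ∂^μ h ∂^ν h`, where `h = η^{ρσ} h_{ρσ}` is the trace. -/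
def T₁ : Word →₀ ℂ := ∑ μ, ∑ ν, ∑ ρ, ∑ σ,
  Finsupp.single [hJ μ ν, dhJ μ ρ ρ, dhJ ν σ σ] (-(ε μ * ε ν * ε ρ * ε σ))

/-- `T₂ = 2 h^{μν} ∂_μ h_{ρσ} ∂_ν h^{ρσ}`. -/
def T₂ : Word →₀ ℂ := ∑ μ, ∑ ν, ∑ ρ, ∑ σ,
  Finsupp.single [hJ μ ν, dhJ μ ρ σ, dhJ ν ρ σ] (2 * (ε μ * ε ν * ε ρ * ε σ))

/-- `T₃ = 4 h_{μν} ∂_ρ h^{μσ} ∂_σ h^{νρ}`. -/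
def T₃ : Word →₀ ℂ := ∑ μ, ∑ ν, ∑ ρ, ∑ σ,
  Finsupp.single [hJ μ ν, dhJ ρ μ σ, dhJ σ ν ρ] (4 * (ε μ * ε ν * ε ρ * ε σ))

/-- `T₄ = 2 h_{μν} ∂_ρ h^{μν} ∂^ρ h`. -/
def T₄ : Word →₀ ℂ := ∑ μ, ∑ ν, ∑ ρ, ∑ σ,
  Finsupp.single [hJ μ ν, dhJ ρ μ ν, dhJ ρ σ σ] (2 * (ε μ * ε ν * ε ρ * ε σ))

/-- `T₅ = - 4 h_{μν} ∂_ρ h^{μσ} ∂^ρ h^ν_σ`. -/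
def T₅ : Word →₀ ℂ := ∑ μ, ∑ ν, ∑ ρ, ∑ σ,
  Finsupp.single [hJ μ ν, dhJ ρ μ σ, dhJ ρ ν σ] (-4 * (ε μ * ε ν * ε ρ * ε σ))

/-- `T₆ = - 4 u^μ ∂_ρ ũ_σ ∂_μ h^{ρσ}`. -/
def T₆ : Word →₀ ℂ := ∑ μ, ∑ ρ, ∑ σ,
  Finsupp.single [uJ μ, dutJ ρ σ, dhJ μ ρ σ] (-4 * (ε μ * ε ρ * ε σ))

/-- `T₇ = 4 ∂_ν u^ρ ∂_μ ũ_ρ h^{μν}`. -/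
def T₇ : Word →₀ ℂ := ∑ μ, ∑ ν, ∑ ρ,
  Finsupp.single [duJ ν ρ, dutJ μ ρ, hJ μ ν] (4 * (ε μ * ε ν * ε ρ))

/-- `T₈ = - 4 ∂^ρ u_ρ ∂_μ ũ_ν h^{μν}`. -/
def T₈ : Word →₀ ℂ := ∑ μ, ∑ ν, ∑ ρ,
  Finsupp.single [duJ ρ ρ, dutJ μ ν, hJ μ ν] (-4 * (ε μ * ε ν * ε ρ))

/-- `T₉ = 4 ∂_μ u^ρ ∂_ρ ũ_ν h^{μν}`. -/
def T₉ : Word →₀ ℂ := ∑ μ, ∑ ν, ∑ ρ,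
  Finsupp.single [duJ μ ρ, dutJ ρ ν, hJ μ ν] (4 * (ε μ * ε ν * ε ρ))

/-- The interaction Lagrangian `T = κ ∑_{j=1}^9 T_j` of massless gravity. -/
def lagrangian (κ : ℝ) : Word →₀ ℂ :=
  (κ : ℂ) • (T₁ + T₂ + T₃ + T₄ + T₅ + T₆ + T₇ + T₈ + T₉)

end MasslessGravity

end

open MasslessGravity

noncomputable section

open scoped SchwartzMap TensorProduct
open MeasureTheory

namespace MasslessGravity

/-! The proof rests on collinear kinematics on the light cone. Modulo relative coboundaries,
derivatives of the two external fields can be integrated by parts onto the coefficient, and the wave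
equation then kills every multiple of the wave operator there. A bilinear term is therefore known
once its coefficient polynomial is known on the null cone of a single momentum k (`mkQ_pairTerm`,
`pairClass_eq_zero`, `mem_span_boxPoly`).

The loop fits into this picture. By Lorentz invariance ∂^{γ₁}D₀⁽⁺⁾ ∂^{γ₂}D₀⁽⁺⁾ = P(∂)(D₀⁽⁺⁾)² with P
homogeneous and, modulo the wave operator, equal to a multiple of ∂^{γ₁+γ₂} that depends only on
|γ₁| and |γ₂| (`exists_prodDplus_eq_diffOp`). Heuristically, if the sum k = p + q of two light-like
momenta is itself light-like, then p and q are fractions of k, and the multiple is a moment of these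
fractions. The actual argument is a recursion for tensor integrals in the relative momentum
(`loopInt_relMom_mul`), which follows from invariance under the Lorentz transformations that fix p +
q. In the quotient by relative coboundaries all derivatives, on internal and external lines alike,
thus become powers of the same null k (`mkQ_loopTerm`). The numerical factors depend only on the
parities and the numbers of derivatives of the factors, so a loop of two complete terms T_i, T_j is
computed by contracting their vertices at k (`mkQ_loopCochainL`, `evalPair_contrWordL`).

Complete k to a complex null frame whose vectors have boost weights 1, -1, 0, 0, with k of weight 1.
Every vertex of the Lagrangian has weight two at k: either the two derivatives are contracted with
fields and supply two vectors k, all other indices being paired with opposite weights, or the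
derivatives are contracted with each other and k² = 0. Two-point functions pair opposite weights, so
two contractions leave external legs of total weight four. A single field has weight at most two,
attained only by k^μ k^ν h_{μν}. What remains is a multiple, the same for all frames, of k^μ k^ν
h_{μν}(x₁) k^ρ k^σ h_{ρσ}(x₂) (`exists_contrTriple_eq`). This is a relative coboundary, because d_Q
of the antighost is the divergence of h and the ghost terms that d_Q also produces contain the wave
operator (`sum_pairClass_h_h_eq_zero`).

The resulting identity is one between formal expressions with polynomials in ∂ as coefficients, and
inserting any distribution for d₂ respects it. Injectivity of P ↦ P(∂)d₂ (`diffOp_d₂_injective`)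
makes the formal expression of the commutator unique, so the replacement of d₂ is well defined, and
it transfers the exchange symmetry of the commutator to the formal expression. Averaging over the
exchange then puts the two divergences into the required symmetric form. -/

/-! ## Phase-space integrals of polynomials -/

/-- Polynomials in the components of the two momenta of a loop. -/
abbrev MomPoly := MvPolynomial (Fin 4 ⊕ Fin 4) ℂ

/-- The point `(i p, i q)` at which polynomials in two light-like momenta are evaluated. -/
def momPoint (z : Mom × Mom) : Fin 4 ⊕ Fin 4 → ℂ :=
  Sum.elim (fun μ => Complex.I * (onShell z.1 μ : ℂ)) (fun μ => Complex.I * (onShell z.2 μ : ℂ))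

/-- The integrand of the two-particle phase-space integral with a polynomial weight. -/
def loopIntegrand (f : MomPoly) (g : 𝓢(Minkowski, ℂ)) (z : Mom × Mom) : ℂ :=
  MvPolynomial.eval (momPoint z) f / ((2 * ‖z.1‖ : ℝ) * (2 * ‖z.2‖ : ℝ) : ℂ) * g (loopArg z)

/-- The two-particle phase-space integral with a polynomial weight. -/
def loopInt (f : MomPoly) (g : 𝓢(Minkowski, ℂ)) : ℂ := ∫ z : Mom × Mom, loopIntegrand f g z

theorem eval_momPoint_monomial (u : Fin 4 ⊕ Fin 4 →₀ ℕ) (z : Mom × Mom) (a : ℂ) :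
    MvPolynomial.eval (momPoint z) (MvPolynomial.monomial u a) =
      a * (momFactor (u.comapDomain Sum.inl Sum.inl_injective.injOn) z.1 *
        momFactor (u.comapDomain Sum.inr Sum.inr_injective.injOn) z.2) := by
  rw [MvPolynomial.eval_monomial, Finsupp.prod_fintype _ _ (by simp), Fintype.prod_sum_type]
  rfl

theorem loopIntegrand_monomial (u : Fin 4 ⊕ Fin 4 →₀ ℕ) (a : ℂ) (g : 𝓢(Minkowski, ℂ))
    (z : Mom × Mom) :
    loopIntegrand (MvPolynomial.monomial u a) g z =
      a * (loopWeight (u.comapDomain Sum.inl Sum.inl_injective.injOn)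
        (u.comapDomain Sum.inr Sum.inr_injective.injOn) z * g (loopArg z)) := by
  rw [loopIntegrand, eval_momPoint_monomial, loopWeight]
  ring

theorem loopIntegrand_add (f₁ f₂ : MomPoly) (g : 𝓢(Minkowski, ℂ)) (z : Mom × Mom) :
    loopIntegrand (f₁ + f₂) g z = loopIntegrand f₁ g z + loopIntegrand f₂ g z := by
  simp only [loopIntegrand, map_add]
  ring

theorem integrable_loopIntegrand (f : MomPoly) (g : 𝓢(Minkowski, ℂ)) :
    Integrable (loopIntegrand f g) := by
  induction f using MvPolynomial.induction_on' with
  | monomial u a =>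
    have := (integrable_loop (u.comapDomain Sum.inl Sum.inl_injective.injOn)
      (u.comapDomain Sum.inr Sum.inr_injective.injOn) g).const_mul a
    exact this.congr (Filter.Eventually.of_forall fun z => (loopIntegrand_monomial u a g z).symm)
  | add f₁ f₂ h₁ h₂ =>
    exact (h₁.add h₂).congr (Filter.Eventually.of_forall fun z =>
      (loopIntegrand_add f₁ f₂ g z).symm)

theorem loopInt_add (f₁ f₂ : MomPoly) (g : 𝓢(Minkowski, ℂ)) :
    loopInt (f₁ + f₂) g = loopInt f₁ g + loopInt f₂ g := by
  rw [loopInt, loopInt, loopInt, ← integral_add (integrable_loopIntegrand f₁ g)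
    (integrable_loopIntegrand f₂ g)]
  exact integral_congr_ae (Filter.Eventually.of_forall fun z => loopIntegrand_add f₁ f₂ g z)

theorem loopInt_smul (a : ℂ) (f : MomPoly) (g : 𝓢(Minkowski, ℂ)) :
    loopInt (a • f) g = a * loopInt f g := by
  rw [loopInt, loopInt, ← integral_const_mul]
  congr 1
  funext z
  simp only [loopIntegrand, MvPolynomial.smul_eval]
  ring

/-- The two-particle phase-space integral, as a linear map of the weight. -/
def loopIntL (g : 𝓢(Minkowski, ℂ)) : MomPoly →ₗ[ℂ] ℂ where
  toFun f := loopInt f g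
  map_add' f₁ f₂ := loopInt_add f₁ f₂ g
  map_smul' a f := loopInt_smul a f g

theorem loopIntL_apply (f : MomPoly) (g : 𝓢(Minkowski, ℂ)) : loopIntL g f = loopInt f g := rfl

theorem loopInt_congr {f₁ f₂ : MomPoly}
    (h : ∀ z, MvPolynomial.eval (momPoint z) f₁ = MvPolynomial.eval (momPoint z) f₂)
    (g : 𝓢(Minkowski, ℂ)) : loopInt f₁ g = loopInt f₂ g := by
  simp only [loopInt, loopIntegrand, h]

/-- The distribution `∫∫ f(ip, iq) e^{i (p+q)·x}`; it is `∂^{γ₁}D₀⁽⁺⁾ ∂^{γ₂}D₀⁽⁺⁾` if `f` is a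
monomial. -/
def loopDistr : MomPoly →ₗ[ℂ] Distr :=
  (MvPolynomial.basisMonomials (Fin 4 ⊕ Fin 4) ℂ).constr ℂ fun u =>
    prodDplus (u.comapDomain Sum.inl Sum.inl_injective.injOn)
      (u.comapDomain Sum.inr Sum.inr_injective.injOn)

theorem loopDistr_monomial_one (u : Fin 4 ⊕ Fin 4 →₀ ℕ) :
    loopDistr (MvPolynomial.monomial u 1) =
      prodDplus (u.comapDomain Sum.inl Sum.inl_injective.injOn)
        (u.comapDomain Sum.inr Sum.inr_injective.injOn) := by
  rw [loopDistr, show MvPolynomial.monomial u (1 : ℂ) = MvPolynomial.basisMonomials _ ℂ u from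
    (congrFun (MvPolynomial.coe_basisMonomials _ ℂ) u).symm, Module.Basis.constr_basis]

theorem prodDplus_apply (γ₁ γ₂ : Fin 4 →₀ ℕ) (φ : 𝓢(Minkowski, ℂ)) :
    prodDplus γ₁ γ₂ φ = (Complex.I / (2 * Real.pi) ^ 3) ^ 2 *
      ∫ z : Mom × Mom, loopWeight γ₁ γ₂ z * (FourierTransform.fourier φ) (loopArg z) := rfl

/-- Since the Fourier transform of a test function can be any Schwartz function, identities between
these distributions may be proved as identities of phase-space integrals with polynomial weights. -/
theorem loopDistr_apply (f : MomPoly) (φ : 𝓢(Minkowski, ℂ)) :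
    loopDistr f φ = (Complex.I / (2 * Real.pi) ^ 3) ^ 2 *
      loopInt f (FourierTransform.fourier φ) := by
  induction f using MvPolynomial.induction_on' with
  | monomial u a =>
    rw [show MvPolynomial.monomial u a = a • MvPolynomial.monomial u (1 : ℂ) by
      simp [MvPolynomial.smul_monomial], map_smul, loopDistr_monomial_one, loopInt_smul]
    change a * prodDplus _ _ φ = _
    rw [prodDplus_apply, loopInt]
    simp only [loopIntegrand_monomial, one_mul]
    ring
  | add f₁ f₂ h₁ h₂ =>
    rw [map_add, loopInt_add, mul_add, ← h₁, ← h₂]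
    rfl

/-! ### Integration by parts along lines -/

/-- The point of momentum space with `i`-th coordinate `t` and remaining coordinates `y`. -/
def linePt (i : Fin 3) (y : Fin 2 → ℝ) (t : ℝ) : Mom := WithLp.toLp 2 (i.insertNth t y)

theorem measurePreserving_linePt (i : Fin 3) :
    MeasurePreserving
      (((MeasurableEquiv.piFinSuccAbove (fun _ : Fin 3 => ℝ) i).symm).trans
        (MeasurableEquiv.toLp 2 (Fin 3 → ℝ))) := by
  exact (volume_preserving_piFinSuccAbove (fun _ : Fin 3 => ℝ) i).symm.trans
    (PiLp.volume_preserving_toLp (Fin 3))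

/-- By Fubini it suffices to integrate a derivative over almost every line parallel to the i-th axis
of the first momentum, where integrability of H and K removes the boundary terms. The line y = 0
passes through the origin, at which the energy |p| is not differentiable, so nothing is asked of it.
-/
theorem integral_eq_zero_of_hasDerivAt_linePt (i : Fin 3) {H K : Mom × Mom → ℂ}
    (hH : Integrable H) (hK : Integrable K)
    (hd : ∀ y : Fin 2 → ℝ, y ≠ 0 → ∀ q t,
      HasDerivAt (fun t => H (linePt i y t, q)) (K (linePt i y t, q)) t) :
    ∫ z, K z = 0 := by
  let e₀ := ((MeasurableEquiv.piFinSuccAbove (fun _ : Fin 3 => ℝ) i).symm).trans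
        (MeasurableEquiv.toLp 2 (Fin 3 → ℝ))
  have h₀ : MeasurePreserving e₀ := measurePreserving_linePt i
  let e : ℝ × ((Fin 2 → ℝ) × Mom) ≃ᵐ Mom × Mom :=
    MeasurableEquiv.prodAssoc.symm.trans (e₀.prodCongr (MeasurableEquiv.refl Mom))
  have he : MeasurePreserving e :=
    (volume_preserving_prodAssoc (α₁ := ℝ) (β₁ := Fin 2 → ℝ) (γ₁ := Mom)).symm.trans
      (h₀.prod (MeasurePreserving.id volume))
  have hev (t : ℝ) (w : (Fin 2 → ℝ) × Mom) : e (t, w) = (linePt i w.1 t, w.2) := rfl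
  have hK' : Integrable (fun x => K (e x)) := he.integrable_comp_emb e.measurableEmbedding |>.mpr hK
  have hH' : Integrable (fun x => H (e x)) := he.integrable_comp_emb e.measurableEmbedding |>.mpr hH
  rw [← he.integral_comp' K, Measure.volume_eq_prod, integral_prod_symm _ hK']
  refine integral_eq_zero_of_ae ?_
  -- The lines through the origin form a null set of lines.
  have hne : ∀ᵐ w : (Fin 2 → ℝ) × Mom, w.1 ≠ 0 := by
    have h1 : ∀ᵐ y : Fin 2 → ℝ, y ≠ 0 := Measure.ae_ne volume 0
    exact (Measure.quasiMeasurePreserving_fst (μ := (volume : Measure (Fin 2 → ℝ)))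
      (ν := (volume : Measure Mom))).ae h1
  filter_upwards [hne, hK'.prod_left_ae, hH'.prod_left_ae] with w hw h1 h2
  exact integral_eq_zero_of_hasDerivAt_of_integrable (f := fun t => H (e (t, w)))
    (fun t => hd w.1 hw w.2 t) h1 h2

/-! ### Lorentz invariance of the phase-space integrals -/

/-- The partial derivative `∂_μ` of Schwartz functions. -/
def schwartzPartial (μ : Fin 4) (g : 𝓢(Minkowski, ℂ)) : 𝓢(Minkowski, ℂ) :=
  LineDeriv.lineDerivOp (EuclideanSpace.single μ (1 : ℝ) : Minkowski) g

theorem schwartzPartial_apply (μ : Fin 4) (g : 𝓢(Minkowski, ℂ)) (x : Minkowski) :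
    schwartzPartial μ g x = fderiv ℝ g x (EuclideanSpace.single μ 1) := by
  rw [schwartzPartial, SchwartzMap.lineDerivOp_apply_eq_fderiv]

theorem schwartzPartial_comm (μ ν : Fin 4) (g : 𝓢(Minkowski, ℂ)) :
    schwartzPartial μ (schwartzPartial ν g) = schwartzPartial ν (schwartzPartial μ g) := by
  have h (g : 𝓢(Minkowski, ℂ)) (μ ν : Fin 4) (x : Minkowski) :
      schwartzPartial μ (schwartzPartial ν g) x =
        fderiv ℝ (fderiv ℝ g) x (EuclideanSpace.single μ 1) (EuclideanSpace.single ν 1) := by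
    have hd : DifferentiableAt ℝ (fderiv ℝ g) x :=
      ((g.smooth 2).fderiv_right (m := 1) le_rfl).differentiable one_ne_zero x
    have hf : ⇑(schwartzPartial ν g) = fun x => fderiv ℝ g x (EuclideanSpace.single ν 1) :=
      funext (schwartzPartial_apply ν g)
    rw [schwartzPartial_apply, hf, fderiv_clm_apply hd (differentiableAt_const _)]
    simp
  ext x
  rw [h, h]
  exact ((g.smooth 2).contDiffAt.isSymmSndFDerivAt (by simp)).eq _ _

/-- The infinitesimal Lorentz transformation `p_ν ↦ p_ρ η_{σν} - p_σ η_{ρν}` of the first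
momentum. -/
def lorentzFst (ρ σ : Fin 4) : Derivation ℂ MomPoly MomPoly :=
  MvPolynomial.mkDerivation ℂ (Sum.elim
    (fun ν => η σ ν • MvPolynomial.X (Sum.inl ρ) - η ρ ν • MvPolynomial.X (Sum.inl σ))
    (fun _ => 0))

/-- The infinitesimal Lorentz transformation of the second momentum. -/
def lorentzSnd (ρ σ : Fin 4) : Derivation ℂ MomPoly MomPoly :=
  MvPolynomial.mkDerivation ℂ (Sum.elim (fun _ => 0)
    (fun ν => η σ ν • MvPolynomial.X (Sum.inr ρ) - η ρ ν • MvPolynomial.X (Sum.inr σ)))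

theorem linePt_ne_zero (i : Fin 3) {y : Fin 2 → ℝ} (hy : y ≠ 0) (t : ℝ) : linePt i y t ≠ 0 := by
  intro h
  apply hy
  funext j
  have : (linePt i y t) (i.succAbove j) = 0 := by rw [h]; rfl
  simpa [linePt] using this

theorem hasDerivAt_norm_linePt (i : Fin 3) {y : Fin 2 → ℝ} (hy : y ≠ 0) (t : ℝ) :
    HasDerivAt (fun t => ‖linePt i y t‖) (t / ‖linePt i y t‖) t := by
  have hn (t : ℝ) : ‖linePt i y t‖ = Real.sqrt (t ^ 2 + ∑ j, (y j) ^ 2) := by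
    rw [EuclideanSpace.norm_eq, Fin.sum_univ_succAbove _ i]
    simp [linePt]
  have hpos : t ^ 2 + ∑ j, (y j) ^ 2 ≠ 0 := by
    have := norm_pos_iff.mpr (linePt_ne_zero i hy t)
    rw [hn] at this
    exact (Real.sqrt_pos.mp this).ne'
  have h : HasDerivAt (fun t : ℝ => t ^ 2 + ∑ j, (y j) ^ 2) (2 * t) t := by
    simpa using (hasDerivAt_pow 2 t).add_const (∑ j, (y j) ^ 2)
  have h2 := h.sqrt hpos
  simp only [← hn] at h2
  refine h2.congr_deriv ?_
  field_simp

theorem hasDerivAt_linePt (i j : Fin 3) (y : Fin 2 → ℝ) (t : ℝ) :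
    HasDerivAt (fun t => linePt i y t j) (if j = i then 1 else 0) t := by
  by_cases h : j = i
  · subst h
    simp only [linePt, Fin.insertNth_apply_same, if_true]
    exact hasDerivAt_id t
  · obtain ⟨k, rfl⟩ := Fin.exists_succAbove_eq h
    simp only [linePt, Fin.insertNth_apply_succAbove, Fin.succAbove_ne, if_false]
    exact hasDerivAt_const t (y k)

/-- Away from the origin, `|p| ∂/∂p^i` acts on light-like momenta as a boost. -/
theorem hasDerivAt_onShell_linePt (i : Fin 3) {y : Fin 2 → ℝ} (hy : y ≠ 0) (ν : Fin 4) (t : ℝ) :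
    HasDerivAt (fun t => onShell (linePt i y t) ν)
      ((if ν = 0 then -onShell (linePt i y t) i.succ else
        if ν = i.succ then -onShell (linePt i y t) 0 else 0) / ‖linePt i y t‖) t := by
  have hne := norm_ne_zero_iff.mpr (linePt_ne_zero i hy t)
  have hs (p : Mom) (j : Fin 3) : onShell p j.succ = -p j := by
    fin_cases j <;> rfl
  have h0 (p : Mom) : onShell p 0 = ‖p‖ := rfl
  cases ν using Fin.cases with
  | zero =>
    simp only [h0, hs, if_true, neg_neg]
    have : linePt i y t i = t := by simp [linePt]
    rw [this]
    exact hasDerivAt_norm_linePt i hy t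
  | succ j =>
    simp only [hs, h0, Fin.succ_ne_zero, if_false, Fin.succ_inj]
    refine (hasDerivAt_linePt i j y t).neg.congr_deriv ?_
    split_ifs
    · field_simp
    · simp

/-- Both sides obey the Leibniz rule in f, so the comparison of |p| ∂/∂p^i with the algebraic boost
is needed only on the variables. -/
theorem hasDerivAt_eval_momPoint (i : Fin 3) {y : Fin 2 → ℝ} (hy : y ≠ 0) (q : Mom) (t : ℝ)
    (f : MomPoly) :
    HasDerivAt (fun t => MvPolynomial.eval (momPoint (linePt i y t, q)) f)
      (MvPolynomial.eval (momPoint (linePt i y t, q)) (lorentzFst 0 i.succ f) /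
        (‖linePt i y t‖ : ℂ)) t := by
  have hne : (‖linePt i y t‖ : ℂ) ≠ 0 := by
    exact_mod_cast norm_ne_zero_iff.mpr (linePt_ne_zero i hy t)
  induction f using MvPolynomial.induction_on with
  | C a => simpa using hasDerivAt_const t a
  | add f₁ f₂ h₁ h₂ =>
    simp only [map_add, add_div]
    exact h₁.add h₂
  | mul_X f x h =>
    have hx : HasDerivAt (fun t => momPoint (linePt i y t, q) x)
        (MvPolynomial.eval (momPoint (linePt i y t, q)) (lorentzFst 0 i.succ (MvPolynomial.X x)) /
        (‖linePt i y t‖ : ℂ)) t := by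
      rw [lorentzFst, MvPolynomial.mkDerivation_X]
      cases x with
      | inl ν =>
        have := ((hasDerivAt_onShell_linePt i hy ν t).ofReal_comp).const_mul Complex.I
        refine this.congr_deriv ?_
        simp only [Sum.elim_inl, map_sub, MvPolynomial.smul_eval, MvPolynomial.eval_X, momPoint]
        rcases eq_or_ne ν 0 with rfl | h0
        · simp [η, ε]
          ring
        · rcases eq_or_ne ν i.succ with rfl | h1
          · simp [η, ε, h0, h0.symm]
            ring
          · simp [η, h0, h1, Ne.symm h0, Ne.symm h1]
      | inr ν => simpa [momPoint] using hasDerivAt_const t _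
    simp only [map_mul, MvPolynomial.eval_X, Derivation.leibniz, smul_eq_mul, map_add]
    refine (h.mul hx).congr_deriv ?_
    ring

/-- The signs are positive because the minus sign in the boost of the lower components cancels the
one in the scaling -(2π)⁻¹ of the Fourier argument. -/
theorem hasDerivAt_loopArg (i : Fin 3) {y : Fin 2 → ℝ} (hy : y ≠ 0) (q : Mom) (t : ℝ)
    (g : 𝓢(Minkowski, ℂ)) :
    HasDerivAt (fun t => g (loopArg (linePt i y t, q)))
      (((2 * Real.pi)⁻¹ : ℝ) * (onShell (linePt i y t) i.succ *
          schwartzPartial 0 g (loopArg (linePt i y t, q)) +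
        onShell (linePt i y t) 0 * schwartzPartial i.succ g (loopArg (linePt i y t, q))) /
        (‖linePt i y t‖ : ℂ)) t := by
  set p := linePt i y t
  have h1 : HasDerivAt (fun t => onShell (linePt i y t))
      ((-onShell p i.succ / ‖p‖) • EuclideanSpace.single (0 : Fin 4) (1 : ℝ) +
        (-onShell p 0 / ‖p‖) • EuclideanSpace.single i.succ (1 : ℝ) : Minkowski) t := by
    have h := (PiLp.continuousLinearEquiv 2 ℝ (fun _ : Fin 4 => ℝ)).symm.hasFDerivAt.comp_hasDerivAt
      t (hasDerivAt_pi.mpr fun ν => hasDerivAt_onShell_linePt i hy ν t)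
    refine h.congr_deriv ?_
    ext ν
    rcases eq_or_ne ν 0 with rfl | h0
    · simp [p, (Fin.succ_ne_zero i).symm]
    · rcases eq_or_ne ν i.succ with rfl | h1
      · simp [p, h0]
      · simp [h0, h1]
  have h2 : HasDerivAt (fun t => loopArg (linePt i y t, q)) _ t :=
    (h1.add_const (onShell q)).const_smul (-(2 * Real.pi)⁻¹ : ℝ)
  have h3 := (g.differentiableAt (x := loopArg (p, q))).hasFDerivAt.comp_hasDerivAt t h2
  refine h3.congr_deriv ?_
  simp only [map_smul, map_add, schwartzPartial_apply, Complex.real_smul]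
  push_cast
  ring

/-- This is boost invariance of the measure d³p/(2|p|). The zeroth variable takes the value i|p|, so
-i times it cancels the singular factor 1/|p|. The derivative along p^i of the resulting function f
g/(4|q|) reintroduces 1/|p| and is the stated integrand; its integral vanishes. -/
theorem lorentzFst_boost (i : Fin 3) (f : MomPoly) (g : 𝓢(Minkowski, ℂ)) :
    loopInt (lorentzFst 0 i.succ f) g - Complex.I / (2 * Real.pi) *
      (loopInt (MvPolynomial.X (Sum.inl 0) * f) (schwartzPartial i.succ g) +
        loopInt (MvPolynomial.X (Sum.inl i.succ) * f) (schwartzPartial 0 g)) = 0 := by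
  have hint := integrable_loopIntegrand
  have key := integral_eq_zero_of_hasDerivAt_linePt i
    (H := fun z => -Complex.I * loopIntegrand (MvPolynomial.X (Sum.inl 0) * f) g z)
    (K := fun z => loopIntegrand (lorentzFst 0 i.succ f) g z - Complex.I / (2 * Real.pi) *
      (loopIntegrand (MvPolynomial.X (Sum.inl 0) * f) (schwartzPartial i.succ g) z +
        loopIntegrand (MvPolynomial.X (Sum.inl i.succ) * f) (schwartzPartial 0 g) z))
    ((hint _ _).const_mul _)
    ((hint _ _).sub (((hint _ _).add (hint _ _)).const_mul _)) ?_
  · have h1 : Integrable fun z => Complex.I / (2 * Real.pi) *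
        (loopIntegrand (MvPolynomial.X (Sum.inl 0) * f) (schwartzPartial i.succ g) z +
          loopIntegrand (MvPolynomial.X (Sum.inl i.succ) * f) (schwartzPartial 0 g) z) :=
      ((hint _ _).add (hint _ _)).const_mul _
    rw [integral_sub (hint _ _) h1, integral_const_mul, integral_add (hint _ _) (hint _ _)] at key
    exact key
  · intro y hy q t
    have hne (t : ℝ) : (‖linePt i y t‖ : ℂ) ≠ 0 := by
      exact_mod_cast norm_ne_zero_iff.mpr (linePt_ne_zero i hy t)
    have h0 (p : Mom) : onShell p 0 = ‖p‖ := rfl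
    have h := ((hasDerivAt_eval_momPoint i hy q t f).mul
      (hasDerivAt_loopArg i hy q t g)).const_mul (1 / (4 * ‖q‖ : ℂ))
    have hH : (fun t => -Complex.I * loopIntegrand (MvPolynomial.X (Sum.inl 0) * f) g
        (linePt i y t, q)) = fun t => 1 / (4 * ‖q‖ : ℂ) *
          (MvPolynomial.eval (momPoint (linePt i y t, q)) f * g (loopArg (linePt i y t, q))) := by
      funext t
      have := hne t
      simp only [loopIntegrand, map_mul, MvPolynomial.eval_X, momPoint, Sum.elim_inl, h0]
      push_cast
      -- At q = 0 both sides are zero by the convention for division by zero.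
      rcases eq_or_ne (‖q‖ : ℂ) 0 with hq | hq
      · simp [hq]
      · field_simp
        rw [Complex.I_sq]
        ring
    simp only [hH]
    refine h.congr_deriv ?_
    have := hne t
    have hI : (Complex.I : ℂ) ^ 2 = -1 := Complex.I_sq
    simp only [loopIntegrand, map_mul, MvPolynomial.eval_X, momPoint, Sum.elim_inl, h0]
    push_cast
    rcases eq_or_ne (‖q‖ : ℂ) 0 with hq | hq
    · simp [hq]
    · have hpi : (Real.pi : ℂ) ≠ 0 := by exact_mod_cast Real.pi_ne_zero
      field_simp
      rw [hI]
      ring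

theorem eval_momPoint_swap (z : Mom × Mom) (f : MomPoly) :
    MvPolynomial.eval (momPoint z) (MvPolynomial.rename Sum.swap f) =
      MvPolynomial.eval (momPoint z.swap) f := by
  rw [MvPolynomial.eval_rename]
  congr 2
  funext x
  cases x <;> rfl

theorem loopInt_rename_swap (f : MomPoly) (g : 𝓢(Minkowski, ℂ)) :
    loopInt (MvPolynomial.rename Sum.swap f) g = loopInt f g := by
  rw [loopInt, loopInt, Measure.volume_eq_prod, ← integral_prod_swap]
  congr 1
  funext z
  simp only [loopIntegrand, eval_momPoint_swap, loopArg, Prod.fst_swap, Prod.snd_swap, Prod.swap_swap]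
  rw [add_comm (onShell z.1), mul_comm ((2 * ‖z.1‖ : ℝ) : ℂ)]

theorem lorentzSnd_rename_swap (ρ σ : Fin 4) (f : MomPoly) :
    lorentzSnd ρ σ (MvPolynomial.rename Sum.swap f) =
      MvPolynomial.rename Sum.swap (lorentzFst ρ σ f) := by
  induction f using MvPolynomial.induction_on with
  | C a => simp
  | add f₁ f₂ h₁ h₂ => simp [h₁, h₂]
  | mul_X f x h =>
    simp only [map_mul, Derivation.leibniz, h, map_add, MvPolynomial.rename_X, smul_eq_mul]
    congr 2
    cases x <;> simp [lorentzFst, lorentzSnd]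

/-- The infinitesimal Lorentz transformation of both momenta. -/
def lorentz (ρ σ : Fin 4) : Derivation ℂ MomPoly MomPoly := lorentzFst ρ σ + lorentzSnd ρ σ

/-- The components of the total momentum. -/
def totMom (μ : Fin 4) : MomPoly := MvPolynomial.X (Sum.inl μ) + MvPolynomial.X (Sum.inr μ)

theorem lorentz_inl (ρ σ ν : Fin 4) : lorentz ρ σ (MvPolynomial.X (Sum.inl ν)) =
    η σ ν • MvPolynomial.X (Sum.inl ρ) - η ρ ν • MvPolynomial.X (Sum.inl σ) := by
  simp [lorentz, lorentzFst, lorentzSnd]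

theorem lorentz_inr (ρ σ ν : Fin 4) : lorentz ρ σ (MvPolynomial.X (Sum.inr ν)) =
    η σ ν • MvPolynomial.X (Sum.inr ρ) - η ρ ν • MvPolynomial.X (Sum.inr σ) := by
  simp [lorentz, lorentzFst, lorentzSnd]

theorem lorentz_totMom (ρ σ ν : Fin 4) :
    lorentz ρ σ (totMom ν) = η σ ν • totMom ρ - η ρ ν • totMom σ := by
  simp only [totMom, map_add, lorentz_inl, lorentz_inr, smul_add]
  abel

theorem loopInt_sub (f₁ f₂ : MomPoly) (g : 𝓢(Minkowski, ℂ)) :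
    loopInt (f₁ - f₂) g = loopInt f₁ g - loopInt f₂ g := map_sub (loopIntL g) f₁ f₂

theorem loopInt_neg (f : MomPoly) (g : 𝓢(Minkowski, ℂ)) :
    loopInt (-f) g = -loopInt f g := map_neg (loopIntL g) f

/-- The boost identity for the second momentum is the one for the first after exchanging the two
particles. In the sum of both, only the total momentum multiplies the derivatives of g. -/
theorem loopInt_lorentz_boost (i : Fin 3) (f : MomPoly) (g : 𝓢(Minkowski, ℂ)) :
    loopInt (lorentz 0 i.succ f) g = Complex.I / (2 * Real.pi) *
      (loopInt (totMom 0 * f) (schwartzPartial i.succ g) +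
        loopInt (totMom i.succ * f) (schwartzPartial 0 g)) := by
  have h1 := lorentzFst_boost i f g
  have h2 := lorentzFst_boost i (MvPolynomial.rename Sum.swap f) g
  have hr (f : MomPoly) : MvPolynomial.rename Sum.swap (MvPolynomial.rename Sum.swap f) = f := by
    rw [MvPolynomial.rename_rename]
    simp
  have e (μ : Fin 4) (g : 𝓢(Minkowski, ℂ)) :
      loopInt (MvPolynomial.X (Sum.inl μ) * MvPolynomial.rename Sum.swap f) g =
        loopInt (MvPolynomial.X (Sum.inr μ) * f) g := by
    rw [← loopInt_rename_swap, map_mul, hr, MvPolynomial.rename_X]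
    rfl
  rw [e, e, ← loopInt_rename_swap, ← lorentzSnd_rename_swap, hr] at h2
  simp only [lorentz, totMom, add_mul, loopInt_add, Derivation.add_apply]
  linear_combination h1 + h2

/-- Rotations are commutators of boosts, so rotation invariance needs no integration by parts of its
own. -/
theorem lorentz_rotation {m n : Fin 4} (hm : m ≠ 0) (hn : n ≠ 0) (h : m ≠ n) :
    lorentz m n = -⁅lorentz 0 m, lorentz 0 n⁆ := by
  apply MvPolynomial.derivation_ext
  have h0 : ((0 : Fin 4) = m) = False := eq_false hm.symm
  have h1 : ((0 : Fin 4) = n) = False := eq_false hn.symm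
  have h2 : (n = m) = False := eq_false h.symm
  rintro (ν | ν)
  all_goals
    simp only [Derivation.neg_apply, Derivation.commutator_apply, lorentz_inl, lorentz_inr, map_sub]
    rcases eq_or_ne ν 0 with rfl | hν0
    · simp [η, ε, hm, hn, h, h0, h1, h2, lorentz_inl, lorentz_inr]
    rcases eq_or_ne ν m with rfl | hνm
    · simp [η, ε, hm, hn, h0, h2, lorentz_inl, lorentz_inr]
    rcases eq_or_ne ν n with rfl | hνn
    · simp [η, ε, hm, hn, h, h1, lorentz_inl, lorentz_inr]
    · simp [η, hν0.symm, hνm.symm, hνn.symm]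

/-- Lorentz invariance of the two-particle phase-space integral. -/
theorem loopInt_lorentz (ρ σ : Fin 4) (f : MomPoly) (g : 𝓢(Minkowski, ℂ)) :
    loopInt (lorentz ρ σ f) g = Complex.I / (2 * Real.pi) *
      (ε ρ * loopInt (totMom σ * f) (schwartzPartial ρ g) -
        ε σ * loopInt (totMom ρ * f) (schwartzPartial σ g)) := by
  have anti (ρ σ : Fin 4) : lorentz ρ σ = -lorentz σ ρ := by
    apply MvPolynomial.derivation_ext
    rintro (ν | ν) <;> simp [lorentz_inl, lorentz_inr]
  have boost (i : Fin 4) (hi : i ≠ 0) (f : MomPoly) (g : 𝓢(Minkowski, ℂ)) :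
      loopInt (lorentz 0 i f) g = Complex.I / (2 * Real.pi) *
      (loopInt (totMom 0 * f) (schwartzPartial i g) +
        loopInt (totMom i * f) (schwartzPartial 0 g)) := by
    obtain ⟨j, rfl⟩ := Fin.exists_succ_eq.mpr hi
    exact loopInt_lorentz_boost j f g
  have hε {i : Fin 4} (hi : i ≠ 0) : ε i = -1 := if_neg hi
  have hε0 : ε 0 = 1 := rfl
  rcases eq_or_ne ρ σ with rfl | hρσ
  · have : lorentz ρ ρ = 0 := by
      apply MvPolynomial.derivation_ext
      rintro (ν | ν) <;> simp [lorentz_inl, lorentz_inr]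
    rw [this, Derivation.zero_apply, sub_self, mul_zero, ← loopIntL_apply, map_zero]
  rcases eq_or_ne ρ 0 with rfl | hρ
  · rw [boost σ hρσ.symm, hε hρσ.symm, hε0]
    ring
  rcases eq_or_ne σ 0 with rfl | hσ
  · rw [anti, Derivation.neg_apply, loopInt_neg, boost ρ hρ, hε hρ, hε0]
    ring
  -- For a rotation the boost identity is applied twice in either order. The terms with two
  -- derivatives of g cancel because these derivatives commute; the rotation of g comes from moving
  -- the total momentum under the second boost.
  rw [hε hρ, hε hσ, lorentz_rotation hρ hσ hρσ, Derivation.neg_apply, Derivation.commutator_apply,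
    loopInt_neg, loopInt_sub, boost ρ hρ, boost σ hσ]
  have h0 (ν : Fin 4) (hν : ν ≠ 0) : lorentz 0 ν (totMom 0) = -totMom ν := by
    rw [lorentz_totMom]
    simp [η, ε, hν]
  have h1 (μ ν : Fin 4) (hμ : μ ≠ 0) (hμν : ν ≠ μ) : lorentz 0 ν (totMom μ) = 0 := by
    rw [lorentz_totMom]
    simp [η, hμ.symm, hμν]
  have e0 (ν : Fin 4) (hν : ν ≠ 0) : totMom 0 * lorentz 0 ν f =
      lorentz 0 ν (totMom 0 * f) + totMom ν * f := by
    rw [Derivation.leibniz, h0 ν hν]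
    simp only [smul_eq_mul]
    ring
  have e1 (μ ν : Fin 4) (hμ : μ ≠ 0) (hμν : ν ≠ μ) : totMom μ * lorentz 0 ν f =
      lorentz 0 ν (totMom μ * f) := by
    rw [Derivation.leibniz, h1 μ ν hμ hμν]
    simp only [smul_eq_mul]
    ring
  rw [e0 σ hσ, e0 ρ hρ, e1 ρ σ hρ hρσ.symm, e1 σ ρ hσ hρσ, loopInt_add, loopInt_add]
  simp only [boost σ hσ, boost ρ hρ]
  rw [schwartzPartial_comm σ 0, schwartzPartial_comm ρ 0, schwartzPartial_comm ρ σ,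
    mul_left_comm (totMom σ) (totMom 0), mul_left_comm (totMom ρ) (totMom 0),
    mul_left_comm (totMom ρ) (totMom σ)]
  ring

/-- The combination of Lorentz transformations that preserve the total momentum. -/
theorem loopInt_cyclic (τ ρ σ : Fin 4) (f : MomPoly) (g : 𝓢(Minkowski, ℂ)) :
    loopInt (totMom τ * lorentz ρ σ f + totMom ρ * lorentz σ τ f + totMom σ * lorentz τ ρ f) g
      = 0 := by
  have hη (μ ν : Fin 4) : η μ ν = η ν μ := by
    unfold η
    by_cases h : μ = ν
    · subst h; rfl
    · simp [h, Ne.symm h]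
  have e (τ ρ σ : Fin 4) : totMom τ * lorentz ρ σ f =
      lorentz ρ σ (totMom τ * f) - (η σ τ • (totMom ρ * f) - η ρ τ • (totMom σ * f)) := by
    rw [Derivation.leibniz, lorentz_totMom]
    simp only [smul_eq_mul, MvPolynomial.smul_eq_C_mul]
    ring
  -- On g a Lorentz transformation acts through the antisymmetric product of k and ∂. Multiplying by
  -- a further k and summing cyclically antisymmetrizes two factors k, so everything cancels.
  rw [e, e, e]
  simp only [loopInt_add, loopInt_sub, loopInt_smul, loopInt_lorentz]
  rw [hη τ σ, hη ρ τ, hη ρ σ, mul_left_comm (totMom σ) (totMom τ),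
    mul_left_comm (totMom ρ) (totMom τ), mul_left_comm (totMom σ) (totMom ρ)]
  ring

/-! ### Cancelling the square of the total momentum. -/

/-- The square `ξ₀² - ξ₁² - ξ₂² - ξ₃²`. -/
def minkSq (ξ : Minkowski) : ℝ := ξ 0 ^ 2 - ξ 1 ^ 2 - ξ 2 ^ 2 - ξ 3 ^ 2

theorem contDiff_minkSq {n : WithTop ℕ∞} : ContDiff ℝ n minkSq := by
  unfold minkSq
  fun_prop

/-- The square of the total momentum. -/
def totSq : MomPoly := ∑ μ, ε μ • totMom μ ^ 2

theorem eval_totMom (z : Mom × Mom) (μ : Fin 4) :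
    MvPolynomial.eval (momPoint z) (totMom μ) = -(2 * Real.pi * Complex.I) * (loopArg z μ : ℂ) := by
  have h : loopArg z μ = -(2 * Real.pi)⁻¹ * (onShell z.1 μ + onShell z.2 μ) := by
    simp [loopArg]
    ring
  have hpi : (Real.pi : ℂ) ≠ 0 := by exact_mod_cast Real.pi_ne_zero
  rw [h]
  simp only [totMom, map_add, MvPolynomial.eval_X, momPoint, Sum.elim_inl, Sum.elim_inr]
  push_cast
  field_simp

theorem eval_totSq (z : Mom × Mom) :
    MvPolynomial.eval (momPoint z) totSq = -(2 * Real.pi) ^ 2 * (minkSq (loopArg z) : ℂ) := by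
  simp only [totSq, Fin.sum_univ_four, map_add, MvPolynomial.smul_eval, map_pow, eval_totMom,
    minkSq, ε]
  simp only [if_true, show (1 : Fin 4) ≠ 0 by decide, show (2 : Fin 4) ≠ 0 by decide,
    show (3 : Fin 4) ≠ 0 by decide, if_false, mul_pow, neg_sq, Complex.I_sq]
  push_cast
  ring

theorem minkSq_loopArg (z : Mom × Mom) :
    minkSq (loopArg z) = ((2 * Real.pi) ^ 2)⁻¹ * (2 * (‖z.1‖ * ‖z.2‖ - inner ℝ z.1 z.2)) := by
  have h (p : Mom) : ‖p‖ ^ 2 = p 0 ^ 2 + p 1 ^ 2 + p 2 ^ 2 := by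
    rw [EuclideanSpace.norm_sq_eq, Fin.sum_univ_three]
    simp
  have h1 := h z.1
  have h2 := h z.2
  have h3 : inner ℝ z.1 z.2 = z.1 0 * z.2 0 + z.1 1 * z.2 1 + z.1 2 * z.2 2 := by
    rw [PiLp.inner_apply, Fin.sum_univ_three]
    simp [mul_comm]
  have h4 (μ : Fin 4) : loopArg z μ = -(2 * Real.pi)⁻¹ * (onShell z.1 μ + onShell z.2 μ) := by
    simp [loopArg]
    ring
  have e0 (p : Mom) : onShell p 0 = ‖p‖ := rfl
  have e1 (p : Mom) : onShell p 1 = -p 0 := rfl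
  have e2 (p : Mom) : onShell p 2 = -p 1 := rfl
  have e3 (p : Mom) : onShell p 3 = -p 2 := rfl
  simp only [minkSq, h4, e0, e1, e2, e3, h3, mul_pow, neg_sq]
  rw [inv_pow]
  linear_combination ((2 ^ 2 * Real.pi ^ 2)⁻¹) * (h1 + h2)

/-- For light-like p and q the square of p + q is 2(|p||q| - p·q). It vanishes only in the equality
case of Cauchy-Schwarz, where q lies on the line spanned by p for p ≠ 0, and a line is a null set in
three-space. -/
theorem ae_minkSq_loopArg_ne_zero : ∀ᵐ z : Mom × Mom, minkSq (loopArg z) ≠ 0 := by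
  have hm : MeasurableSet {z : Mom × Mom | inner ℝ z.1 z.2 = ‖z.1‖ * ‖z.2‖} :=
    (isClosed_eq (by fun_prop) (by fun_prop)).measurableSet
  have hnull : (volume : Measure (Mom × Mom)) {z | inner ℝ z.1 z.2 = ‖z.1‖ * ‖z.2‖} = 0 := by
    rw [Measure.volume_eq_prod, Measure.measure_prod_null hm]
    filter_upwards [Measure.ae_ne (volume : Measure Mom) 0] with p hp
    refine measure_mono_null (t := (Submodule.span ℝ {p} : Set Mom)) ?_ ?_
    · intro q hq
      have hq : inner ℝ p q = ‖p‖ * ‖q‖ := hq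
      rw [inner_eq_norm_mul_iff_real] at hq
      have hp' : ‖p‖ ≠ 0 := norm_ne_zero_iff.mpr hp
      refine Submodule.mem_span_singleton.mpr ⟨‖p‖⁻¹ * ‖q‖, ?_⟩
      rw [mul_smul, hq, smul_smul, inv_mul_cancel₀ hp', one_smul]
    · refine Measure.addHaar_submodule volume _ fun h => ?_
      have h1 := finrank_span_singleton (K := ℝ) hp
      rw [h, finrank_top, finrank_euclideanSpace_fin] at h1
      omega
  have : ∀ᵐ z : Mom × Mom, z ∉ {z : Mom × Mom | inner ℝ z.1 z.2 = ‖z.1‖ * ‖z.2‖} :=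
    measure_eq_zero_iff_ae_notMem.mp hnull
  filter_upwards [this] with z hz h0
  apply hz
  rw [minkSq_loopArg] at h0
  have : (((2 * Real.pi) ^ 2)⁻¹ : ℝ) ≠ 0 := by positivity
  have := (mul_eq_zero.mp h0).resolve_left this
  change inner ℝ z.1 z.2 = ‖z.1‖ * ‖z.2‖
  linarith

/-- A factor `(p + q)²` in the weight can be cancelled. -/
theorem loopInt_eq_zero_of_totSq_mul {F : MomPoly} (h : ∀ g, loopInt (totSq * F) g = 0)
    (g : 𝓢(Minkowski, ℂ)) : loopInt F g = 0 := by
  let χ : ContDiffBump (0 : Minkowski) := ⟨1, 2, one_pos, one_lt_two⟩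
  let c : ℕ → ℝ := fun n => ((n : ℝ) + 1)⁻¹
  have hc (n : ℕ) : 0 < c n := by positivity
  have hclim : Filter.Tendsto c Filter.atTop (nhds 0) := by
    simpa [c, one_div] using tendsto_one_div_add_atTop_nhds_zero_nat (𝕜 := ℝ)
  -- A smooth compactly supported regularization of 1/ξ²: with s = ξ², the quotient s/(s² + c) has
  -- no pole, s times it lies in [0, 1], and it tends to 1/s wherever s ≠ 0. Testing the hypothesis
  -- with a n times g and applying dominated convergence removes the factor s.
  let a : ℕ → Minkowski → ℝ := fun n ξ => χ (c n • ξ) * (minkSq ξ / (minkSq ξ ^ 2 + c n))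
  have ha (n : ℕ) : ContDiff ℝ ((⊤ : ℕ∞) : WithTop ℕ∞) (a n) := by
    refine (χ.contDiff.comp (contDiff_const_smul (c n))).mul
      (contDiff_minkSq.div ((contDiff_minkSq.pow 2).add contDiff_const) fun ξ => ?_)
    have := hc n
    positivity
  have hsupp (n : ℕ) : HasCompactSupport (a n) := by
    refine HasCompactSupport.mul_right ?_
    exact χ.hasCompactSupport.comp_smul (hc n).ne'
  let G : ℕ → 𝓢(Minkowski, ℂ) := fun n =>
    HasCompactSupport.toSchwartzMap (f := fun ξ => (a n ξ : ℂ) * g ξ)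
      (HasCompactSupport.mul_right ((hsupp n).comp_left (g := fun x : ℝ => (x : ℂ)) rfl))
      ((Complex.ofRealCLM.contDiff.comp (ha n)).mul (g.smooth _))
  have hG (n : ℕ) (ξ : Minkowski) : G n ξ = (a n ξ : ℂ) * g ξ := rfl
  have hint (n : ℕ) (z : Mom × Mom) : loopIntegrand (totSq * F) (G n) z =
      -(2 * Real.pi) ^ 2 *
        (((minkSq (loopArg z) * a n (loopArg z) : ℝ) : ℂ) * loopIntegrand F g z) := by
    simp only [loopIntegrand, map_mul, eval_totSq, hG]
    push_cast
    ring
  have hzero (n : ℕ) : ∫ z, ((minkSq (loopArg z) * a n (loopArg z) : ℝ) : ℂ) *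
      loopIntegrand F g z = 0 := by
    have h1 := h (G n)
    rw [loopInt] at h1
    simp only [hint] at h1
    rw [integral_const_mul] at h1
    have hpi : (-(2 * Real.pi) ^ 2 : ℂ) ≠ 0 := by simp
    exact (mul_eq_zero.mp h1).resolve_left hpi
  have hle (n : ℕ) (ξ : Minkowski) : |minkSq ξ * a n ξ| ≤ 1 := by
    have e : minkSq ξ * a n ξ = χ (c n • ξ) * (minkSq ξ ^ 2 / (minkSq ξ ^ 2 + c n)) := by
      simp only [a]
      ring
    have := hc n
    rw [e, abs_of_nonneg (by have := χ.nonneg' (c n • ξ); positivity)]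
    refine mul_le_one₀ χ.le_one (by positivity) ?_
    rw [div_le_one (by positivity)]
    linarith
  have hlim := tendsto_integral_of_dominated_convergence (μ := (volume : Measure (Mom × Mom)))
    (F := fun n z => ((minkSq (loopArg z) * a n (loopArg z) : ℝ) : ℂ) * loopIntegrand F g z)
    (f := loopIntegrand F g) (fun z => ‖loopIntegrand F g z‖) (fun n => ?_)
    (integrable_loopIntegrand F g).norm (fun n => Filter.Eventually.of_forall fun z => ?_) ?_
  · simp only [hzero] at hlim
    exact (tendsto_nhds_unique hlim tendsto_const_nhds)
  · refine AEStronglyMeasurable.mul ?_ (integrable_loopIntegrand F g).aestronglyMeasurable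
    have hl : Continuous loopArg := by
      have := continuous_onShell
      unfold loopArg
      fun_prop
    have h1 := (ha n).continuous
    have h2 := (contDiff_minkSq (n := 0)).continuous
    exact Continuous.aestronglyMeasurable (by fun_prop)
  · rw [norm_mul, Complex.norm_real, Real.norm_eq_abs]
    exact mul_le_of_le_one_left (norm_nonneg _) (hle n _)
  · filter_upwards [ae_minkSq_loopArg_ne_zero] with z hz
    have h1 : Filter.Tendsto (fun n => χ (c n • loopArg z)) Filter.atTop (nhds 1) := by
      have h2 : Filter.Tendsto (fun n => c n • loopArg z) Filter.atTop (nhds 0) := by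
        simpa using hclim.smul_const (loopArg z)
      have h3 := (χ.continuous.tendsto 0).comp h2
      rwa [χ.one_of_mem_closedBall (Metric.mem_closedBall_self χ.rIn_pos.le)] at h3
    have h2 : Filter.Tendsto (fun n => minkSq (loopArg z) ^ 2 / (minkSq (loopArg z) ^ 2 + c n))
        Filter.atTop (nhds 1) := by
      have h3 : minkSq (loopArg z) ^ 2 ≠ 0 := pow_ne_zero 2 hz
      have h4 : Filter.Tendsto (fun n => minkSq (loopArg z) ^ 2 + c n) Filter.atTop
          (nhds (minkSq (loopArg z) ^ 2)) := by
        simpa using hclim.const_add (minkSq (loopArg z) ^ 2)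
      have := (tendsto_const_nhds (x := minkSq (loopArg z) ^ 2)).div h4 h3
      rwa [div_self h3] at this
    have h3 : Filter.Tendsto (fun n => minkSq (loopArg z) * a n (loopArg z)) Filter.atTop
        (nhds 1) := by
      have := h1.mul h2
      rw [one_mul] at this
      refine this.congr fun n => ?_
      simp only [a]
      ring
    have h4 := ((Complex.continuous_ofReal.tendsto 1).comp h3).mul_const (loopIntegrand F g z)
    simpa using h4

/-! ### Polynomials in the partial derivatives, acting on distributions -/

/-- Polynomials in the four partial derivatives. -/
abbrev DerivPoly := MvPolynomial (Fin 4) ℂ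

theorem partialD_apply (μ : Fin 4) (d : Distr) (φ : 𝓢(Minkowski, ℂ)) :
    partialD μ d φ = d (-schwartzPartial μ φ) := rfl

theorem partialD_comm (μ ν : Fin 4) : Commute (partialD μ) (partialD ν) := by
  ext d φ
  change d (-schwartzPartial ν (-schwartzPartial μ φ)) =
    d (-schwartzPartial μ (-schwartzPartial ν φ))
  congr 1
  have h (μ ν : Fin 4) : schwartzPartial ν (-schwartzPartial μ φ) =
      -schwartzPartial ν (schwartzPartial μ φ) := LineDeriv.lineDerivOp_neg _ _
  rw [h, h, schwartzPartial_comm]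

theorem diffOp_monomial (d : Distr) (α : Fin 4 →₀ ℕ) :
    diffOp d (MvPolynomial.monomial α 1) =
      (partialD 0 ^ α 0 * partialD 1 ^ α 1 * partialD 2 ^ α 2 * partialD 3 ^ α 3) d := by
  rw [diffOp, show MvPolynomial.monomial α (1 : ℂ) = MvPolynomial.basisMonomials _ ℂ α from
    (congrFun (MvPolynomial.coe_basisMonomials _ ℂ) α).symm, Module.Basis.constr_basis]

theorem diffOp_one (d : Distr) : diffOp d 1 = d := by
  rw [← MvPolynomial.C_1, ← MvPolynomial.monomial_zero', diffOp_monomial]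
  simp

theorem diffOp_X_mul (d : Distr) (μ : Fin 4) (P : DerivPoly) :
    diffOp d (MvPolynomial.X μ * P) = partialD μ (diffOp d P) := by
  induction P using MvPolynomial.induction_on' with
  | monomial α a =>
    rw [show MvPolynomial.monomial α a = a • MvPolynomial.monomial α (1 : ℂ) by
      simp [MvPolynomial.smul_monomial], mul_smul_comm, map_smul, map_smul, map_smul,
      MvPolynomial.X, MvPolynomial.monomial_mul, one_mul, diffOp_monomial, diffOp_monomial,
      ← Module.End.mul_apply]
    congr 2
    have c (μ ν : Fin 4) (n : ℕ) (B : Module.End ℂ Distr) :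
        partialD μ * (partialD ν ^ n * B) = partialD ν ^ n * (partialD μ * B) := by
      rw [← mul_assoc, ((partialD_comm μ ν).pow_right n).eq, mul_assoc]
    fin_cases μ <;> simp [pow_add]
    · simp only [mul_assoc]
    · simp only [mul_assoc, c 1 0]
    · simp only [mul_assoc, c 2 0, c 2 1]
    · have e := ((partialD_comm 3 3).pow_right (α 3)).eq
      simp only [mul_assoc, c 3 0, c 3 1, c 3 2]
  | add P Q hP hQ => simp only [mul_add, map_add, hP, hQ]

theorem loopInt_totMom_mul (μ : Fin 4) (f : MomPoly) (φ : 𝓢(Minkowski, ℂ)) :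
    loopInt (totMom μ * f) (FourierTransform.fourier φ) =
      loopInt f (FourierTransform.fourier (-schwartzPartial μ φ)) := by
  simp only [loopInt, loopIntegrand, map_mul, eval_totMom]
  congr 1
  funext z
  have h : FourierTransform.fourier (-schwartzPartial μ φ) (loopArg z) =
      -(2 * Real.pi * Complex.I) * (loopArg z μ : ℂ) *
        (FourierTransform.fourier φ) (loopArg z) := by
    have hn : FourierTransform.fourier (-schwartzPartial μ φ) =
        -FourierTransform.fourier (schwartzPartial μ φ) :=
      map_neg (SchwartzMap.fourierTransformCLM ℂ : 𝓢(Minkowski, ℂ) →L[ℂ] 𝓢(Minkowski, ℂ)) _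
    have hg : (fun x : Minkowski => inner ℝ x
        (EuclideanSpace.single μ (1 : ℝ) : Minkowski)).HasTemperateGrowth := by fun_prop
    rw [hn, schwartzPartial, SchwartzMap.fourier_lineDerivOp_eq]
    rw [neg_apply, smul_apply, SchwartzMap.smulLeftCLM_apply_apply hg,
      EuclideanSpace.inner_single_right]
    simp [mul_assoc]
  rw [h]
  ring

/-- The exponential depends on p + q only, so total momentum leaves the loop as a derivative. Only
the relative momentum is left to be integrated. -/
theorem loopDistr_totMom_mul (μ : Fin 4) (f : MomPoly) :
    loopDistr (totMom μ * f) = partialD μ (loopDistr f) := by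
  ext φ
  rw [partialD_apply, loopDistr_apply, loopDistr_apply, loopInt_totMom_mul]

theorem loopDistr_eq_zero {f : MomPoly} (h : ∀ g, loopInt f g = 0) : loopDistr f = 0 := by
  ext φ
  rw [loopDistr_apply, h, mul_zero]
  rfl

/-! ### The relative momentum -/

/-- Half the difference of the two momenta. -/
def relMom (μ : Fin 4) : MomPoly :=
  (1 / 2 : ℂ) • (MvPolynomial.X (Sum.inl μ) - MvPolynomial.X (Sum.inr μ))

theorem lorentz_relMom (ρ σ ν : Fin 4) :
    lorentz ρ σ (relMom ν) = η σ ν • relMom ρ - η ρ ν • relMom σ := by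
  rw [relMom, Derivation.map_smul, map_sub, lorentz_inl, lorentz_inr]
  simp only [relMom, MvPolynomial.smul_eq_C_mul]
  ring

theorem lorentz_aeval_relMom (ρ σ : Fin 4) (N : DerivPoly) :
    lorentz ρ σ (MvPolynomial.aeval relMom N) =
      ∑ ν, MvPolynomial.aeval relMom (MvPolynomial.pderiv ν N) *
        (η σ ν • relMom ρ - η ρ ν • relMom σ) := by
  induction N using MvPolynomial.induction_on with
  | C a =>
    rw [MvPolynomial.aeval_C]
    simp
  | add f₁ f₂ h₁ h₂ => simp only [map_add, h₁, h₂, add_mul, Finset.sum_add_distrib]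
  | mul_X f x h =>
    simp only [map_mul, Derivation.leibniz, h, MvPolynomial.aeval_X, lorentz_relMom,
      MvPolynomial.pderiv_X, smul_eq_mul, map_add, add_mul, Finset.sum_add_distrib,
      Finset.mul_sum]
    congr 1
    · rw [Finset.sum_eq_single x]
      · simp
      · intro ν _ hν
        rw [Pi.single_eq_of_ne hν.symm, map_zero, mul_zero, zero_mul]
      · simp
    · exact Finset.sum_congr rfl fun ν _ => (mul_assoc _ _ _).symm

theorem sum_ε_onShell_sq (p : Mom) : ∑ μ, ε μ * (Complex.I * (onShell p μ : ℂ)) ^ 2 = 0 := by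
  have h : ‖p‖ ^ 2 = p 0 ^ 2 + p 1 ^ 2 + p 2 ^ 2 := by
    rw [EuclideanSpace.norm_sq_eq, Fin.sum_univ_three]
    simp
  have hc : (‖p‖ : ℂ) ^ 2 = (p 0 : ℂ) ^ 2 + (p 1 : ℂ) ^ 2 + (p 2 : ℂ) ^ 2 := by exact_mod_cast h
  have e0 : onShell p 0 = ‖p‖ := rfl
  have e1 : onShell p 1 = -p 0 := rfl
  have e2 : onShell p 2 = -p 1 := rfl
  have e3 : onShell p 3 = -p 2 := rfl
  simp [Fin.sum_univ_four, ε, e0, e1, e2, e3, mul_pow, hc]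
  ring

/-- The contraction of the cyclic identity. -/
theorem sum_cyclic_contraction (σ : Fin 4) (k n N : Fin 4 → ℂ) (N₀ : ℂ) :
    ∑ τ, ∑ ρ, ε τ * ε ρ *
      (k τ * (N₀ * (η σ ρ * n ρ - η ρ ρ * n σ) +
          n ρ * ∑ ν, N ν * (η σ ν * n ρ - η ρ ν * n σ)) +
        k ρ * (N₀ * (η τ ρ * n σ - η σ ρ * n τ) +
          n ρ * ∑ ν, N ν * (η τ ν * n σ - η σ ν * n τ)) +
        k σ * (N₀ * (η ρ ρ * n τ - η τ ρ * n ρ) +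
          n ρ * ∑ ν, N ν * (η ρ ν * n τ - η τ ν * n ρ))) * k τ =
    (∑ μ, ε μ * k μ ^ 2) * (-2 * N₀ * n σ + (∑ μ, ε μ * n μ ^ 2) * (ε σ * N σ) -
        (∑ μ, n μ * N μ) * n σ) - k σ * (∑ μ, ε μ * n μ ^ 2) * (∑ μ, k μ * N μ) +
      (∑ μ, ε μ * k μ * n μ) * (2 * k σ * N₀ + k σ * (∑ μ, n μ * N μ) + (∑ μ, k μ * N μ) * n σ -
        ε σ * N σ * (∑ μ, ε μ * k μ * n μ)) := by
  fin_cases σ <;> simp [Fin.sum_univ_four, η, ε] <;> ring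

/-- Integration by parts over the directions of the relative momentum n at fixed total momentum k.
The cyclic identity, which only involves Lorentz transformations fixing k, is applied to k_τ n_ρ
N(n), multiplied by k^τ and contracted in ρ. On the mass shell k·n = 0 and n² = -k²/4, and Euler's
relation gives n·∂N = dN. The result is -k² times the asserted expression, and k² can be cancelled.
-/
theorem loopInt_relMom_mul {d : ℕ} {N : DerivPoly} (hN : N.IsHomogeneous d) (σ : Fin 4)
    (g : 𝓢(Minkowski, ℂ)) :
    loopInt ((d + 2 : ℂ) • (relMom σ * MvPolynomial.aeval relMom N) + (1 / 4 : ℂ) •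
      ∑ ν, (η σ ν • totSq - totMom σ * totMom ν) *
        MvPolynomial.aeval relMom (MvPolynomial.pderiv ν N)) g = 0 := by
  refine loopInt_eq_zero_of_totSq_mul (fun g => ?_) g
  have key : loopInt (-∑ τ, ∑ ρ, (ε τ * ε ρ) •
      (totMom τ * lorentz ρ σ (totMom τ * (relMom ρ * MvPolynomial.aeval relMom N)) +
        totMom ρ * lorentz σ τ (totMom τ * (relMom ρ * MvPolynomial.aeval relMom N)) +
        totMom σ * lorentz τ ρ (totMom τ * (relMom ρ * MvPolynomial.aeval relMom N)))) g = 0 := by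
    rw [loopInt_neg, ← loopIntL_apply, map_sum]
    simp only [map_sum, map_smul, loopIntL_apply, loopInt_cyclic, smul_zero, Finset.sum_const_zero,
      neg_zero]
  rw [← key]
  refine loopInt_congr (fun z => ?_) g
  have euler := congrArg (fun P => MvPolynomial.eval (momPoint z) (MvPolynomial.aeval relMom P))
    hN.sum_X_mul_pderiv
  simp only [map_sum, map_mul, MvPolynomial.aeval_X, nsmul_eq_mul, map_natCast] at euler
  have hp := sum_ε_onShell_sq z.1
  have hq := sum_ε_onShell_sq z.2
  set k : Fin 4 → ℂ := fun μ => MvPolynomial.eval (momPoint z) (totMom μ) with hk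
  set n : Fin 4 → ℂ := fun μ => MvPolynomial.eval (momPoint z) (relMom μ) with hn
  set M : Fin 4 → ℂ := fun μ => MvPolynomial.eval (momPoint z)
    (MvPolynomial.aeval relMom (MvPolynomial.pderiv μ N)) with hM
  set M₀ := MvPolynomial.eval (momPoint z) (MvPolynomial.aeval relMom N) with hM₀
  have c := sum_cyclic_contraction σ k n M M₀
  -- This relation and the next one express that both momenta are light-like.
  have hkn : ∑ μ, ε μ * k μ * n μ = 0 := by
    have : ∑ μ, ε μ * k μ * n μ = (1 / 2) *
        (∑ μ, ε μ * (Complex.I * (onShell z.1 μ : ℂ)) ^ 2 -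
          ∑ μ, ε μ * (Complex.I * (onShell z.2 μ : ℂ)) ^ 2) := by
      rw [← Finset.sum_sub_distrib, Finset.mul_sum]
      refine Finset.sum_congr rfl fun μ _ => ?_
      simp only [hk, hn, totMom, relMom, map_add, map_sub, MvPolynomial.smul_eval,
        MvPolynomial.eval_X, momPoint, Sum.elim_inl, Sum.elim_inr]
      ring
    rw [this, hp, hq]
    ring
  have hnn : ∑ μ, ε μ * n μ ^ 2 = -(1 / 4) * ∑ μ, ε μ * k μ ^ 2 := by
    have : ∑ μ, ε μ * n μ ^ 2 = -(1 / 4) * ∑ μ, ε μ * k μ ^ 2 + (1 / 2) *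
        (∑ μ, ε μ * (Complex.I * (onShell z.1 μ : ℂ)) ^ 2 +
          ∑ μ, ε μ * (Complex.I * (onShell z.2 μ : ℂ)) ^ 2) := by
      rw [← Finset.sum_add_distrib, Finset.mul_sum, Finset.mul_sum, ← Finset.sum_add_distrib]
      refine Finset.sum_congr rfl fun μ _ => ?_
      simp only [hk, hn, totMom, relMom, map_add, map_sub, MvPolynomial.smul_eval,
        MvPolynomial.eval_X, momPoint, Sum.elim_inl, Sum.elim_inr]
      ring
    rw [this, hp, hq]
    ring
  have hE : ∑ μ, n μ * M μ = d * M₀ := euler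
  have hK : MvPolynomial.eval (momPoint z) totSq = ∑ μ, ε μ * k μ ^ 2 := by
    simp [totSq, hk, MvPolynomial.smul_eval]
  have hR : MvPolynomial.eval (momPoint z) (∑ τ, ∑ ρ, (ε τ * ε ρ) •
      (totMom τ * lorentz ρ σ (totMom τ * (relMom ρ * MvPolynomial.aeval relMom N)) +
        totMom ρ * lorentz σ τ (totMom τ * (relMom ρ * MvPolynomial.aeval relMom N)) +
        totMom σ * lorentz τ ρ (totMom τ * (relMom ρ * MvPolynomial.aeval relMom N)))) =
      ∑ τ, ∑ ρ, ε τ * ε ρ *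
      (k τ * (M₀ * (η σ ρ * n ρ - η ρ ρ * n σ) +
          n ρ * ∑ ν, M ν * (η σ ν * n ρ - η ρ ν * n σ)) +
        k ρ * (M₀ * (η τ ρ * n σ - η σ ρ * n τ) +
          n ρ * ∑ ν, M ν * (η τ ν * n σ - η σ ν * n τ)) +
        k σ * (M₀ * (η ρ ρ * n τ - η τ ρ * n ρ) +
          n ρ * ∑ ν, M ν * (η ρ ν * n τ - η τ ν * n ρ))) * k τ := by
    simp only [map_sum, MvPolynomial.smul_eval]
    refine Finset.sum_congr rfl fun τ _ => Finset.sum_congr rfl fun ρ _ => ?_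
    simp only [Derivation.leibniz, lorentz_totMom, lorentz_relMom, lorentz_aeval_relMom, smul_eq_mul,
      map_add, map_mul, map_sub, map_sum, MvPolynomial.smul_eval]
    change ε τ * ε ρ * (k τ * (k τ * (n ρ * ∑ ν, M ν * (η σ ν * n ρ - η ρ ν * n σ) +
      M₀ * (η σ ρ * n ρ - η ρ ρ * n σ)) + n ρ * M₀ * (η σ τ * k ρ - η ρ τ * k σ)) +
      k ρ * (k τ * (n ρ * ∑ ν, M ν * (η τ ν * n σ - η σ ν * n τ) +
      M₀ * (η τ ρ * n σ - η σ ρ * n τ)) + n ρ * M₀ * (η τ τ * k σ - η σ τ * k τ)) +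
      k σ * (k τ * (n ρ * ∑ ν, M ν * (η ρ ν * n τ - η τ ν * n ρ) +
      M₀ * (η ρ ρ * n τ - η τ ρ * n ρ)) + n ρ * M₀ * (η ρ τ * k τ - η τ τ * k ρ))) = _
    ring
  have hF : ∑ ν, (η σ ν * (∑ μ, ε μ * k μ ^ 2) - k σ * k ν) * M ν =
      (∑ μ, ε μ * k μ ^ 2) * (ε σ * M σ) - k σ * ∑ ν, k ν * M ν := by
    simp only [sub_mul, Finset.sum_sub_distrib]
    congr 1
    · rw [Finset.sum_eq_single σ]
      · simp only [η, if_true]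
        ring
      · intro ν _ hν
        simp [η, hν.symm]
      · simp
    · rw [Finset.mul_sum]
      exact Finset.sum_congr rfl fun ν _ => by ring
  rw [map_neg, hR, c, hkn, hnn, hE, map_mul, map_add, MvPolynomial.smul_eval, MvPolynomial.smul_eval,
    map_sum, hK]
  simp only [map_mul, map_sub, MvPolynomial.smul_eval, hK]
  change _ * (_ * (n σ * M₀) + 1 / 4 * ∑ ν, (η σ ν * (∑ μ, ε μ * k μ ^ 2) - k σ * k ν) * M ν) = _
  rw [hF]
  ring

/-! ### Reduction of tensor integrals -/

/-- The d'Alembert operator. -/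
def boxPoly : DerivPoly := ∑ μ, ε μ • MvPolynomial.X μ ^ 2

/-- The distribution of the weight `f` is `P(∂) (D₀⁽⁺⁾)²` with a homogeneous polynomial `P` of
degree `d` that is congruent to `N` modulo the wave operator. -/
def ReducesTo (d : ℕ) (f : MomPoly) (N : DerivPoly) : Prop :=
  ∃ P : DerivPoly, P.IsHomogeneous d ∧ loopDistr f = diffOp (prodDplus 0 0) P ∧
    P - N ∈ Ideal.span {boxPoly}

theorem ReducesTo.add {d : ℕ} {f f' : MomPoly} {N N' : DerivPoly} (h : ReducesTo d f N)
    (h' : ReducesTo d f' N') : ReducesTo d (f + f') (N + N') := by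
  obtain ⟨P, hP, hf, hN⟩ := h
  obtain ⟨P', hP', hf', hN'⟩ := h'
  refine ⟨P + P', hP.add hP', by rw [map_add, map_add, hf, hf'], ?_⟩
  rw [add_sub_add_comm]
  exact Ideal.add_mem _ hN hN'

theorem ReducesTo.smul {d : ℕ} {f : MomPoly} {N : DerivPoly} (a : ℂ) (h : ReducesTo d f N) :
    ReducesTo d (a • f) (a • N) := by
  obtain ⟨P, hP, hf, hN⟩ := h
  refine ⟨a • P, (MvPolynomial.homogeneousSubmodule _ _ d).smul_mem a hP,
    by rw [map_smul, map_smul, hf], ?_⟩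
  rw [← smul_sub, MvPolynomial.smul_eq_C_mul]
  exact Ideal.mul_mem_left _ _ hN

theorem reducesTo_zero (d : ℕ) : ReducesTo d 0 0 :=
  ⟨0, MvPolynomial.isHomogeneous_zero _ _ d, by simp, by simp⟩

theorem ReducesTo.sum {ι : Type*} {d : ℕ} (s : Finset ι) {f : ι → MomPoly} {N : ι → DerivPoly}
    (h : ∀ i ∈ s, ReducesTo d (f i) (N i)) : ReducesTo d (∑ i ∈ s, f i) (∑ i ∈ s, N i) := by
  classical
  induction s using Finset.induction_on with
  | empty => simpa using reducesTo_zero d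
  | insert a s ha ih =>
    rw [Finset.sum_insert ha, Finset.sum_insert ha]
    exact (h a (Finset.mem_insert_self _ _)).add
      (ih fun i hi => h i (Finset.mem_insert_of_mem hi))

theorem ReducesTo.totMom_mul {d : ℕ} {f : MomPoly} {N : DerivPoly} (h : ReducesTo d f N)
    (μ : Fin 4) : ReducesTo (d + 1) (totMom μ * f) (MvPolynomial.X μ * N) := by
  obtain ⟨P, hP, hf, hN⟩ := h
  refine ⟨MvPolynomial.X μ * P, ?_, ?_, ?_⟩
  · rw [add_comm]
    exact (MvPolynomial.isHomogeneous_X ℂ μ).mul hP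
  · rw [loopDistr_totMom_mul, hf, diffOp_X_mul]
  · rw [← mul_sub]
    exact Ideal.mul_mem_left _ _ hN

theorem ReducesTo.congr_right {d : ℕ} {f : MomPoly} {N N' : DerivPoly} (h : ReducesTo d f N)
    (hN' : N - N' ∈ Ideal.span {boxPoly}) : ReducesTo d f N' := by
  obtain ⟨P, hP, hf, hN⟩ := h
  refine ⟨P, hP, hf, ?_⟩
  rw [← sub_add_sub_cancel P N N']
  exact Ideal.add_mem _ hN hN'

theorem ReducesTo.totSq_mul {d : ℕ} {f : MomPoly} {N : DerivPoly} (h : ReducesTo d f N) :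
    ReducesTo (d + 2) (totSq * f) 0 := by
  have h1 : ReducesTo (d + 2) (∑ μ, ε μ • (totMom μ * (totMom μ * f)))
      (∑ μ, ε μ • (MvPolynomial.X μ * (MvPolynomial.X μ * N))) :=
    ReducesTo.sum _ fun μ _ => ((h.totMom_mul μ).totMom_mul μ).smul (ε μ)
  have e1 : totSq * f = ∑ μ, ε μ • (totMom μ * (totMom μ * f)) := by
    rw [totSq, Finset.sum_mul]
    refine Finset.sum_congr rfl fun μ _ => ?_
    rw [smul_mul_assoc, pow_two, mul_assoc]
  rw [e1]
  refine h1.congr_right ?_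
  have e2 : ∑ μ, ε μ • (MvPolynomial.X μ * (MvPolynomial.X μ * N)) - 0 = N * boxPoly := by
    rw [sub_zero, boxPoly, Finset.mul_sum]
    refine Finset.sum_congr rfl fun μ _ => ?_
    rw [mul_smul_comm, pow_two]
    congr 1
    ring
  rw [e2]
  exact Ideal.mul_mem_left _ _ (Ideal.subset_span rfl)

theorem reducesTo_C (a : ℂ) : ReducesTo 0 (MvPolynomial.C a) (MvPolynomial.C a) := by
  refine ⟨MvPolynomial.C a, MvPolynomial.isHomogeneous_C _ a, ?_, by simp⟩
  have h : loopDistr 1 = prodDplus 0 0 := by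
    rw [← MvPolynomial.C_1, ← MvPolynomial.monomial_zero', loopDistr_monomial_one]
    rfl
  rw [← mul_one (MvPolynomial.C a), ← MvPolynomial.smul_eq_C_mul, map_smul, h,
    ← mul_one (MvPolynomial.C a), ← MvPolynomial.smul_eq_C_mul, map_smul, diffOp_one]

/-! ### Moments of the momenta modulo the wave operator. -/

/-- The moments of the uniform distribution on `[-1/2, 1/2]`. -/
def moment : ℕ → ℂ
  | 0 => 1
  | 1 => 0
  | d + 2 => (d + 1 : ℂ) / (4 * (d + 3)) * moment d

/-- A homogeneous polynomial is a combination of products with the variables. -/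
theorem exists_eq_sum_X_mul {d : ℕ} {N : DerivPoly} (hN : N.IsHomogeneous (d + 1)) :
    ∃ N' : Fin 4 → DerivPoly, (∀ μ, (N' μ).IsHomogeneous d) ∧
      N = ∑ μ, MvPolynomial.X μ * N' μ := by
  refine ⟨fun μ => ((d + 1 : ℂ)⁻¹) • MvPolynomial.pderiv μ N, fun μ => ?_, ?_⟩
  · exact (MvPolynomial.homogeneousSubmodule _ _ d).smul_mem _ (by simpa using hN.pderiv (i := μ))
  · simp only [mul_smul_comm, ← Finset.smul_sum]
    rw [hN.sum_X_mul_pderiv, ← Nat.cast_smul_eq_nsmul ℂ, smul_smul]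
    push_cast
    rw [inv_mul_cancel₀ (by exact_mod_cast Nat.succ_ne_zero d), one_smul]

theorem eq_smul_of_smul_add_eq_zero {V : Type*} [AddCommGroup V] [Module ℂ V] {x y : V} {a : ℂ}
    (ha : a ≠ 0) (h : a • x + (1 / 4 : ℂ) • y = 0) : x = (-(1 / (4 * a)) : ℂ) • y := by
  have e : x = a⁻¹ • (a • x + (1 / 4 : ℂ) • y) + (-(1 / (4 * a)) : ℂ) • y := by
    rw [smul_add, smul_smul, inv_mul_cancel₀ ha, one_smul, smul_smul, add_assoc, ← add_smul,
      show a⁻¹ * (1 / 4) + -(1 / (4 * a)) = 0 by field_simp; ring, zero_smul, add_zero]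
  rwa [h, smul_zero, zero_add] at e

/-- In the recursion the term with k² is a multiple of the wave operator, so only -k_σ k·∂N
survives. Euler's relation, now in the variable k, turns it into the factor d. -/
theorem reducesTo_relMom_mul {d : ℕ} {N : DerivPoly} (hN : N.IsHomogeneous d)
    (c : ℂ) (h : ∀ ν, ReducesTo (d - 1) (MvPolynomial.aeval relMom (MvPolynomial.pderiv ν N))
      (c • MvPolynomial.pderiv ν N)) (σ : Fin 4) :
    ReducesTo (d + 1) (relMom σ * MvPolynomial.aeval relMom N)
      ((d / (4 * (d + 2)) * c : ℂ) • (MvPolynomial.X σ * N)) := by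
  have hd : (d + 2 : ℂ) ≠ 0 := by exact_mod_cast (Nat.succ_ne_zero (d + 1))
  have hrec := loopDistr_eq_zero (loopInt_relMom_mul hN σ)
  rw [map_add, map_smul, map_smul] at hrec
  have e : loopDistr (relMom σ * MvPolynomial.aeval relMom N) = loopDistr
      ((-(1 / (4 * (d + 2))) : ℂ) • ∑ ν, (η σ ν • totSq - totMom σ * totMom ν) *
        MvPolynomial.aeval relMom (MvPolynomial.pderiv ν N)) := by
    rw [map_smul]
    exact eq_smul_of_smul_add_eq_zero hd hrec
  suffices hs : ReducesTo (d + 1)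
      ((-(1 / (4 * (d + 2))) : ℂ) • ∑ ν, (η σ ν • totSq - totMom σ * totMom ν) *
        MvPolynomial.aeval relMom (MvPolynomial.pderiv ν N))
      ((d / (4 * (d + 2)) * c : ℂ) • (MvPolynomial.X σ * N)) by
    obtain ⟨P, hP, hf, hP'⟩ := hs
    exact ⟨P, hP, e.trans hf, hP'⟩
  -- For d = 0 the degree d - 1 is truncated, but the derivatives of a constant vanish and both
  -- sides are zero.
  rcases Nat.eq_zero_or_pos d with rfl | hpos
  · have h0 (ν : Fin 4) : MvPolynomial.pderiv ν N = 0 := by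
      rw [MvPolynomial.totalDegree_eq_zero_iff_eq_C.mp
        ((MvPolynomial.totalDegree_zero_iff_isHomogeneous _).mpr hN)]
      simp
    simp only [h0, map_zero, mul_zero, Finset.sum_const_zero, smul_zero, Nat.cast_zero, zero_div,
      zero_mul, zero_smul]
    exact reducesTo_zero 1
  obtain ⟨m, rfl⟩ := Nat.exists_eq_succ_of_ne_zero hpos.ne'
  simp only [Nat.succ_eq_add_one, Nat.add_sub_cancel] at h
  have h1 : ReducesTo (m + 1 + 1) (∑ ν, (η σ ν • totSq - totMom σ * totMom ν) *
        MvPolynomial.aeval relMom (MvPolynomial.pderiv ν N))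
      (∑ ν, (η σ ν • 0 + (-1 : ℂ) • (MvPolynomial.X σ * (MvPolynomial.X ν *
        (c • MvPolynomial.pderiv ν N))))) := by
    refine ReducesTo.sum _ fun ν _ => ?_
    have := ((h ν).totSq_mul.smul (η σ ν)).add ((((h ν).totMom_mul ν).totMom_mul σ).smul (-1))
    convert this using 1
    rw [sub_mul, smul_mul_assoc, neg_one_smul, mul_assoc, sub_eq_add_neg]
  convert h1.smul (-(1 / (4 * ((m.succ : ℕ) + 2))) : ℂ) using 1
  simp only [smul_zero, zero_add, mul_smul_comm, ← Finset.smul_sum, ← Finset.mul_sum]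
  rw [hN.sum_X_mul_pderiv, ← Nat.cast_smul_eq_nsmul ℂ, mul_smul_comm, smul_smul, smul_smul,
    smul_smul]
  congr 1
  ring

/-- On the cone k² = 0 the relative momentum behaves like x k with x uniformly distributed in [-1/2,
1/2]. The induction goes down by two degrees, since one factor n is split off and N is
differentiated once. -/
theorem reducesTo_aeval_relMom (d : ℕ) : ∀ N : DerivPoly, N.IsHomogeneous d →
    ReducesTo d (MvPolynomial.aeval relMom N) (moment d • N) := by
  induction d using Nat.strong_induction_on with
  | _ d ih =>
    intro N hN
    rcases d with _ | d
    · rw [MvPolynomial.totalDegree_eq_zero_iff_eq_C.mp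
        ((MvPolynomial.totalDegree_zero_iff_isHomogeneous _).mpr hN)]
      simpa [moment, MvPolynomial.aeval_C] using reducesTo_C _
    · obtain ⟨N', hN', rfl⟩ := exists_eq_sum_X_mul hN
      rw [map_sum, Finset.smul_sum]
      refine ReducesTo.sum _ fun μ _ => ?_
      rw [map_mul, MvPolynomial.aeval_X]
      have h := reducesTo_relMom_mul (hN' μ) (moment (d - 1))
        (fun ν => ih (d - 1) (by omega) _ (hN' μ).pderiv) μ
      convert h using 2
      rcases d with _ | d
      · simp [moment]
      · simp only [moment, Nat.add_sub_cancel]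
        push_cast
        ring

/-- The moments of the momentum fractions of the two particles. -/
def loopMoment : ℕ → ℕ → ℕ → ℂ
  | 0, 0, m => moment m
  | 0, b + 1, m => 1 / 2 * loopMoment 0 b m - loopMoment 0 b (m + 1)
  | a + 1, b, m => 1 / 2 * loopMoment a b m + loopMoment a b (m + 1)

/-- With p = k/2 + n, q = k/2 - n and n replaced by x k, the constant is the mean of (1/2 + x)^a
(1/2 - x)^b x^m. One factor p or q is expanded at a time, which raises m; hence m and N have to stay
general in the induction. -/
theorem reducesTo_mul (a b : ℕ) : ∀ (m : ℕ) (A B N : DerivPoly), A.IsHomogeneous a →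
    B.IsHomogeneous b → N.IsHomogeneous m →
    ReducesTo (a + b + m) (MvPolynomial.rename Sum.inl A * MvPolynomial.rename Sum.inr B *
      MvPolynomial.aeval relMom N) (loopMoment a b m • (A * B * N)) := by
  have inl (μ : Fin 4) : (MvPolynomial.X (Sum.inl μ) : MomPoly) =
      (1 / 2 : ℂ) • totMom μ + relMom μ := by
    rw [totMom, relMom]
    module
  have inr (μ : Fin 4) : (MvPolynomial.X (Sum.inr μ) : MomPoly) =
      (1 / 2 : ℂ) • totMom μ + (-1 : ℂ) • relMom μ := by
    rw [totMom, relMom]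
    module
  have hC (P : DerivPoly) (hP : P.IsHomogeneous 0) : ∃ x : ℂ, P = MvPolynomial.C x :=
    ⟨_, MvPolynomial.totalDegree_eq_zero_iff_eq_C.mp
        ((MvPolynomial.totalDegree_zero_iff_isHomogeneous _).mpr hP)⟩
  induction a with
  | zero =>
    induction b with
    | zero =>
      intro m A B N hA hB hN
      obtain ⟨x, rfl⟩ := hC A hA
      obtain ⟨y, rfl⟩ := hC B hB
      have := (reducesTo_aeval_relMom m N hN).smul (x * y)
      rw [zero_add, zero_add]
      convert this using 1
      · simp only [MvPolynomial.rename_C, MvPolynomial.smul_eq_C_mul, map_mul]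
      · simp only [loopMoment, MvPolynomial.smul_eq_C_mul, map_mul]
        ring
    | succ b ih =>
      intro m A B N hA hB hN
      obtain ⟨B', hB', rfl⟩ := exists_eq_sum_X_mul hB
      have h : ReducesTo (0 + (b + 1) + m) (∑ μ, ((1 / 2 : ℂ) • (totMom μ *
          (MvPolynomial.rename Sum.inl A * MvPolynomial.rename Sum.inr (B' μ) *
            MvPolynomial.aeval relMom N)) + (-1 : ℂ) •
          (MvPolynomial.rename Sum.inl A * MvPolynomial.rename Sum.inr (B' μ) *
            MvPolynomial.aeval relMom (MvPolynomial.X μ * N))))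
          (∑ μ, ((1 / 2 : ℂ) • (MvPolynomial.X μ * loopMoment 0 b m • (A * B' μ * N)) +
            (-1 : ℂ) • loopMoment 0 b (m + 1) • (A * B' μ * (MvPolynomial.X μ * N)))) := by
        refine ReducesTo.sum _ fun μ _ => ReducesTo.add (ReducesTo.smul _ ?_)
          (ReducesTo.smul _ ?_)
        · have := (ih m A (B' μ) N hA (hB' μ) hN).totMom_mul μ
          convert this using 1
          ring
        · have := ih (m + 1) A (B' μ) (MvPolynomial.X μ * N) hA (hB' μ)
            (by rw [add_comm]; exact (MvPolynomial.isHomogeneous_X ℂ μ).mul hN)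
          convert this using 1
          ring
      convert h using 1
      · rw [map_sum, Finset.mul_sum, Finset.sum_mul]
        refine Finset.sum_congr rfl fun μ _ => ?_
        rw [map_mul, MvPolynomial.rename_X, inr, map_mul, MvPolynomial.aeval_X]
        simp only [MvPolynomial.smul_eq_C_mul]
        ring
      · rw [Finset.mul_sum, Finset.sum_mul, Finset.smul_sum]
        refine Finset.sum_congr rfl fun μ _ => ?_
        simp only [loopMoment, MvPolynomial.smul_eq_C_mul, map_sub, map_mul, map_neg, map_one]
        ring
  | succ a ih =>
    intro m A B N hA hB hN
    obtain ⟨A', hA', rfl⟩ := exists_eq_sum_X_mul hA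
    have h : ReducesTo (a + 1 + b + m) (∑ μ, ((1 / 2 : ℂ) • (totMom μ *
        (MvPolynomial.rename Sum.inl (A' μ) * MvPolynomial.rename Sum.inr B *
          MvPolynomial.aeval relMom N)) +
        (MvPolynomial.rename Sum.inl (A' μ) * MvPolynomial.rename Sum.inr B *
          MvPolynomial.aeval relMom (MvPolynomial.X μ * N))))
        (∑ μ, ((1 / 2 : ℂ) • (MvPolynomial.X μ * loopMoment a b m • (A' μ * B * N)) +
          loopMoment a b (m + 1) • (A' μ * B * (MvPolynomial.X μ * N)))) := by
      refine ReducesTo.sum _ fun μ _ => ReducesTo.add (ReducesTo.smul _ ?_) ?_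
      · have := (ih m (A' μ) B N (hA' μ) hB hN).totMom_mul μ
        convert this using 1
        ring
      · have := ih (m + 1) (A' μ) B (MvPolynomial.X μ * N) (hA' μ) hB
          (by rw [add_comm]; exact (MvPolynomial.isHomogeneous_X ℂ μ).mul hN)
        convert this using 1
        ring
    convert h using 1
    · rw [map_sum, Finset.sum_mul, Finset.sum_mul]
      refine Finset.sum_congr rfl fun μ _ => ?_
      rw [map_mul, MvPolynomial.rename_X, inl, map_mul, MvPolynomial.aeval_X]
      simp only [MvPolynomial.smul_eq_C_mul]
      ring
    · rw [Finset.sum_mul, Finset.sum_mul, Finset.smul_sum]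
      refine Finset.sum_congr rfl fun μ _ => ?_
      simp only [loopMoment, MvPolynomial.smul_eq_C_mul, map_add, map_mul]
      ring

/-- Products of derivatives of `D₀⁽⁺⁾` are derivatives of `(D₀⁽⁺⁾)²`; modulo the wave operator, the
differential operator is a multiple of `∂^{γ₁+γ₂}` that only depends on the orders of `γ₁`, `γ₂`. -/
theorem exists_prodDplus_eq_diffOp (γ₁ γ₂ : Fin 4 →₀ ℕ) :
    ∃ P : DerivPoly, P.IsHomogeneous (γ₁.degree + γ₂.degree) ∧
      prodDplus γ₁ γ₂ = diffOp (prodDplus 0 0) P ∧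
      P - loopMoment γ₁.degree γ₂.degree 0 • MvPolynomial.monomial (γ₁ + γ₂) 1 ∈
        Ideal.span {boxPoly} := by
  have h := reducesTo_mul γ₁.degree γ₂.degree 0 (MvPolynomial.monomial γ₁ 1)
    (MvPolynomial.monomial γ₂ 1) 1 (MvPolynomial.isHomogeneous_monomial 1 rfl)
    (MvPolynomial.isHomogeneous_monomial 1 rfl) (MvPolynomial.isHomogeneous_one _ _)
  obtain ⟨P, hP, hf, hN⟩ := h
  refine ⟨P, hP, ?_, ?_⟩
  · rw [← hf, map_one (MvPolynomial.aeval relMom), mul_one, MvPolynomial.rename_monomial, MvPolynomial.rename_monomial,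
      MvPolynomial.monomial_mul, one_mul, loopDistr_monomial_one]
    congr 1
    · ext μ
      simp [Finsupp.mapDomain_apply Sum.inl_injective, Finsupp.mapDomain_of_notMem_range]
    · ext μ
      simp [Finsupp.mapDomain_apply Sum.inr_injective, Finsupp.mapDomain_of_notMem_range]
  · rwa [mul_one, MvPolynomial.monomial_mul, one_mul] at hN

/-! ### Non-degeneracy of the causal distribution -/

theorem diffOp_C (d : Distr) (a : ℂ) : diffOp d (MvPolynomial.C a) = a • d := by
  rw [← mul_one (MvPolynomial.C a), ← MvPolynomial.smul_eq_C_mul, map_smul, diffOp_one]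

theorem diffOp_mul_X (d : Distr) (μ : Fin 4) (P : DerivPoly) :
    diffOp d (P * MvPolynomial.X μ) = partialD μ (diffOp d P) := by
  rw [mul_comm, diffOp_X_mul]

theorem diffOp_smul_left (a : ℂ) (d : Distr) (P : DerivPoly) :
    diffOp (a • d) P = a • diffOp d P := by
  induction P using MvPolynomial.induction_on with
  | C b => rw [diffOp_C, diffOp_C, smul_comm]
  | add P Q hP hQ => rw [map_add, map_add, hP, hQ, smul_add]
  | mul_X P μ hP => rw [diffOp_mul_X, diffOp_mul_X, hP, map_smul]

theorem diffOp_sub_left (d d' : Distr) (P : DerivPoly) :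
    diffOp (d - d') P = diffOp d P - diffOp d' P := by
  induction P using MvPolynomial.induction_on with
  | C b => rw [diffOp_C, diffOp_C, diffOp_C, smul_sub]
  | add P Q hP hQ => rw [map_add, map_add, map_add, hP, hQ, add_sub_add_comm]
  | mul_X P μ hP => rw [diffOp_mul_X, diffOp_mul_X, diffOp_mul_X, hP, map_sub]

/-- The reflection `P(∂) ↦ P(-∂)`. -/
def negX : DerivPoly →ₐ[ℂ] DerivPoly := MvPolynomial.aeval fun μ => -MvPolynomial.X μ

theorem negX_X (μ : Fin 4) : negX (MvPolynomial.X μ) = -MvPolynomial.X μ := by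
  simp [negX]

theorem reflect_apply (d : Distr) (φ : 𝓢(Minkowski, ℂ)) :
    reflect d φ = d (SchwartzMap.compCLMOfContinuousLinearEquiv ℂ
      (ContinuousLinearEquiv.neg ℝ : Minkowski ≃L[ℝ] Minkowski) φ) := rfl

theorem reflect_reflect (d : Distr) : reflect (reflect d) = d := by
  ext φ
  rw [reflect_apply, reflect_apply]
  congr 1
  ext x
  simp [SchwartzMap.compCLMOfContinuousLinearEquiv_apply]

theorem partialD_reflect (μ : Fin 4) (d : Distr) :
    partialD μ (reflect d) = -reflect (partialD μ d) := by
  ext φ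
  rw [partialD_apply, reflect_apply]
  change _ = -(reflect (partialD μ d) φ)
  rw [reflect_apply, partialD_apply, ← map_neg]
  congr 1
  rw [schwartzPartial, schwartzPartial, SchwartzMap.lineDerivOp_compCLMOfContinuousLinearEquiv]
  ext x
  simp [SchwartzMap.compCLMOfContinuousLinearEquiv_apply, LineDeriv.lineDerivOp_left_neg]

theorem reflect_diffOp (d : Distr) (P : DerivPoly) :
    reflect (diffOp d P) = diffOp (reflect d) (negX P) := by
  induction P using MvPolynomial.induction_on with
  | C b => rw [negX, MvPolynomial.aeval_C, MvPolynomial.algebraMap_eq, diffOp_C, diffOp_C, map_smul]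
  | add P Q hP hQ => rw [map_add, map_add, hP, hQ, map_add, map_add]
  | mul_X P μ hP =>
    rw [map_mul negX, negX_X, mul_neg, map_neg (diffOp _), diffOp_mul_X, diffOp_mul_X, ← hP,
      partialD_reflect]
    exact (neg_neg _).symm

theorem smul_sub_eq_neg {M : Type*} [AddCommGroup M] [Module ℂ M] (a : ℂ) (x y : M) :
    a • (y - x) = -(a • (x - y)) := by
  rw [← smul_neg, neg_sub]

theorem reflect_d₂ : reflect d₂ = -d₂ := by
  rw [d₂, map_smul, map_sub, reflect_reflect]
  exact smul_sub_eq_neg _ _ _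

theorem loopDistr_aeval_totMom (P : DerivPoly) :
    loopDistr (MvPolynomial.aeval totMom P) = diffOp (prodDplus 0 0) P := by
  induction P using MvPolynomial.induction_on with
  | C a =>
    have h : loopDistr 1 = prodDplus 0 0 := by
      rw [← MvPolynomial.C_1, ← MvPolynomial.monomial_zero', loopDistr_monomial_one]
      rfl
    rw [MvPolynomial.aeval_C, diffOp_C, MvPolynomial.algebraMap_eq, ← mul_one (MvPolynomial.C a),
      ← MvPolynomial.smul_eq_C_mul, map_smul, h]
  | add P Q hP hQ => rw [map_add, map_add, hP, hQ, map_add]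
  | mul_X P μ hP =>
    rw [map_mul, MvPolynomial.aeval_X, mul_comm, loopDistr_totMom_mul, hP, diffOp_mul_X]

/-- The value of `P(∂)` at the frequency `ξ`. -/
def freqEval (P : DerivPoly) (ξ : Minkowski) : ℂ :=
  MvPolynomial.eval (fun μ => -(2 * Real.pi * Complex.I) * (ξ μ : ℂ)) P

theorem contDiff_freqEval (P : DerivPoly) {n : WithTop ℕ∞} : ContDiff ℝ n (freqEval P) := by
  unfold freqEval
  induction P using MvPolynomial.induction_on with
  | C a => simpa using contDiff_const
  | add P Q hP hQ => simpa using hP.add hQ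
  | mul_X P μ hP =>
    simp only [map_mul, MvPolynomial.eval_X]
    have : ContDiff ℝ n fun ξ : Minkowski => (ξ μ : ℂ) :=
      Complex.ofRealCLM.contDiff.comp (by fun_prop)
    exact hP.mul (contDiff_const.mul this)

theorem eval_aeval_totMom (P : DerivPoly) (z : Mom × Mom) :
    MvPolynomial.eval (momPoint z) (MvPolynomial.aeval totMom P) = freqEval P (loopArg z) := by
  induction P using MvPolynomial.induction_on with
  | C a => simp [freqEval]
  | add P Q hP hQ =>
    simp only [freqEval, map_add] at hP hQ ⊢
    rw [hP, hQ]
  | mul_X P μ hP =>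
    simp only [freqEval, map_mul, MvPolynomial.aeval_X, eval_totMom, MvPolynomial.eval_X] at hP ⊢
    rw [hP]

theorem loopArg_zero (z : Mom × Mom) : loopArg z 0 = -((2 * Real.pi)⁻¹ * (‖z.1‖ + ‖z.2‖)) := by
  simp [loopArg, onShell]
  ring

theorem continuous_loopArg : Continuous loopArg := by
  have := continuous_onShell
  unfold loopArg
  fun_prop

/-- The two terms of d₂ have Fourier transforms carried by opposite cones. A test function whose
Fourier transform vanishes for ξ⁰ ≥ 0 sees only the square of D₀⁽⁺⁾, whose frequencies have ξ⁰ ≤ 0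
in the present convention. -/
theorem loopInt_eq_zero_of_diffOp_d₂ {P : DerivPoly} (h : diffOp d₂ P = 0) (g : 𝓢(Minkowski, ℂ))
    (hg : ∀ ξ : Minkowski, 0 ≤ ξ 0 → g ξ = 0) :
    loopInt (MvPolynomial.aeval totMom P) g = 0 := by
  set φ : 𝓢(Minkowski, ℂ) := FourierTransform.fourierInv g with hφ
  have hF : FourierTransform.fourier φ = g := FourierTransform.fourier_fourierInv_eq g
  have h1 : d₂ = (1 / 2 : ℂ) • (prodDplus 0 0 - reflect (prodDplus 0 0)) := rfl
  have h2 : diffOp (reflect (prodDplus 0 0)) P = reflect (diffOp (prodDplus 0 0) (negX P)) := by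
    rw [reflect_diffOp]
    congr 1
    have : (negX.comp negX) = AlgHom.id ℂ DerivPoly := by
      ext μ
      simp [negX]
    exact (AlgHom.congr_fun this P).symm
  rw [h1, diffOp_smul_left, diffOp_sub_left, h2, ← loopDistr_aeval_totMom,
    ← loopDistr_aeval_totMom] at h
  have h3 := congrArg (fun d : Distr => d φ) h
  change (1 / 2 : ℂ) * (loopDistr (MvPolynomial.aeval totMom P) φ -
    loopDistr (MvPolynomial.aeval totMom (negX P)) (SchwartzMap.compCLMOfContinuousLinearEquiv ℂ
      (ContinuousLinearEquiv.neg ℝ : Minkowski ≃L[ℝ] Minkowski) φ)) = 0 at h3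
  rw [loopDistr_apply, loopDistr_apply, hF] at h3
  have h4 : loopInt (MvPolynomial.aeval totMom (negX P)) (FourierTransform.fourier
      (SchwartzMap.compCLMOfContinuousLinearEquiv ℂ
        (ContinuousLinearEquiv.neg ℝ : Minkowski ≃L[ℝ] Minkowski) φ)) = 0 := by
    rw [loopInt]
    refine integral_eq_zero_of_ae (Filter.Eventually.of_forall fun z => ?_)
    have h5 : FourierTransform.fourier (SchwartzMap.compCLMOfContinuousLinearEquiv ℂ
        (ContinuousLinearEquiv.neg ℝ : Minkowski ≃L[ℝ] Minkowski) φ) (loopArg z) =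
        g (-loopArg z) := by
      rw [← hF, SchwartzMap.fourier_coe, SchwartzMap.fourier_coe, Real.fourier_eq, Real.fourier_eq,
        ← integral_neg_eq_self]
      congr 1
      funext v
      simp [SchwartzMap.compCLMOfContinuousLinearEquiv_apply]
    have h6 : g (-loopArg z) = 0 := by
      apply hg
      simp only [PiLp.neg_apply, loopArg_zero, neg_neg]
      positivity
    simp [loopIntegrand, h5, h6]
  rw [h4, mul_zero, sub_zero] at h3
  have hpi : (Real.pi : ℂ) ≠ 0 := by exact_mod_cast Real.pi_ne_zero
  have hc : (1 / 2 : ℂ) * (Complex.I / (2 * Real.pi) ^ 3) ^ 2 ≠ 0 := by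
    exact mul_ne_zero (by norm_num) (pow_ne_zero _ (div_ne_zero Complex.I_ne_zero
      (pow_ne_zero _ (mul_ne_zero two_ne_zero hpi))))
  rw [← mul_assoc] at h3
  exact (mul_eq_zero.mp h3).resolve_left hc

/-- Testing with a bump function times the complex conjugate of the symbol of P makes the integrand
χ|P|² times a non-negative weight. Its integral is zero, so it vanishes almost everywhere, and by
continuity at the given point. -/
theorem freqEval_loopArg_eq_zero {P : DerivPoly} (h : diffOp d₂ P = 0) (z₀ : Mom × Mom)
    (hp : z₀.1 ≠ 0) (hq : z₀.2 ≠ 0) : freqEval P (loopArg z₀) = 0 := by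
  set t := (2 * Real.pi)⁻¹ * (‖z₀.1‖ + ‖z₀.2‖) with ht
  have hpp := norm_pos_iff.mpr hp
  have hqq := norm_pos_iff.mpr hq
  have htpos : 0 < t := by positivity
  -- The centre has zeroth component -t, so the outer radius t/2 keeps the support in the half-space
  -- of negative ξ⁰.
  let χ : ContDiffBump (loopArg z₀) := ⟨t / 4, t / 2, by positivity, by linarith⟩
  let G : Minkowski → ℂ := fun ξ => (χ ξ : ℂ) * (starRingEnd ℂ) (freqEval P ξ)
  have hGs : HasCompactSupport G :=
    HasCompactSupport.mul_right (χ.hasCompactSupport.comp_left (g := fun x : ℝ => (x : ℂ)) rfl)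
  have hGc : ContDiff ℝ ((⊤ : ℕ∞) : WithTop ℕ∞) G :=
    (Complex.ofRealCLM.contDiff.comp χ.contDiff).mul
      (Complex.conjCLE.contDiff.comp (contDiff_freqEval P))
  let g : 𝓢(Minkowski, ℂ) := hGs.toSchwartzMap hGc
  have hgG (ξ : Minkowski) : g ξ = (χ ξ : ℂ) * (starRingEnd ℂ) (freqEval P ξ) := rfl
  have hg0 (ξ : Minkowski) (hξ : 0 ≤ ξ 0) : g ξ = 0 := by
    have : χ ξ = 0 := by
      apply χ.zero_of_le_dist
      change t / 2 ≤ dist ξ (loopArg z₀)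
      have h1 : |(ξ - loopArg z₀) 0| ≤ ‖ξ - loopArg z₀‖ := by
        simpa using PiLp.norm_apply_le (ξ - loopArg z₀) 0
      rw [dist_eq_norm]
      refine le_trans ?_ h1
      rw [PiLp.sub_apply, loopArg_zero, ← ht, sub_neg_eq_add, abs_of_nonneg (by positivity)]
      linarith
    rw [hgG, this]
    simp
  have hint := loopInt_eq_zero_of_diffOp_d₂ h g hg0
  let w : Mom × Mom → ℝ := fun z =>
    χ (loopArg z) * ‖freqEval P (loopArg z)‖ ^ 2 / ((2 * ‖z.1‖) * (2 * ‖z.2‖))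
  have hw (z : Mom × Mom) : loopIntegrand (MvPolynomial.aeval totMom P) g z = (w z : ℂ) := by
    simp only [loopIntegrand, eval_aeval_totMom, hgG, w]
    push_cast
    rw [← Complex.mul_conj']
    ring
  have hwint : Integrable w := by
    refine (integrable_loopIntegrand (MvPolynomial.aeval totMom P) g).re.congr
      (Filter.Eventually.of_forall fun z => ?_)
    simp only [hw]
    exact Complex.ofReal_re _
  have hw0 : 0 ≤ w := fun z => by
    have := χ.nonneg' (loopArg z)
    simp only [w, Pi.zero_apply]
    positivity
  have hwz : ∫ z, w z = 0 := by
    rw [loopInt] at hint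
    simp only [hw] at hint
    rw [integral_complex_ofReal] at hint
    exact_mod_cast hint
  have hae := (integral_eq_zero_iff_of_nonneg hw0 hwint).mp hwz
  -- Multiplying by |p||q| instead of dividing gives a function continuous everywhere, so that
  -- almost everywhere zero implies zero.
  have hcont : Continuous fun z : Mom × Mom =>
      χ (loopArg z) * ‖freqEval P (loopArg z)‖ ^ 2 * (‖z.1‖ * ‖z.2‖) := by
    have h1 := continuous_loopArg
    have h2 := (contDiff_freqEval P (n := 0)).continuous
    have h3 := χ.continuous
    fun_prop
  have heq : (fun z : Mom × Mom =>
      χ (loopArg z) * ‖freqEval P (loopArg z)‖ ^ 2 * (‖z.1‖ * ‖z.2‖)) = fun _ => 0 := by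
    refine (hcont.ae_eq_iff_eq volume continuous_const).mp ?_
    filter_upwards [hae] with z hz
    simp only [w, Pi.zero_apply, div_eq_zero_iff, mul_eq_zero, OfNat.ofNat_ne_zero, false_or] at hz
    simp only [mul_eq_zero]
    tauto
  have h1 := congrFun heq z₀
  have hχ : χ (loopArg z₀) = 1 :=
    χ.one_of_mem_closedBall (Metric.mem_closedBall_self χ.rIn_pos.le)
  simpa [hχ, hp, hq] using h1

/-- Every time-like momentum is the sum of two light-like ones. -/
theorem exists_onShell_add (κ : Fin 4 → ℝ) (h0 : 3 < κ 0) (h : ∀ i : Fin 3, |κ i.succ| < 1) :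
    ∃ z : Mom × Mom, z.1 ≠ 0 ∧ z.2 ≠ 0 ∧ ∀ μ, onShell z.1 μ + onShell z.2 μ = κ μ := by
  obtain ⟨a1, b1⟩ := abs_lt.mp (h 0)
  obtain ⟨a2, b2⟩ := abs_lt.mp (h 1)
  obtain ⟨a3, b3⟩ := abs_lt.mp (h 2)
  simp only [Fin.succ_zero_eq_one, Fin.succ_one_eq_two,
    show (Fin.succ 2 : Fin 4) = 3 from rfl] at a1 b1 a2 b2 a3 b3
  have hD : 0 < κ 0 + κ 1 := by linarith
  -- The first light-like summand is taken as (t, -t, 0, 0); this t is the value for which the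
  -- remainder is light-like as well.
  set t := (κ 0 ^ 2 - (κ 1 ^ 2 + κ 2 ^ 2 + κ 3 ^ 2)) / (2 * (κ 0 + κ 1)) with ht
  have hteq : t * (2 * (κ 0 + κ 1)) = κ 0 ^ 2 - (κ 1 ^ 2 + κ 2 ^ 2 + κ 3 ^ 2) := by
    rw [ht]
    field_simp
  have htpos : 0 < t := by
    rw [ht]
    apply div_pos _ (by linarith)
    nlinarith
  have htlt : 0 < κ 0 - t := by
    have : 0 < (κ 0 - t) * (2 * (κ 0 + κ 1)) := by
      have e : (κ 0 - t) * (2 * (κ 0 + κ 1)) = (κ 0 + κ 1) ^ 2 + κ 2 ^ 2 + κ 3 ^ 2 := by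
        linear_combination -hteq
      rw [e]
      positivity
    exact pos_of_mul_pos_left this (by linarith)
  have n1 : ‖(!₂[t, 0, 0] : Mom)‖ = t := by
    rw [EuclideanSpace.norm_eq, Fin.sum_univ_three]
    simp [htpos.le]
  have n2 : ‖(!₂[-κ 1 - t, -κ 2, -κ 3] : Mom)‖ = κ 0 - t := by
    have e : (-κ 1 - t) ^ 2 + (-κ 2) ^ 2 + (-κ 3) ^ 2 = (κ 0 - t) ^ 2 := by
      linear_combination hteq
    rw [EuclideanSpace.norm_eq, Fin.sum_univ_three]
    simp only [Real.norm_eq_abs, sq_abs, Matrix.cons_val_zero, Matrix.cons_val_one, Matrix.cons_val]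
    rw [e, Real.sqrt_sq htlt.le]
  refine ⟨(!₂[t, 0, 0], !₂[-κ 1 - t, -κ 2, -κ 3]), ?_, ?_, ?_⟩
  · exact norm_pos_iff.mp (n1.symm ▸ htpos : 0 < ‖(!₂[t, 0, 0] : Mom)‖)
  · exact norm_pos_iff.mp (n2.symm ▸ htlt : 0 < ‖(!₂[-κ 1 - t, -κ 2, -κ 3] : Mom)‖)
  · intro μ
    simp only [onShell, n1, n2]
    fin_cases μ <;> simp

/-- The symbol of P vanishes at all sums of two non-zero light-like momenta. These fill an open set
of time-like momenta, on which a non-zero polynomial cannot vanish. -/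
theorem diffOp_d₂_injective : Function.Injective (diffOp d₂) := by
  rw [injective_iff_map_eq_zero]
  intro P h
  -- An energy above 3 and spatial components below 1 guarantee time-like momenta; the factor i is
  -- that of ∂ acting on a plane wave.
  let s : Fin 4 → Set ℂ := fun μ => (fun x : ℝ => Complex.I * (x : ℂ)) ''
    (if μ = 0 then Set.Ioo 3 4 else Set.Ioo 0 1)
  refine MvPolynomial.funext_set s (fun μ => ?_) fun x hx => ?_
  · refine Set.Infinite.image ?_ ?_
    · intro a _ b _ hab
      simpa using hab
    · split_ifs
      · exact Set.Ioo_infinite (by norm_num)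
      · exact Set.Ioo_infinite (by norm_num)
  · choose κ hκ hκx using fun μ => hx μ (Set.mem_univ μ)
    have h0 : 3 < κ 0 := by
      have := hκ 0
      simp only [if_true, Set.mem_Ioo] at this
      exact this.1
    have h1 (i : Fin 3) : |κ i.succ| < 1 := by
      have := hκ i.succ
      simp only [Fin.succ_ne_zero, if_false, Set.mem_Ioo] at this
      rw [abs_lt]
      constructor <;> linarith [this.1, this.2]
    obtain ⟨z, hp, hq, hz⟩ := exists_onShell_add κ h0 h1
    have hzero := freqEval_loopArg_eq_zero h z hp hq
    have hpi : (Real.pi : ℂ) ≠ 0 := by exact_mod_cast Real.pi_ne_zero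
    have hx' : x = fun μ => -(2 * Real.pi * Complex.I) * (loopArg z μ : ℂ) := by
      funext μ
      have : loopArg z μ = -(2 * Real.pi)⁻¹ * κ μ := by
        rw [← hz μ]
        simp [loopArg]
        ring
      rw [this, ← hκx μ]
      push_cast
      field_simp
    rw [map_zero, hx']
    exact hzero

/-- The expression `C` is determined by its value for the causal distribution. -/
theorem cochainAt_d₂_injective : Function.Injective (cochainAt d₂) :=
  Module.Flat.rTensor_preserves_injective_linearMap (M := Wick) (diffOp d₂) diffOp_d₂_injective

/-! ### Derivations and the exchange of the two points on Wick polynomials -/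

theorem wick_induction_left {p : Wick → Prop} (h1 : p 1) (hg : ∀ a B, p B → p (gen a * B))
    (hadd : ∀ A B, p A → p B → p (A + B)) (hsmul : ∀ (c : ℂ) A, p A → p (c • A)) (A : Wick) :
    p A := by
  have key : ∀ A B : Wick, p B → p (A * B) := by
    intro A
    induction A using wick_induction with
    | h0 c => intro B hB; rw [← Algebra.smul_def]; exact hsmul c B hB
    | hg a => exact hg a
    | hmul A A' hA hA' => intro B hB; rw [mul_assoc]; exact hA _ (hA' _ hB)
    | hadd A A' hA hA' => intro B hB; rw [add_mul]; exact hadd _ _ (hA _ hB) (hA' _ hB)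
  simpa using key A 1 h1

theorem wickDer_one (s : ℕ) (v : Gen → Wick) (h₁ h₂ h₃) : wickDer s v h₁ h₂ h₃ 1 = 0 := by
  simp [wickDer]

theorem wickSwap_gen (a : Gen) : wickSwap (gen a) = gen (a.1.rev, a.2) :=
  wickLift_gen _ _ _ _ a

theorem wickSwap_wickSwap (A : Wick) : wickSwap (wickSwap A) = A := by
  have : wickSwap.comp wickSwap = AlgHom.id ℂ Wick :=
    wick_hom_ext fun a => by simp [wickSwap_gen]
  exact AlgHom.congr_fun this A

theorem wickBRST_gen_mul (a : Gen) (B : Wick) :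
    wickBRST (gen a * B) = brstGen a * B + (-1 : ℂ) ^ a.parity • (gen a * wickBRST B) := by
  have := wickDer_gen_mul 1 brstGen
  simp only [one_mul] at this
  exact this _ _ _ a B

theorem wickBRST_gen (a : Gen) : wickBRST (gen a) = brstGen a := wickDer_gen _ _ _ _ _ a

theorem wickPartial_gen_mul (k : Fin 2) (μ : Fin 4) (a : Gen) (B : Wick) :
    wickPartial k μ (gen a * B) =
      (if a.1 = k then gen (a.1, ⟨a.2.field, a.2.deriv + Finsupp.single μ 1⟩) else 0) * B +
        gen a * wickPartial k μ B := by
  refine (wickDer_gen_mul 0 _ _ _ _ a B).trans ?_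
  rw [zero_mul, pow_zero, one_smul]
  rfl

theorem wickPartial_gen (k : Fin 2) (μ : Fin 4) (a : Gen) :
    wickPartial k μ (gen a) =
      if a.1 = k then gen (a.1, ⟨a.2.field, a.2.deriv + Finsupp.single μ 1⟩) else 0 :=
  wickDer_gen _ _ _ _ _ a

theorem wickSwap_brstGen (a : Gen) : wickSwap (brstGen a) = brstGen (a.1.rev, a.2) := by
  obtain ⟨k, φ, α⟩ := a
  cases φ <;> simp [brstGen, wickSwap_gen]

theorem wickSwap_wickBRST (A : Wick) : wickSwap (wickBRST A) = wickBRST (wickSwap A) := by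
  induction A using wick_induction_left with
  | h1 =>
    have h : wickBRST 1 = 0 := wickDer_one _ _ _ _ _
    rw [map_one wickSwap, h, map_zero]
  | hg a B hB =>
    rw [wickBRST_gen_mul, map_mul, wickSwap_gen, wickBRST_gen_mul, map_add, map_mul, map_smul,
      map_mul, wickSwap_brstGen, wickSwap_gen, hB]
    rfl
  | hadd A B hA hB => rw [map_add, map_add, hA, hB, map_add, map_add]
  | hsmul c A hA => rw [map_smul, map_smul, hA, map_smul, map_smul]

theorem wickSwap_wickPartial (k : Fin 2) (μ : Fin 4) (A : Wick) :
    wickSwap (wickPartial k μ A) = wickPartial k.rev μ (wickSwap A) := by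
  induction A using wick_induction_left with
  | h1 =>
    have h (k : Fin 2) : wickPartial k μ 1 = 0 := wickDer_one _ _ _ _ _
    rw [map_one wickSwap, h, h, map_zero]
  | hg a B hB =>
    rw [wickPartial_gen_mul, map_mul, wickSwap_gen, wickPartial_gen_mul, map_add, map_mul,
      map_mul, wickSwap_gen, hB]
    simp only [Fin.rev_inj]
    split_ifs <;> simp [wickSwap_gen]
  | hadd A B hA hB => rw [map_add, map_add, hA, hB, map_add, map_add]
  | hsmul c A hA => rw [map_smul, map_smul, hA, map_smul, map_smul]

/-! ### The operations on formal expressions -/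

/-- The operation `d_Q` on formal expressions. -/
def formalBRST : Cochain →ₗ[ℂ] Cochain := TensorProduct.map LinearMap.id wickBRST

/-- The partial derivative with respect to `x_k` on formal expressions. -/
def formalPartial (k : Fin 2) (μ : Fin 4) : Cochain →ₗ[ℂ] Cochain :=
  (-1 : ℂ) ^ (k : ℕ) • TensorProduct.map (LinearMap.mulLeft ℂ (MvPolynomial.X μ)) LinearMap.id +
    TensorProduct.map LinearMap.id (wickPartial k μ)

/-- The exchange of the two points on formal expressions. -/
def formalSwap : Cochain →ₗ[ℂ] Cochain :=
  TensorProduct.map negX.toLinearMap wickSwap.toLinearMap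

theorem cochain_neg_smul (c : ℂ) (C : Cochain) : (-c) • C = -(c • C) := neg_smul c C

theorem cochainAt_tmul (d : Distr) (P : DerivPoly) (W : Wick) :
    cochainAt d (P ⊗ₜ W) = diffOp d P ⊗ₜ W := rfl

theorem formalBRST_tmul (P : DerivPoly) (W : Wick) :
    formalBRST (P ⊗ₜ W) = P ⊗ₜ wickBRST W := rfl

theorem formalPartial_tmul (k : Fin 2) (μ : Fin 4) (P : DerivPoly) (W : Wick) :
    formalPartial k μ (P ⊗ₜ W) =
      (-1 : ℂ) ^ (k : ℕ) • ((MvPolynomial.X μ * P) ⊗ₜ W) + P ⊗ₜ wickPartial k μ W := rfl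

theorem formalSwap_tmul (P : DerivPoly) (W : Wick) :
    formalSwap (P ⊗ₜ W) = negX P ⊗ₜ wickSwap W := rfl

theorem opPartial_tmul (k : Fin 2) (μ : Fin 4) (d : Distr) (W : Wick) :
    opPartial k μ (d ⊗ₜ W) =
      (-1 : ℂ) ^ (k : ℕ) • (partialD μ d ⊗ₜ[ℂ] W) + d ⊗ₜ wickPartial k μ W := rfl

theorem opSwap_tmul (d : Distr) (W : Wick) :
    opSwap (d ⊗ₜ W) = reflect d ⊗ₜ wickSwap W := rfl

/-- This and the next lemma hold for an arbitrary distribution d. They are the reason why one formal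
identity serves both the commutator and the chronological product. -/
theorem cochainAt_formalBRST (d : Distr) (C : Cochain) :
    cochainAt d (formalBRST C) = opBRST (cochainAt d C) := by
  have : cochainAt d ∘ₗ formalBRST = opBRST ∘ₗ cochainAt d := TensorProduct.ext' fun _ _ => rfl
  exact LinearMap.congr_fun this C

theorem cochainAt_formalPartial (d : Distr) (k : Fin 2) (μ : Fin 4) (C : Cochain) :
    cochainAt d (formalPartial k μ C) = opPartial k μ (cochainAt d C) := by
  have : cochainAt d ∘ₗ formalPartial k μ = opPartial k μ ∘ₗ cochainAt d :=
    TensorProduct.ext' fun P W => by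
      simp only [LinearMap.comp_apply]
      rw [formalPartial_tmul, map_add, map_smul, cochainAt_tmul, cochainAt_tmul, cochainAt_tmul,
        diffOp_X_mul, opPartial_tmul]
  exact LinearMap.congr_fun this C

theorem opSwap_cochainAt (d : Distr) (C : Cochain) :
    opSwap (cochainAt d C) = cochainAt (reflect d) (formalSwap C) := by
  have : opSwap ∘ₗ cochainAt d = cochainAt (reflect d) ∘ₗ formalSwap :=
    TensorProduct.ext' fun P W => by
      simp only [LinearMap.comp_apply]
      rw [cochainAt_tmul, opSwap_tmul, reflect_diffOp, formalSwap_tmul, cochainAt_tmul]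
  exact LinearMap.congr_fun this C

theorem cochainAt_neg_left (d : Distr) (C : Cochain) : cochainAt (-d) C = -cochainAt d C := by
  induction C using TensorProduct.induction_on with
  | zero => simp
  | tmul P W =>
    have h := diffOp_smul_left (-1) d P
    have e (x : Distr) : (-1 : ℂ) • x = -x := neg_one_smul ℂ x
    rw [e, e] at h
    rw [cochainAt_tmul, cochainAt_tmul, h, TensorProduct.neg_tmul]
  | add C C' h h' => rw [map_add, map_add, h, h', neg_add]

/-- The sign comes from d₂ being odd; an even Feynman propagator produces none, which is the
difference between the two brackets in the theorem. -/
theorem opSwap_cochainAt_d₂ (C : Cochain) :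
    opSwap (cochainAt d₂ C) = -cochainAt d₂ (formalSwap C) := by
  rw [opSwap_cochainAt, reflect_d₂, cochainAt_neg_left]

theorem formalSwap_formalBRST (C : Cochain) :
    formalSwap (formalBRST C) = formalBRST (formalSwap C) := by
  have : formalSwap ∘ₗ formalBRST = formalBRST ∘ₗ formalSwap := TensorProduct.ext' fun P W => by
    simp only [LinearMap.comp_apply, formalBRST_tmul, formalSwap_tmul, wickSwap_wickBRST]
  exact LinearMap.congr_fun this C

theorem formalSwap_formalPartial (k : Fin 2) (μ : Fin 4) (C : Cochain) :
    formalSwap (formalPartial k μ C) = formalPartial k.rev μ (formalSwap C) := by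
  have : formalSwap ∘ₗ formalPartial k μ = formalPartial k.rev μ ∘ₗ formalSwap :=
    TensorProduct.ext' fun P W => by
      simp only [LinearMap.comp_apply, formalPartial_tmul, formalSwap_tmul, map_add, map_smul,
        wickSwap_wickPartial, map_mul, negX_X, neg_mul, TensorProduct.neg_tmul]
      fin_cases k <;> simp [cochain_neg_smul]
  exact LinearMap.congr_fun this C

/-! ### Relative coboundaries -/

/-- The formal relative coboundaries `d_Q b + ∑ ∂¹_μ X_μ + ∑ ∂²_μ Y_μ`. -/
def relCobound : Submodule ℂ Cochain :=
  LinearMap.range (formalBRST ∘ₗ LinearMap.fst ℂ Cochain ((Fin 4 → Cochain) × (Fin 4 → Cochain)) +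
    ((∑ μ, formalPartial 0 μ ∘ₗ LinearMap.proj μ) ∘ₗ
        LinearMap.fst ℂ (Fin 4 → Cochain) (Fin 4 → Cochain) +
      (∑ μ, formalPartial 1 μ ∘ₗ LinearMap.proj μ) ∘ₗ
        LinearMap.snd ℂ (Fin 4 → Cochain) (Fin 4 → Cochain)) ∘ₗ LinearMap.snd ℂ _ _)

theorem mem_relCobound {C : Cochain} : C ∈ relCobound ↔ ∃ (b : Cochain) (X Y : Fin 4 → Cochain),
    C = formalBRST b + ((∑ μ, formalPartial 0 μ (X μ)) + ∑ μ, formalPartial 1 μ (Y μ)) := by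
  constructor
  · rintro ⟨⟨b, X, Y⟩, rfl⟩
    exact ⟨b, X, Y, by simp⟩
  · rintro ⟨b, X, Y, rfl⟩
    exact ⟨⟨b, X, Y⟩, by simp⟩

theorem formalBRST_mem (b : Cochain) : formalBRST b ∈ relCobound :=
  mem_relCobound.mpr ⟨b, 0, 0, by simp⟩

theorem formalPartial_mem (k : Fin 2) (μ : Fin 4) (C : Cochain) :
    formalPartial k μ C ∈ relCobound := by
  have h (k : Fin 2) : ∑ ν, formalPartial k ν (Pi.single (M := fun _ => Cochain) μ C ν) =
      formalPartial k μ C := by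
    rw [Finset.sum_eq_single μ (fun ν _ hν => by rw [Pi.single_eq_of_ne hν, map_zero]) (by simp),
      Pi.single_eq_same]
  rw [mem_relCobound]
  fin_cases k
  · exact ⟨0, Pi.single μ C, 0, by simpa using (h 0).symm⟩
  · exact ⟨0, 0, Pi.single μ C, by simpa using (h 1).symm⟩

/-! ### Integration by parts in bilinear terms. -/

/-- The formal expression `P(∂) ⊗ ∂^α φ(x₁) ∂^β ψ(x₂)`. -/
def pairTerm (P : DerivPoly) (φ ψ : Jet) : Cochain := P ⊗ₜ (gen (0, φ) * gen (1, ψ))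

/-- A total derivative with respect to x₁ is a relative coboundary, and ∂/∂x₁ acts on a function of
x₁ - x₂ as ∂. Each derivative moved to the coefficient therefore costs a sign. -/
theorem pairTerm_add_deriv_left (P : DerivPoly) (φ : FieldComp) (ψ : Jet) (α : Fin 4 →₀ ℕ) :
    ∀ α₀, pairTerm P ⟨φ, α₀ + α⟩ ψ -
      (-1 : ℂ) ^ α.degree • pairTerm (MvPolynomial.monomial α 1 * P) ⟨φ, α₀⟩ ψ ∈ relCobound := by
  induction α using Finsupp.induction_linear generalizing P with
  | zero =>
    intro α₀
    have : (MvPolynomial.monomial (0 : Fin 4 →₀ ℕ) (1 : ℂ)) = 1 := rfl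
    simp [this]
  | add α β hα hβ =>
    intro α₀
    have h := add_mem (hβ P (α₀ + α))
      (relCobound.smul_mem ((-1 : ℂ) ^ β.degree) (hα (MvPolynomial.monomial β 1 * P) α₀))
    rw [smul_sub, smul_smul, ← mul_assoc (MvPolynomial.monomial α _), MvPolynomial.monomial_mul,
      one_mul, ← pow_add, add_assoc, sub_add_sub_cancel, add_comm β.degree, ← map_add] at h
    exact h
  | single μ n =>
    induction n generalizing P with
    | zero =>
      intro α₀
      have : (MvPolynomial.monomial (0 : Fin 4 →₀ ℕ) (1 : ℂ)) = 1 := rfl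
      simp [this]
    | succ n ih =>
      intro α₀
      have h1 := formalPartial_mem 0 μ (pairTerm P ⟨φ, α₀ + Finsupp.single μ n⟩ ψ)
      rw [pairTerm, formalPartial_tmul, wickPartial_gen_mul, wickPartial_gen] at h1
      simp only [Fin.val_zero, pow_zero, one_smul, if_true, one_ne_zero, if_false, mul_zero,
        add_zero] at h1
      have h2 := sub_mem h1 (ih (MvPolynomial.X μ * P) α₀)
      have e : MvPolynomial.monomial (Finsupp.single μ n) (1 : ℂ) * (MvPolynomial.X μ * P) =
          MvPolynomial.monomial (Finsupp.single μ (n + 1)) 1 * P := by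
        rw [← mul_assoc, MvPolynomial.X, MvPolynomial.monomial_mul, one_mul, Finsupp.single_add]
      rw [e] at h2
      rw [Finsupp.degree_single, pow_succ, mul_neg_one, cochain_neg_smul]
      rw [Finsupp.degree_single] at h2
      rw [Finsupp.single_add, ← add_assoc, ← Finsupp.single_add]
      simp only [pairTerm] at h2 ⊢
      convert h2 using 1
      abel

/-- At x₂ there is no sign, since ∂/∂x₂ acts on a function of x₁ - x₂ as -∂. -/
theorem pairTerm_add_deriv_right (P : DerivPoly) (φ : Jet) (ψ : FieldComp) (β : Fin 4 →₀ ℕ) :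
    ∀ β₀, pairTerm P φ ⟨ψ, β₀ + β⟩ -
      pairTerm (MvPolynomial.monomial β 1 * P) φ ⟨ψ, β₀⟩ ∈ relCobound := by
  induction β using Finsupp.induction_linear generalizing P with
  | zero =>
    intro β₀
    have : (MvPolynomial.monomial (0 : Fin 4 →₀ ℕ) (1 : ℂ)) = 1 := rfl
    simp [this]
  | add α β hα hβ =>
    intro β₀
    have h := add_mem (hβ P (β₀ + α)) (hα (MvPolynomial.monomial β 1 * P) β₀)
    rw [← mul_assoc (MvPolynomial.monomial α _), MvPolynomial.monomial_mul,
      one_mul, add_assoc, sub_add_sub_cancel] at h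
    exact h
  | single μ n =>
    induction n generalizing P with
    | zero =>
      intro β₀
      have : (MvPolynomial.monomial (0 : Fin 4 →₀ ℕ) (1 : ℂ)) = 1 := rfl
      simp [this]
    | succ n ih =>
      intro β₀
      have h1 := formalPartial_mem 1 μ (pairTerm P φ ⟨ψ, β₀ + Finsupp.single μ n⟩)
      rw [pairTerm, formalPartial_tmul, wickPartial_gen_mul, wickPartial_gen] at h1
      simp only [Fin.val_one, pow_one, if_true, zero_ne_one, if_false, zero_mul,
        zero_add, cochain_neg_smul, one_smul] at h1
      have h2 := add_mem h1 (ih (MvPolynomial.X μ * P) β₀)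
      have e : MvPolynomial.monomial (Finsupp.single μ n) (1 : ℂ) * (MvPolynomial.X μ * P) =
          MvPolynomial.monomial (Finsupp.single μ (n + 1)) 1 * P := by
        rw [← mul_assoc, MvPolynomial.X, MvPolynomial.monomial_mul, one_mul, Finsupp.single_add]
      rw [e] at h2
      rw [Finsupp.single_add, ← add_assoc, ← Finsupp.single_add]
      simp only [pairTerm] at h2 ⊢
      convert h2 using 1
      abel

/-- The derivatives of the fields in a bilinear term can be moved to the coefficient. -/
theorem pairTerm_sub_mem (P : DerivPoly) (φ ψ : Jet) :
    pairTerm P φ ψ - (-1 : ℂ) ^ φ.deriv.degree •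
      pairTerm (MvPolynomial.monomial (φ.deriv + ψ.deriv) 1 * P) ⟨φ.field, 0⟩ ⟨ψ.field, 0⟩ ∈
        relCobound := by
  have h1 := pairTerm_add_deriv_left P φ.field ψ φ.deriv 0
  have h2 := relCobound.smul_mem ((-1 : ℂ) ^ φ.deriv.degree) (pairTerm_add_deriv_right
    (MvPolynomial.monomial φ.deriv 1 * P) ⟨φ.field, 0⟩ ψ.field ψ.deriv 0)
  have h := add_mem h1 h2
  rw [smul_sub, ← mul_assoc (MvPolynomial.monomial _ _) (MvPolynomial.monomial _ _),
    MvPolynomial.monomial_mul, one_mul, zero_add, zero_add, add_comm ψ.deriv] at h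
  rwa [sub_add_sub_cancel] at h

theorem pairTerm_add (P Q : DerivPoly) (φ ψ : Jet) :
    pairTerm (P + Q) φ ψ = pairTerm P φ ψ + pairTerm Q φ ψ := TensorProduct.add_tmul _ _ _

theorem pairTerm_smul (c : ℂ) (P : DerivPoly) (φ ψ : Jet) :
    pairTerm (c • P) φ ψ = c • pairTerm P φ ψ := TensorProduct.smul_tmul' _ _ _

theorem pairTerm_sum {ι : Type*} (s : Finset ι) (P : ι → DerivPoly) (φ ψ : Jet) :
    pairTerm (∑ i ∈ s, P i) φ ψ = ∑ i ∈ s, pairTerm (P i) φ ψ := TensorProduct.sum_tmul _ _ _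

/-- By the wave equation, multiples of `∑ ε_μ ∂_μ²` are relative coboundaries. -/
theorem pairTerm_mem_of_mem_span {P : DerivPoly} (hP : P ∈ Ideal.span {boxPoly})
    (φ ψ : FieldComp) : pairTerm P ⟨φ, 0⟩ ⟨ψ, 0⟩ ∈ relCobound := by
  obtain ⟨Q, rfl⟩ := Ideal.mem_span_singleton'.mp hP
  have h := relCobound.sum_mem (t := Finset.univ) fun μ _ => relCobound.smul_mem (ε μ)
    (pairTerm_add_deriv_right Q ⟨φ, 0⟩ ψ (Finsupp.single μ 2) 0)
  simp only [smul_sub, Finset.sum_sub_distrib] at h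
  have h1 : ∑ μ, ε μ • pairTerm Q ⟨φ, 0⟩ ⟨ψ, 0 + Finsupp.single μ 2⟩ = 0 := by
    simp only [pairTerm, ← TensorProduct.tmul_smul, ← mul_smul_comm]
    rw [← TensorProduct.tmul_sum, ← Finset.mul_sum, gen_wave, mul_zero, TensorProduct.tmul_zero]
  rw [h1, zero_sub, neg_mem_iff] at h
  simp only [← pairTerm_smul, ← pairTerm_sum] at h
  convert h using 2
  rw [boxPoly, Finset.mul_sum]
  refine Finset.sum_congr rfl fun μ _ => ?_
  rw [← MvPolynomial.X_pow_eq_monomial]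
  rw [mul_smul_comm, mul_comm]

/-- The class of `P(∂) ⊗ φ(x₁) ψ(x₂)` modulo relative coboundaries. -/
def pairClass (P : DerivPoly) (φ ψ : FieldComp) : Cochain ⧸ relCobound :=
  relCobound.mkQ (pairTerm P ⟨φ, 0⟩ ⟨ψ, 0⟩)

theorem mkQ_pairTerm (P : DerivPoly) (φ ψ : Jet) :
    relCobound.mkQ (pairTerm P φ ψ) = (-1 : ℂ) ^ φ.deriv.degree •
      pairClass (MvPolynomial.monomial (φ.deriv + ψ.deriv) 1 * P) φ.field ψ.field := by
  have h := pairTerm_sub_mem P φ ψ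
  rwa [← Submodule.Quotient.mk_eq_zero, ← Submodule.mkQ_apply, map_sub, map_smul, sub_eq_zero] at h

theorem pairClass_add (P Q : DerivPoly) (φ ψ : FieldComp) :
    pairClass (P + Q) φ ψ = pairClass P φ ψ + pairClass Q φ ψ := by
  rw [pairClass, pairTerm_add, map_add]
  rfl

theorem pairClass_smul (c : ℂ) (P : DerivPoly) (φ ψ : FieldComp) :
    pairClass (c • P) φ ψ = c • pairClass P φ ψ := by
  rw [pairClass, pairTerm_smul, map_smul]
  rfl

theorem pairClass_eq_zero {P : DerivPoly} (hP : P ∈ Ideal.span {boxPoly}) (φ ψ : FieldComp) :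
    pairClass P φ ψ = 0 :=
  (Submodule.Quotient.mk_eq_zero _).mpr (pairTerm_mem_of_mem_span hP φ ψ)

theorem sum_smul_pairClass_box (P : DerivPoly) (φ ψ : FieldComp) :
    ∑ ρ, ε ρ • pairClass (MvPolynomial.X ρ * (MvPolynomial.X ρ * P)) φ ψ = 0 := by
  have h : boxPoly * P ∈ Ideal.span {boxPoly} :=
    Ideal.mul_mem_right _ _ (Ideal.mem_span_singleton_self _)
  rw [← pairClass_eq_zero h φ ψ, boxPoly, Finset.sum_mul, Fin.sum_univ_four, Fin.sum_univ_four,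
    pairClass_add, pairClass_add, pairClass_add]
  simp only [smul_mul_assoc, pairClass_smul, pow_two, mul_assoc]

-- The term with the antighost at x₁ and the graviton at x₂ is chosen because d_Q of the antighost
-- is a divergence of h. The remaining terms are written with a repeated variable in front, or with
-- a trace, so that contraction of the indices will exhibit the wave operator. The relative sign is
-- due to d_Q being odd and passing the antighost.
open MvPolynomial in
theorem mkQ_formalBRST_pairTerm_ut_h (μ ρ σ : Fin 4) :
    relCobound.mkQ (formalBRST (pairTerm (X μ * X ρ * X σ) ⟨.ut μ, 0⟩ ⟨.h ρ σ, 0⟩)) =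
    (-Complex.I) • (∑ ν, ε ν • pairClass (X μ * X ν * X ρ * X σ) (.h μ ν) (.h ρ σ)) +
      (Complex.I / 2) • (pairClass (X ρ * (X ρ * (X μ * X σ))) (.ut μ) (.u σ) +
        pairClass (X σ * (X σ * (X μ * X ρ))) (.ut μ) (.u ρ) -
        η ρ σ • ∑ τ, ε τ • pairClass (X τ * (X μ * X ρ * X σ)) (.ut μ) (.u τ)) := by
  have e : formalBRST (pairTerm (X μ * X ρ * X σ) ⟨.ut μ, 0⟩ ⟨.h ρ σ, 0⟩) =
      Complex.I • (∑ ν, ε ν •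
        pairTerm (X μ * X ρ * X σ) ⟨.h μ ν, Finsupp.single ν 1⟩ ⟨.h ρ σ, 0⟩) +
      (Complex.I / 2) • (pairTerm (X μ * X ρ * X σ) ⟨.ut μ, 0⟩ ⟨.u σ, Finsupp.single ρ 1⟩ +
        pairTerm (X μ * X ρ * X σ) ⟨.ut μ, 0⟩ ⟨.u ρ, Finsupp.single σ 1⟩ -
        η ρ σ • ∑ τ, ε τ •
          pairTerm (X μ * X ρ * X σ) ⟨.ut μ, 0⟩ ⟨.u τ, Finsupp.single τ 1⟩) := by
    rw [pairTerm, formalBRST_tmul, wickBRST_gen_mul, wickBRST_gen]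
    simp only [brstGen, Gen.parity, FieldComp.parity, pow_one, zero_add, pairTerm,
      ← TensorProduct.tmul_smul, ← TensorProduct.tmul_sum, ← TensorProduct.tmul_add,
      ← TensorProduct.tmul_sub]
    congr 1
    simp only [smul_mul_assoc, mul_smul_comm, Finset.sum_mul, mul_add, mul_sub, Finset.mul_sum,
      smul_smul, neg_mul_neg, one_mul]
  rw [e]
  simp only [map_add, map_sub, map_smul, map_sum, mkQ_pairTerm, Finsupp.degree_single, map_zero,
    pow_zero, pow_one, one_smul, add_zero, zero_add]
  refine congrArg₂ (· + ·) ?_ ?_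
  · rw [neg_smul, ← smul_neg, ← Finset.sum_neg_distrib]
    refine congrArg _ (Finset.sum_congr rfl fun ν _ => ?_)
    rw [neg_smul, one_smul, smul_neg]
    refine congrArg (fun P => -(ε ν • pairClass P (.h μ ν) (.h ρ σ))) ?_
    change X ν * _ = _
    ring
  · refine congrArg _ (congrArg₂ (· - ·) (congrArg₂ (· + ·) ?_ ?_) rfl)
    · refine congrArg (fun P => pairClass P (.ut μ) (.u σ)) ?_
      change X ρ * _ = _
      ring
    · refine congrArg (fun P => pairClass P (.ut μ) (.u ρ)) ?_
      change X σ * _ = _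
      ring

-- The derivative from d_Q h_{ρσ} meets the derivative in the coefficient that carries the same
-- index; their contraction is the wave operator.
open MvPolynomial in
theorem sum_pairClass_box_left (μ σ : Fin 4) : ∑ ρ, (ε μ * ε ρ * ε σ) •
    pairClass (X ρ * (X ρ * (X μ * X σ))) (.ut μ) (.u σ) = 0 := by
  rw [← smul_zero (ε μ * ε σ), ← sum_smul_pairClass_box (X μ * X σ) (.ut μ) (.u σ),
    Finset.smul_sum]
  exact Finset.sum_congr rfl fun ρ _ => by rw [smul_smul]; ring_nf

-- The trace part of d_Q h_{ρσ} contracts the two derivatives ∂^ρ and ∂^σ of the coefficient with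
-- each other, which again gives the wave operator.
open MvPolynomial in
theorem sum_pairClass_box_trace (μ : Fin 4) : ∑ ρ, ∑ σ, (ε μ * ε ρ * ε σ) • η ρ σ •
    ∑ τ, ε τ • pairClass (X τ * (X μ * X ρ * X σ)) (.ut μ) (.u τ) = 0 := by
  have (ρ : Fin 4) : ∑ σ, (ε μ * ε ρ * ε σ) • η ρ σ •
      ∑ τ, ε τ • pairClass (X τ * (X μ * X ρ * X σ)) (.ut μ) (.u τ) =
      ∑ τ, (ε μ * ε τ) • ε ρ • pairClass (X ρ * (X ρ * (X μ * X τ))) (.ut μ) (.u τ) := by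
    rw [Finset.sum_eq_single ρ (fun σ _ hσ => by simp [η, Ne.symm hσ]) (by simp), Finset.smul_sum,
      Finset.smul_sum]
    refine Finset.sum_congr rfl fun τ _ => ?_
    have hε : ε ρ * ε ρ = 1 := by unfold ε; split_ifs <;> norm_num
    rw [smul_smul, smul_smul, smul_smul, η, if_pos rfl]
    congr 1
    · linear_combination ε μ * ε ρ * ε τ * hε
    · congr 1
      ring
  simp only [this]
  rw [Finset.sum_comm]
  simp only [← Finset.smul_sum, sum_smul_pairClass_box, smul_zero, Finset.sum_const_zero]

open MvPolynomial in
/-- The double divergence of the graviton fields at both points is a relative coboundary. -/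
theorem sum_pairClass_h_h_eq_zero :
    ∑ μ, ∑ ν, ∑ ρ, ∑ σ, (ε μ * ε ν * ε ρ * ε σ) •
      pairClass (X μ * X ν * X ρ * X σ) (.h μ ν) (.h ρ σ) = 0 := by
  -- The preimage under d_Q is the divergence of the antighost at x₁ times the double divergence of
  -- h at x₂, with all derivatives in the coefficient.
  have h0 : relCobound.mkQ (formalBRST (∑ μ, ∑ ρ, ∑ σ, (ε μ * ε ρ * ε σ) •
      pairTerm (X μ * X ρ * X σ) ⟨.ut μ, 0⟩ ⟨.h ρ σ, 0⟩)) = 0 :=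
    (Submodule.Quotient.mk_eq_zero _).mpr (formalBRST_mem _)
  simp only [map_sum, map_smul, mkQ_formalBRST_pairTerm_ut_h] at h0
  simp only [smul_add, smul_sub, Finset.sum_add_distrib, Finset.sum_sub_distrib,
    smul_comm _ (Complex.I / 2), smul_comm _ (-Complex.I)] at h0
  simp only [← Finset.smul_sum] at h0
  have z3 (μ : Fin 4) : ∑ ρ, ∑ σ, (ε μ * ε ρ * ε σ) •
      pairClass (X ρ * (X ρ * (X μ * X σ))) (.ut μ) (.u σ) = 0 := by
    rw [Finset.sum_comm]
    simp only [sum_pairClass_box_left, Finset.sum_const_zero]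
  have z4 (μ : Fin 4) : ∑ ρ, ∑ σ, (ε μ * ε ρ * ε σ) •
      pairClass (X σ * (X σ * (X μ * X ρ))) (.ut μ) (.u ρ) = 0 := by
    rw [← Finset.sum_const_zero]
    refine Finset.sum_congr rfl fun ρ _ => ?_
    rw [← sum_pairClass_box_left μ ρ]
    exact Finset.sum_congr rfl fun σ _ => by rw [mul_right_comm]
  simp only [sum_pairClass_box_trace, z3, z4, Finset.sum_const_zero, smul_zero,
    sub_zero, add_zero] at h0
  rw [smul_eq_zero_iff_right (neg_ne_zero.mpr Complex.I_ne_zero)] at h0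
  rw [← h0]
  refine Finset.sum_congr rfl fun μ _ => ?_
  rw [Finset.sum_comm]
  refine Finset.sum_congr rfl fun ρ _ => ?_
  rw [Finset.sum_comm]
  refine Finset.sum_congr rfl fun σ _ => ?_
  rw [Finset.smul_sum]
  exact Finset.sum_congr rfl fun ν _ => by rw [smul_smul]; ring_nf

/-! ### The one-loop commutator as an expression in the causal distribution -/

/-- The polynomial `P` with `∂^{γ₁}D₀⁽⁺⁾ ∂^{γ₂}D₀⁽⁺⁾ = P(∂) (D₀⁽⁺⁾)²`. -/
def loopPoly (γ₁ γ₂ : Fin 4 →₀ ℕ) : DerivPoly := (exists_prodDplus_eq_diffOp γ₁ γ₂).choose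

theorem isHomogeneous_loopPoly (γ₁ γ₂ : Fin 4 →₀ ℕ) :
    (loopPoly γ₁ γ₂).IsHomogeneous (γ₁.degree + γ₂.degree) :=
  (exists_prodDplus_eq_diffOp γ₁ γ₂).choose_spec.1

theorem prodDplus_eq_diffOp (γ₁ γ₂ : Fin 4 →₀ ℕ) :
    prodDplus γ₁ γ₂ = diffOp (prodDplus 0 0) (loopPoly γ₁ γ₂) :=
  (exists_prodDplus_eq_diffOp γ₁ γ₂).choose_spec.2.1

theorem loopPoly_sub_mem (γ₁ γ₂ : Fin 4 →₀ ℕ) :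
    loopPoly γ₁ γ₂ - loopMoment γ₁.degree γ₂.degree 0 • MvPolynomial.monomial (γ₁ + γ₂) 1 ∈
      Ideal.span {boxPoly} :=
  (exists_prodDplus_eq_diffOp γ₁ γ₂).choose_spec.2.2

theorem negX_of_isHomogeneous {P : DerivPoly} {n : ℕ} (hP : P.IsHomogeneous n) :
    negX P = (-1 : ℂ) ^ n • P := by
  rw [MvPolynomial.as_sum P, map_sum, Finset.smul_sum]
  refine Finset.sum_congr rfl fun α hα => ?_
  have hd : α.degree = n := hP.degree_eq_sum_deg_support hα |>.symm
  have h : (α.prod fun μ k => (-MvPolynomial.X μ : DerivPoly) ^ k) =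
      (-1) ^ α.degree * α.prod fun μ k => MvPolynomial.X μ ^ k := by
    simp only [Finsupp.prod, neg_pow (MvPolynomial.X _ : DerivPoly), Finset.prod_mul_distrib,
      Finset.prod_pow_eq_pow_sum]
    rfl
  rw [← hd, negX, MvPolynomial.aeval_monomial, MvPolynomial.algebraMap_eq, h,
    MvPolynomial.monomial_eq, MvPolynomial.smul_eq_C_mul, mul_left_comm, map_pow, map_neg,
    MvPolynomial.C_1]

theorem twoPoint_swap (φ ψ : FieldComp) :
    twoPoint ψ φ = (-1) ^ (φ.parity * ψ.parity) * twoPoint φ ψ := by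
  have hη (μ ν : Fin 4) : η μ ν = η ν μ := by
    unfold η
    by_cases h : μ = ν
    · subst h; rfl
    · simp [h, Ne.symm h]
  cases φ <;> cases ψ <;> simp [twoPoint, FieldComp.parity]
  · rename_i μ ν ρ σ
    rw [hη ρ μ, hη σ ν, hη σ μ, hη ρ ν]
    ring
  · rw [hη]
  · rw [hη]

theorem parity_eq_of_twoPoint_ne_zero {φ ψ : FieldComp} (h : twoPoint φ ψ ≠ 0) :
    φ.parity = ψ.parity := by
  cases φ <;> cases ψ <;> simp [twoPoint, FieldComp.parity] at h ⊢

theorem wordParity_eq (w : Word) (i : Fin w.length) :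
    wordParity w = wordParity (w.take i) + (w.get i).field.parity + wordParity (w.drop (i + 1)) := by
  conv_lhs => rw [← List.take_append_drop i w, List.drop_eq_getElem_cons i.isLt]
  simp only [wordParity, List.map_append, List.map_cons, List.sum_append, List.sum_cons, add_assoc]
  rfl

theorem wordParity_eraseIdx (w : Word) (i : Fin w.length) :
    wordParity (w.eraseIdx i) = wordParity (w.take i) + wordParity (w.drop (i + 1)) := by
  rw [List.eraseIdx_eq_take_drop_succ]
  simp [wordParity]

theorem neg_one_pow_congr {m n : ℕ} (h : Even (m + n)) : (-1 : ℂ) ^ m = (-1) ^ n := by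
  rcases Nat.even_add.mp h with h
  by_cases hm : Even m
  · rw [hm.neg_one_pow, (h.mp hm).neg_one_pow]
  · rw [(Nat.not_even_iff_odd.mp hm).neg_one_pow,
      (Nat.not_even_iff_odd.mp (fun hn => hm (h.mpr hn))).neg_one_pow]

/-- The number of derivatives enters because reversing a two-point function reflects its argument. A
non-zero contraction joins fields of equal parity, so the Fermi signs depend only on the parities of
the words before and after removal of the pair, and they telescope over successive contractions. -/
theorem contractionFactor_swap (a b : Word) (i : Fin a.length) (j : Fin b.length) :
    contractionFactor b a j i =
      (-1) ^ (((a.get i).deriv + (b.get j).deriv).degree + wordParity a * wordParity b +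
        wordParity (a.eraseIdx i) * wordParity (b.eraseIdx j)) * contractionFactor a b i j := by
  have hdeg (α : Fin 4 →₀ ℕ) : ∑ μ, α μ = α.degree := (Finsupp.degree_eq_sum α).symm
  rw [contractionFactor, contractionFactor, twoPoint_swap, hdeg, hdeg, wordParity_eraseIdx,
    wordParity_eraseIdx, wordParity_eq a i, wordParity_eq b j, map_add]
  by_cases h : twoPoint (a.get i).field (b.get j).field = 0
  · rw [h]
    simp only [mul_zero]
  · have hp := parity_eq_of_twoPoint_ne_zero h
    rw [← hp]
    generalize wordParity (a.take i) = p
    generalize wordParity (a.drop (i + 1)) = q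
    generalize wordParity (b.take j) = r
    generalize wordParity (b.drop (j + 1)) = s
    generalize (a.get i).deriv.degree = m
    generalize (b.get j).deriv.degree = n
    have hpar : (a.get i).field.parity = 0 ∨ (a.get i).field.parity = 1 := by
      cases (a.get i).field <;> simp [FieldComp.parity]
    simp only [← mul_assoc, ← pow_add]
    congr 1
    apply neg_one_pow_congr
    rcases hpar with h0 | h0 <;> rw [h0]
    · exact ⟨m + n + (p + q) * (r + s), by ring⟩
    · exact ⟨m + n + (p + q) * (r + s) + p + q + r + s + 1, by ring⟩

/-- The expression of which the one-loop part of the commutator is the value at `d₂`. -/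
def loopCochain (a b : Word) : Cochain :=
  ∑ i : Fin a.length, ∑ j : Fin b.length,
    ∑ k : Fin (a.eraseIdx i).length, ∑ l : Fin (b.eraseIdx j).length,
      (contractionFactor a b i j * contractionFactor (a.eraseIdx i) (b.eraseIdx j) k l) •
        (loopPoly ((a.get i).deriv + (b.get j).deriv)
            (((a.eraseIdx i).get k).deriv + ((b.eraseIdx j).get l).deriv) ⊗ₜ[ℂ]
          (wordAt 0 ((a.eraseIdx i).eraseIdx k) * wordAt 1 ((b.eraseIdx j).eraseIdx l)))

theorem gen_mul_wordAt (c : Gen) (k : Fin 2) (w : Word) :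
    gen c * wordAt k w = (-1 : ℂ) ^ (c.parity * wordParity w) • (wordAt k w * gen c) := by
  induction w with
  | nil => simp [wordAt, wordParity]
  | cons j w ih =>
    have e : wordAt k (j :: w) = gen (k, j) * wordAt k w := by simp [wordAt]
    have e' : wordParity (j :: w) = Gen.parity (k, j) + wordParity w := by
      simp [wordParity, Gen.parity]
    rw [e, e', ← mul_assoc, gen_comm c, smul_mul_assoc, mul_assoc, ih, mul_smul_comm, smul_smul,
      ← pow_add, mul_add, mul_assoc]

theorem wordAt_mul_wordAt (k l : Fin 2) (v w : Word) :
    wordAt k v * wordAt l w =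
      (-1 : ℂ) ^ (wordParity v * wordParity w) • (wordAt l w * wordAt k v) := by
  induction v with
  | nil => simp [wordAt, wordParity]
  | cons j v ih =>
    have e : wordAt k (j :: v) = gen (k, j) * wordAt k v := by simp [wordAt]
    have e' : wordParity (j :: v) = Gen.parity (k, j) + wordParity v := by
      simp [wordParity, Gen.parity]
    rw [e, e', mul_assoc, ih, mul_smul_comm, ← mul_assoc, gen_mul_wordAt, smul_mul_assoc,
      smul_smul, ← pow_add, mul_assoc, add_mul, add_comm]

theorem wickSwap_wordAt (k : Fin 2) (w : Word) : wickSwap (wordAt k w) = wordAt k.rev w := by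
  induction w with
  | nil => simp [wordAt]
  | cons j w ih =>
    have e (k : Fin 2) : wordAt k (j :: w) = gen (k, j) * wordAt k w := by simp [wordAt]
    rw [e, e, map_mul, ih, wickSwap_gen]

/-- Each term of the product in reversed order is the corresponding term of the original product
with D₀⁽⁺⁾(x) replaced by D₀⁽⁺⁾(-x). The signs of the contractions, of reordering the remaining
fields and of the reflected derivatives cancel. -/
theorem smul_opSwap_loopTerm (a b : Word) (i : Fin a.length) (j : Fin b.length)
    (k : Fin (a.eraseIdx i).length) (l : Fin (b.eraseIdx j).length) :
    (-1 : ℂ) ^ (wordParity a * wordParity b) • opSwap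
      ((contractionFactor b a j i * contractionFactor (b.eraseIdx j) (a.eraseIdx i) l k) •
        (prodDplus ((b.get j).deriv + (a.get i).deriv)
            (((b.eraseIdx j).get l).deriv + ((a.eraseIdx i).get k).deriv) ⊗ₜ[ℂ]
          (wordAt 0 ((b.eraseIdx j).eraseIdx l) * wordAt 1 ((a.eraseIdx i).eraseIdx k)))) =
      (contractionFactor a b i j * contractionFactor (a.eraseIdx i) (b.eraseIdx j) k l) •
        (diffOp (reflect (prodDplus 0 0)) (loopPoly ((a.get i).deriv + (b.get j).deriv)
            (((a.eraseIdx i).get k).deriv + ((b.eraseIdx j).get l).deriv)) ⊗ₜ[ℂ]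
          (wordAt 0 ((a.eraseIdx i).eraseIdx k) * wordAt 1 ((b.eraseIdx j).eraseIdx l))) := by
  rw [map_smul, opSwap_tmul, map_mul, wickSwap_wordAt, wickSwap_wordAt, prodDplus_eq_diffOp,
    reflect_diffOp, negX_of_isHomogeneous (isHomogeneous_loopPoly _ _), map_smul,
    contractionFactor_swap a b i j,
    contractionFactor_swap (a.eraseIdx i) (b.eraseIdx j) k l,
    add_comm (b.get j).deriv, add_comm ((b.eraseIdx j).get l).deriv]
  have e := wordAt_mul_wordAt 1 0 ((b.eraseIdx j).eraseIdx l) ((a.eraseIdx i).eraseIdx k)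
  rw [show (Fin.rev 0 : Fin 2) = 1 from rfl, show (Fin.rev 1 : Fin 2) = 0 from rfl, e,
    TensorProduct.tmul_smul, ← TensorProduct.smul_tmul', smul_smul, smul_smul, smul_smul]
  congr 1
  generalize contractionFactor a b i j = x
  generalize contractionFactor (a.eraseIdx i) (b.eraseIdx j) k l = y
  generalize wordParity a * wordParity b = A
  generalize wordParity (a.eraseIdx i) * wordParity (b.eraseIdx j) = B
  rw [mul_comm (wordParity ((b.eraseIdx j).eraseIdx l))]
  generalize wordParity ((a.eraseIdx i).eraseIdx k) * wordParity ((b.eraseIdx j).eraseIdx l) = C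
  generalize ((a.get i).deriv + (b.get j).deriv).degree = m
  generalize (((a.eraseIdx i).get k).deriv + ((b.eraseIdx j).get l).deriv).degree = n
  -- Every summand of the exponent occurs twice.
  have h : (-1 : ℂ) ^ (A + (m + A + B) + (n + B + C) + C + (m + n)) = 1 :=
    Even.neg_one_pow ⟨A + m + B + n + C, by ring⟩
  calc _ = (-1 : ℂ) ^ (A + (m + A + B) + (n + B + C) + C + (m + n)) * (x * y) := by
        simp only [pow_add]
        ring
    _ = _ := by rw [h, one_mul]

/-- The factor 1/2 compensating the ordering of the two contractions is absorbed in the 1/2 of d₂.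
-/
theorem oneLoopProduct_sub (a b : Word) :
    oneLoopProduct a b - (-1 : ℂ) ^ (wordParity a * wordParity b) • opSwap (oneLoopProduct b a) =
      cochainAt d₂ (loopCochain a b) := by
  have h1 : (-1 : ℂ) ^ (wordParity a * wordParity b) • opSwap (oneLoopProduct b a) =
      (1 / 2 : ℂ) • ∑ i : Fin a.length, ∑ j : Fin b.length,
        ∑ k : Fin (a.eraseIdx i).length, ∑ l : Fin (b.eraseIdx j).length,
        (contractionFactor a b i j * contractionFactor (a.eraseIdx i) (b.eraseIdx j) k l) •
          (diffOp (reflect (prodDplus 0 0)) (loopPoly ((a.get i).deriv + (b.get j).deriv)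
            (((a.eraseIdx i).get k).deriv + ((b.eraseIdx j).get l).deriv)) ⊗ₜ[ℂ]
          (wordAt 0 ((a.eraseIdx i).eraseIdx k) * wordAt 1 ((b.eraseIdx j).eraseIdx l))) := by
    rw [oneLoopProduct, map_smul, smul_comm, map_sum]
    congr 1
    simp only [map_sum, Finset.smul_sum]
    rw [Finset.sum_comm]
    refine Finset.sum_congr rfl fun i _ => Finset.sum_congr rfl fun j _ => ?_
    rw [Finset.sum_comm]
    exact Finset.sum_congr rfl fun k _ => Finset.sum_congr rfl fun l _ =>
      smul_opSwap_loopTerm a b i j k l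
  rw [h1, oneLoopProduct, ← smul_sub]
  simp only [← Finset.sum_sub_distrib, ← smul_sub, loopCochain, map_sum, map_smul, Finset.smul_sum]
  refine Finset.sum_congr rfl fun i _ => Finset.sum_congr rfl fun j _ =>
    Finset.sum_congr rfl fun k _ => Finset.sum_congr rfl fun l _ => ?_
  rw [smul_comm, cochainAt_tmul, d₂, diffOp_smul_left, diffOp_sub_left, ← prodDplus_eq_diffOp,
    ← TensorProduct.sub_tmul, TensorProduct.smul_tmul']

/-- The bilinear extension of `loopCochain`. -/
def loopCochainL : (Word →₀ ℂ) →ₗ[ℂ] (Word →₀ ℂ) →ₗ[ℂ] Cochain :=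
  Finsupp.linearCombination ℂ fun a => Finsupp.linearCombination ℂ fun b => loopCochain a b

theorem oneLoopCommutator_eq (A B : Word →₀ ℂ) :
    oneLoopCommutator A B = cochainAt d₂ (loopCochainL A B) := by
  have : oneLoopCommutator = loopCochainL.compr₂ (cochainAt d₂) := by
    refine Finsupp.lhom_ext' fun a => LinearMap.ext_ring ?_
    refine Finsupp.lhom_ext' fun b => LinearMap.ext_ring ?_
    simp [oneLoopCommutator, loopCochainL, oneLoopProduct_sub]
  rw [this]
  rfl

/-! ### Null frames -/

/-- The pairing of the labels of a null frame. -/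
def nullDual : Fin 4 → Fin 4 := ![1, 0, 3, 2]

/-- A complex frame of Minkowski space in which the metric pairs the vectors `0, 1` and the
vectors `2, 3`. -/
structure NullFrame where
  vec : Fin 4 → Fin 4 → ℂ
  orth : ∀ a b, ∑ μ, ε μ * vec a μ * vec b μ = if b = nullDual a then 1 else 0

/-- The lower components of the first vector of a null frame. -/
def NullFrame.mom (F : NullFrame) (μ : Fin 4) : ℂ := ε μ * F.vec 0 μ

theorem ε_mul_ε (μ : Fin 4) : ε μ * ε μ = 1 := by
  unfold ε
  split_ifs <;> norm_num

/-- The Gram matrix is the permutation matrix of an involution, hence its own inverse. The frame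
matrix is thereby invertible, and orthonormality turns into completeness. -/
theorem NullFrame.complete (F : NullFrame) (μ ν : Fin 4) :
    ∑ a, F.vec a μ * F.vec (nullDual a) ν = η μ ν := by
  let A : Matrix (Fin 4) (Fin 4) ℂ := Matrix.of F.vec
  let S : Matrix (Fin 4) (Fin 4) ℂ := Matrix.of fun a b => if b = nullDual a then 1 else 0
  have h1 : A * Matrix.diagonal ε * A.transpose = S := by
    ext a b
    rw [Matrix.mul_apply]
    simp only [Matrix.mul_diagonal, Matrix.transpose_apply]
    rw [show S a b = _ from (F.orth a b).symm]
    exact Finset.sum_congr rfl fun μ _ => by rw [mul_comm (ε μ)]; rfl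
  have h2 : S * S = 1 := by
    ext a b
    rw [Matrix.mul_apply]
    fin_cases a <;> fin_cases b <;> simp [S, nullDual, Fin.sum_univ_four]
  have h3 : A * (Matrix.diagonal ε * A.transpose * S) = 1 := by
    rw [← mul_assoc, ← mul_assoc, h1, h2]
  have h4 := congrArg (fun M => Matrix.diagonal ε * M) (mul_eq_one_comm.mp h3)
  have h5 : Matrix.diagonal ε * Matrix.diagonal ε = (1 : Matrix (Fin 4) (Fin 4) ℂ) := by
    rw [Matrix.diagonal_mul_diagonal]
    simp only [ε_mul_ε, Matrix.diagonal_one]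
  simp only [← mul_assoc, h5, one_mul, mul_one] at h4
  have h6 := congrFun (congrFun h4 μ) ν
  rw [mul_assoc, Matrix.mul_apply] at h6
  have h7 : Matrix.diagonal ε μ ν = η μ ν := by
    rw [Matrix.diagonal_apply, η]
  rw [h7] at h6
  rw [← h6]
  refine Finset.sum_congr rfl fun a _ => ?_
  rw [Matrix.mul_apply, Finset.sum_eq_single (nullDual a)]
  · simp [A, S]
  · intro b _ hb
    simp [S, hb]
  · simp

theorem NullFrame.sum_mom_sq (F : NullFrame) : ∑ μ, ε μ * (F.mom μ * F.mom μ) = 0 := by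
  have h := F.orth 0 0
  simp only [nullDual, Matrix.cons_val_zero, zero_ne_one, if_false] at h
  rw [← h]
  refine Finset.sum_congr rfl fun μ _ => ?_
  rw [NullFrame.mom]
  linear_combination (ε μ * F.vec 0 μ * F.vec 0 μ) * ε_mul_ε μ

/-- The frame is complex because real transverse directions contain no null vectors. It is explicit:
k, a multiple of (1, 0, 0, -1) dual to it, and two transverse null vectors. The products reduce by
bc = k₁² + k₂² = (k₀ - k₃)(k₀ + k₃), and k₀ - k₃ is the only denominator. -/
theorem exists_nullFrame (k : Fin 4 → ℂ) (hk : k 0 ^ 2 = k 1 ^ 2 + k 2 ^ 2 + k 3 ^ 2)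
    (hk0 : k 0 - k 3 ≠ 0) : ∃ F : NullFrame, F.mom = k := by
  let b : ℂ := -k 1 + Complex.I * k 2
  let c : ℂ := -k 1 - Complex.I * k 2
  let f : Fin 4 → Fin 4 → ℂ := ![![k 0, -k 1, -k 2, -k 3],
    ![1 / (k 0 - k 3), 0, 0, -1 / (k 0 - k 3)],
    ![c / (2 * (k 0 - k 3)), 1 / 2, Complex.I / 2, -c / (2 * (k 0 - k 3))],
    ![-b / (k 0 - k 3), -1, Complex.I, b / (k 0 - k 3)]]
  have hI := Complex.I_sq
  refine ⟨⟨f, fun a b' => ?_⟩, ?_⟩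
  · fin_cases a <;> fin_cases b' <;>
      simp [Fin.sum_univ_four, ε, f, nullDual, b, c] <;> field_simp
    all_goals first
      | ring1
      | linear_combination hk
      | linear_combination (-(k 0 - k 3) ^ 2) * hI
  · funext μ
    fin_cases μ <;> simp [NullFrame.mom, f, ε]

/-! ### Polynomials vanishing on the null cone -/

/-- Modulo the wave operator the square of the time variable is the sum of the squares of the
spatial ones, so degree at most one in the time variable suffices. -/
theorem exists_normalForm (P : DerivPoly) : ∃ A B : MvPolynomial (Fin 3) ℂ,
    P - (MvPolynomial.rename Fin.succ A + MvPolynomial.X 0 * MvPolynomial.rename Fin.succ B) ∈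
      Ideal.span {boxPoly} := by
  induction P using MvPolynomial.induction_on with
  | C a => exact ⟨MvPolynomial.C a, 0, by simp⟩
  | add P Q hP hQ =>
    obtain ⟨A, B, h⟩ := hP
    obtain ⟨A', B', h'⟩ := hQ
    refine ⟨A + A', B + B', ?_⟩
    convert add_mem h h' using 1
    simp only [map_add]
    ring
  | mul_X P μ hP =>
    obtain ⟨A, B, h⟩ := hP
    have h1 := Ideal.mul_mem_right (MvPolynomial.X μ) _ h
    rcases Fin.eq_zero_or_eq_succ μ with rfl | ⟨i, rfl⟩
    · refine ⟨(∑ i, MvPolynomial.X i ^ 2) * B, A, ?_⟩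
      have h2 : boxPoly * MvPolynomial.rename Fin.succ B ∈ Ideal.span {boxPoly} :=
        Ideal.mul_mem_right _ _ (Ideal.mem_span_singleton_self _)
      convert add_mem h1 h2 using 1
      have e : boxPoly = MvPolynomial.X 0 ^ 2 -
          ∑ i : Fin 3, (MvPolynomial.X i.succ ^ 2 : DerivPoly) := by
        rw [boxPoly, Fin.sum_univ_succ]
        simp [ε, Fin.succ_ne_zero, sub_eq_add_neg]
      rw [e, map_mul, map_sum]
      simp only [map_pow, MvPolynomial.rename_X]
      ring
    · refine ⟨A * MvPolynomial.X i, B * MvPolynomial.X i, ?_⟩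
      convert h1 using 1
      simp only [map_mul, MvPolynomial.rename_X]
      ring

/-- A polynomial that vanishes at the momenta of all null frames is a multiple of the wave
operator. -/
theorem mem_span_boxPoly {P : DerivPoly} (hP : ∀ F : NullFrame, MvPolynomial.eval F.mom P = 0) :
    P ∈ Ideal.span {boxPoly} := by
  obtain ⟨A, B, h⟩ := exists_normalForm P
  obtain ⟨Q, hQ⟩ := Ideal.mem_span_singleton'.mp h
  have key (x : Fin 3 → ℝ) (hx : ∀ i, 0 < x i) :
      MvPolynomial.eval (fun i => (x i : ℂ)) A = 0 ∧
        MvPolynomial.eval (fun i => (x i : ℂ)) B = 0 := by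
    set r := Real.sqrt (x 0 ^ 2 + x 1 ^ 2 + x 2 ^ 2) with hr
    have h0 := hx 0
    have h1 := hx 1
    have h2 := hx 2
    have hr2 : r ^ 2 = x 0 ^ 2 + x 1 ^ 2 + x 2 ^ 2 := Real.sq_sqrt (by positivity)
    have hrx : x 2 < r := by
      apply Real.lt_sqrt_of_sq_lt
      have := pow_pos h0 2
      have := pow_pos h1 2
      linarith
    -- Both sheets s = r and s = -r of the cone over x are used: A + rB = 0 and A - rB = 0 give A =
    -- B = 0. Positivity of the coordinates ensures s ≠ x₂ on both sheets, so that null frames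
    -- exist.
    have hval (s : ℝ) (hs : s ^ 2 = r ^ 2) (hs' : s - x 2 ≠ 0) :
        MvPolynomial.eval (fun i => (x i : ℂ)) A +
          s * MvPolynomial.eval (fun i => (x i : ℂ)) B = 0 := by
      have hnull : (s : ℂ) ^ 2 = (x 0 : ℂ) ^ 2 + (x 1 : ℂ) ^ 2 + (x 2 : ℂ) ^ 2 := by
        exact_mod_cast hs.trans hr2
      let k : Fin 4 → ℂ := Fin.cons (s : ℂ) fun i => (x i : ℂ)
      obtain ⟨F, hF⟩ := exists_nullFrame k hnull (by
        change (s : ℂ) - (x 2 : ℂ) ≠ 0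
        exact_mod_cast hs')
      have hPF := hP F
      have hbox : MvPolynomial.eval k boxPoly = 0 := by
        have h3 : MvPolynomial.eval k boxPoly =
            (s : ℂ) ^ 2 - ((x 0 : ℂ) ^ 2 + (x 1 : ℂ) ^ 2 + (x 2 : ℂ) ^ 2) := by
          rw [boxPoly, Fin.sum_univ_four]
          simp only [map_add, MvPolynomial.smul_eval, map_pow, MvPolynomial.eval_X]
          change ε 0 * (s : ℂ) ^ 2 + ε 1 * (x 0 : ℂ) ^ 2 + ε 2 * (x 1 : ℂ) ^ 2 +
            ε 3 * (x 2 : ℂ) ^ 2 = _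
          simp [ε]
          ring
        rw [h3, hnull, sub_self]
      have hev := congrArg (MvPolynomial.eval k) hQ
      rw [map_mul, hbox, mul_zero, map_sub, ← hF, hPF, hF, zero_sub, eq_comm, neg_eq_zero, map_add,
        map_mul, MvPolynomial.eval_rename, MvPolynomial.eval_rename, MvPolynomial.eval_X] at hev
      exact hev
    have hp := hval r rfl (by linarith)
    have hn := hval (-r) (neg_sq r) (by linarith)
    have hr0 : (r : ℂ) ≠ 0 := by
      have : 0 < r := h2.trans hrx
      exact_mod_cast this.ne'
    push_cast at hn
    have hA : MvPolynomial.eval (fun i => (x i : ℂ)) A = 0 := by linear_combination (hp + hn) / 2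
    rw [hA, zero_add] at hp
    exact ⟨hA, (mul_eq_zero.mp hp).resolve_left hr0⟩
  have zero_of (A : MvPolynomial (Fin 3) ℂ)
      (hA : ∀ x : Fin 3 → ℝ, (∀ i, 0 < x i) → MvPolynomial.eval (fun i => (x i : ℂ)) A = 0) :
      A = 0 := by
    refine MvPolynomial.funext_set (fun _ => (fun x : ℝ => (x : ℂ)) '' Set.Ioi 0) (fun _ =>
      (Set.Ioi_infinite 0).image Complex.ofReal_injective.injOn) fun y hy => ?_
    choose x hx hxy using fun i => hy i (Set.mem_univ i)
    rw [map_zero, ← hA x hx]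
    congr 2
    funext i
    exact (hxy i).symm
  rw [zero_of A fun x hx => (key x hx).1, zero_of B fun x hx => (key x hx).2] at h
  simpa using h

/-! ### Fields in a null frame and their contractions -/

/-- The space spanned by the field components. -/
abbrev FieldSpace := FieldComp →₀ ℂ

/-- The graviton field with polarization `v ⊗ w`. -/
def hVec : (Fin 4 → ℂ) →ₗ[ℂ] (Fin 4 → ℂ) →ₗ[ℂ] FieldSpace :=
  LinearMap.mk₂ ℂ (fun v w => ∑ μ, ∑ ν, (v μ * w ν) • Finsupp.single (FieldComp.h μ ν) 1)
    (fun v v' w => by simp only [Pi.add_apply, add_mul, add_smul, Finset.sum_add_distrib])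
    (fun c v w => by
      simp only [Pi.smul_apply, smul_eq_mul, mul_assoc, mul_smul, ← Finset.smul_sum])
    (fun v w w' => by simp only [Pi.add_apply, mul_add, add_smul, Finset.sum_add_distrib])
    (fun c v w => by
      simp only [Pi.smul_apply, smul_eq_mul, mul_left_comm _ c, mul_smul c, ← Finset.smul_sum])

theorem hVec_apply (v w : Fin 4 → ℂ) :
    hVec v w = ∑ μ, ∑ ν, (v μ * w ν) • Finsupp.single (FieldComp.h μ ν) 1 := rfl

/-- The ghost field with polarization `v`. -/
def uVec : (Fin 4 → ℂ) →ₗ[ℂ] FieldSpace :=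
  ∑ μ, (LinearMap.proj μ).smulRight (Finsupp.single (FieldComp.u μ) 1)

theorem uVec_apply (v : Fin 4 → ℂ) : uVec v = ∑ μ, v μ • Finsupp.single (FieldComp.u μ) 1 := by
  simp [uVec]

/-- The anti-ghost field with polarization `v`. -/
def utVec : (Fin 4 → ℂ) →ₗ[ℂ] FieldSpace :=
  ∑ μ, (LinearMap.proj μ).smulRight (Finsupp.single (FieldComp.ut μ) 1)

theorem utVec_apply (v : Fin 4 → ℂ) : utVec v = ∑ μ, v μ • Finsupp.single (FieldComp.ut μ) 1 := by
  simp [utVec]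

/-- The field components with respect to a null frame. -/
def frameField (F : NullFrame) : FieldComp → FieldSpace
  | .h a b => hVec (F.vec a) (F.vec b)
  | .u a => uVec (F.vec a)
  | .ut a => utVec (F.vec a)

/-- The bilinear extension of the numbers in the two-point functions. -/
def twoPointL : FieldSpace →ₗ[ℂ] FieldSpace →ₗ[ℂ] ℂ :=
  Finsupp.linearCombination ℂ fun φ => Finsupp.linearCombination ℂ fun ψ => twoPoint φ ψ

theorem twoPointL_single (φ ψ : FieldComp) :
    twoPointL (Finsupp.single φ 1) (Finsupp.single ψ 1) = twoPoint φ ψ := by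
  simp [twoPointL]

/-- The Minkowski bilinear form. -/
def minkForm (v w : Fin 4 → ℂ) : ℂ := ∑ μ, ε μ * v μ * w μ

theorem sum_mul_η (f : Fin 4 → ℂ) (μ : Fin 4) : ∑ ρ, f ρ * η μ ρ = f μ * ε μ := by
  simp [η]

theorem twoPointL_hVec (v w v' w' : Fin 4 → ℂ) :
    twoPointL (hVec v w) (hVec v' w') = -(Complex.I / 2) * (minkForm v v' * minkForm w w' +
      minkForm w v' * minkForm v w' - minkForm v w * minkForm v' w') := by
  have h0 : twoPointL (hVec v w) (hVec v' w') =
      ∑ μ, ∑ ν, ∑ ρ, ∑ σ, v μ * w ν * (v' ρ * w' σ) * twoPoint (.h μ ν) (.h ρ σ) := by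
    rw [hVec_apply v w]
    simp only [map_sum, map_smul, LinearMap.sum_apply, LinearMap.smul_apply]
    simp only [hVec_apply, map_sum, map_smul, twoPointL_single, smul_eq_mul, Finset.mul_sum]
    refine Finset.sum_congr rfl fun μ _ => Finset.sum_congr rfl fun ν _ =>
      Finset.sum_congr rfl fun ρ _ => Finset.sum_congr rfl fun σ _ => ?_
    ring
  have h1 : ∑ μ, ∑ ν, ∑ ρ, ∑ σ, v μ * w ν * (v' ρ * w' σ) * (η μ ρ * η ν σ) =
      minkForm v v' * minkForm w w' := by
    rw [minkForm, minkForm, Finset.sum_mul_sum]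
    refine Finset.sum_congr rfl fun μ _ => Finset.sum_congr rfl fun ν _ => ?_
    simp only [← mul_assoc _ (η μ _) (η ν _), sum_mul_η (fun σ => _ * (_ * w' σ) * _) ν]
    have := sum_mul_η (fun ρ => v μ * w ν * (v' ρ * w' ν) * ε ν) μ
    simp only [mul_right_comm _ (η μ _) (ε ν), this]
    ring
  have h2 : ∑ μ, ∑ ν, ∑ ρ, ∑ σ, v μ * w ν * (v' ρ * w' σ) * (η ν ρ * η μ σ) =
      minkForm w v' * minkForm v w' := by
    rw [mul_comm, minkForm, minkForm, Finset.sum_mul_sum]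
    refine Finset.sum_congr rfl fun μ _ => Finset.sum_congr rfl fun ν _ => ?_
    simp only [← mul_assoc _ (η ν _) (η μ _), sum_mul_η (fun σ => _ * (_ * w' σ) * _) μ]
    have := sum_mul_η (fun ρ => v μ * w ν * (v' ρ * w' μ) * ε μ) ν
    simp only [mul_right_comm _ (η ν _) (ε μ), this]
    ring
  have h3 : ∑ μ, ∑ ν, ∑ ρ, ∑ σ, v μ * w ν * (v' ρ * w' σ) * (η μ ν * η ρ σ) =
      minkForm v w * minkForm v' w' := by
    have e (μ ν : Fin 4) : ∑ ρ, ∑ σ, v μ * w ν * (v' ρ * w' σ) * (η μ ν * η ρ σ) =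
        v μ * w ν * minkForm v' w' * η μ ν := by
      simp only [← mul_assoc _ (η μ ν) (η _ _), sum_mul_η (fun σ => _ * (_ * w' σ) * _)]
      rw [minkForm, Finset.mul_sum, Finset.sum_mul]
      exact Finset.sum_congr rfl fun ρ _ => by ring
    simp only [e]
    generalize minkForm v' w' = m
    rw [minkForm, Finset.sum_mul]
    refine Finset.sum_congr rfl fun μ _ => ?_
    rw [sum_mul_η (fun ν => v μ * w ν * m) μ]
    ring
  rw [h0, ← h1, ← h2, ← h3]
  simp only [← Finset.sum_add_distrib, ← Finset.sum_sub_distrib, Finset.mul_sum, twoPoint]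
  refine Finset.sum_congr rfl fun μ _ => Finset.sum_congr rfl fun ν _ =>
    Finset.sum_congr rfl fun ρ _ => Finset.sum_congr rfl fun σ _ => ?_
  ring

theorem twoPointL_uVec_utVec (v w : Fin 4 → ℂ) :
    twoPointL (uVec v) (utVec w) = Complex.I * minkForm v w := by
  rw [uVec_apply]
  simp only [map_sum, map_smul, LinearMap.sum_apply, LinearMap.smul_apply]
  simp only [utVec_apply, map_sum, map_smul, twoPointL_single, smul_eq_mul, twoPoint, minkForm,
    Finset.mul_sum]
  refine Finset.sum_congr rfl fun μ _ => ?_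
  have := sum_mul_η (fun ν => v μ * (w ν * (Complex.I))) μ
  calc _ = ∑ ν, v μ * (w ν * (Complex.I)) * η μ ν := Finset.sum_congr rfl fun ν _ => by ring
    _ = _ := by rw [this]; ring

theorem twoPointL_utVec_uVec (v w : Fin 4 → ℂ) :
    twoPointL (utVec v) (uVec w) = -Complex.I * minkForm v w := by
  rw [utVec_apply]
  simp only [map_sum, map_smul, LinearMap.sum_apply, LinearMap.smul_apply]
  simp only [uVec_apply, map_sum, map_smul, twoPointL_single, smul_eq_mul, twoPoint, minkForm,
    Finset.mul_sum]
  refine Finset.sum_congr rfl fun μ _ => ?_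
  have := sum_mul_η (fun ν => v μ * (w ν * (-Complex.I))) μ
  calc _ = ∑ ν, v μ * (w ν * (-Complex.I)) * η μ ν := Finset.sum_congr rfl fun ν _ => by ring
    _ = _ := by rw [this]; ring

/-- The metric in a null frame. -/
def frameMetric (a b : Fin 4) : ℂ := if b = nullDual a then 1 else 0

/-- The numbers in the two-point functions of the components with respect to a null frame. -/
def frameTwoPoint : FieldComp → FieldComp → ℂ
  | .h a b, .h c d => -(Complex.I / 2) * (frameMetric a c * frameMetric b d +
      frameMetric b c * frameMetric a d - frameMetric a b * frameMetric c d)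
  | .u a, .ut b => Complex.I * frameMetric a b
  | .ut a, .u b => -Complex.I * frameMetric a b
  | _, _ => 0

/-- Two-point functions involve the fields only through the metric, whose components are the same in
all null frames. This independence of the frame is what later yields one constant for all momenta.
-/
theorem twoPointL_frameField (F : NullFrame) (φ ψ : FieldComp) :
    twoPointL (frameField F φ) (frameField F ψ) = frameTwoPoint φ ψ := by
  have h (a b : Fin 4) : minkForm (F.vec a) (F.vec b) = frameMetric a b := F.orth a b
  cases φ <;> cases ψ
  case h.h => rw [frameField, frameField, twoPointL_hVec]; simp only [h, frameTwoPoint]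
  case u.ut => rw [frameField, frameField, twoPointL_uVec_utVec, h]; rfl
  case ut.u => rw [frameField, frameField, twoPointL_utVec_uVec, h]; rfl
  all_goals
    simp only [frameField, frameTwoPoint, hVec_apply, uVec_apply, utVec_apply, map_sum, map_smul,
      LinearMap.sum_apply, LinearMap.smul_apply, twoPointL_single, twoPoint, smul_zero,
      Finset.sum_const_zero]

/-- The boost weight of the vectors of a null frame. -/
def labelWeight : Fin 4 → ℤ := ![1, -1, 0, 0]

/-- The boost weight of the field components with respect to a null frame. -/
def fieldWeight : FieldComp → ℤ
  | .h a b => labelWeight a + labelWeight b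
  | .u a => labelWeight a
  | .ut a => labelWeight a

theorem labelWeight_nullDual (a : Fin 4) : labelWeight (nullDual a) = -labelWeight a := by
  fin_cases a <;> rfl

theorem labelWeight_le (a : Fin 4) : labelWeight a ≤ 1 := by
  fin_cases a <;> simp [labelWeight]

theorem eq_zero_of_labelWeight {a : Fin 4} (h : labelWeight a = 1) : a = 0 := by
  revert h
  fin_cases a <;> simp [labelWeight]

theorem frameMetric_ne_zero {a b : Fin 4} (h : frameMetric a b ≠ 0) :
    labelWeight a + labelWeight b = 0 := by
  have : b = nullDual a := by
    by_contra hb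
    exact h (if_neg hb)
  rw [this, labelWeight_nullDual, add_neg_cancel]

/-- Conservation of boost weight: the metric, and hence each term of the two-point functions, pairs
frame vectors of opposite weight. -/
theorem frameTwoPoint_ne_zero {φ ψ : FieldComp} (h : frameTwoPoint φ ψ ≠ 0) :
    fieldWeight φ + fieldWeight ψ = 0 := by
  cases φ <;> cases ψ <;> simp only [frameTwoPoint, ne_eq, not_true_eq_false] at h
  case h.h a b c d =>
    have : frameMetric a c * frameMetric b d ≠ 0 ∨ frameMetric b c * frameMetric a d ≠ 0 ∨
        frameMetric a b * frameMetric c d ≠ 0 := by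
      by_contra hc
      simp only [not_or, not_not] at hc
      apply h
      rw [hc.1, hc.2.1, hc.2.2]
      ring
    simp only [fieldWeight]
    rcases this with h | h | h <;>
    · have h1 := frameMetric_ne_zero (left_ne_zero_of_mul h)
      have h2 := frameMetric_ne_zero (right_ne_zero_of_mul h)
      linarith
  case u.ut => exact frameMetric_ne_zero (right_ne_zero_of_mul h)
  case ut.u => exact frameMetric_ne_zero (right_ne_zero_of_mul h)

theorem fieldWeight_le (φ : FieldComp) : fieldWeight φ ≤ 2 := by
  cases φ with
  | h a b =>
    have := labelWeight_le a
    have := labelWeight_le b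
    simp only [fieldWeight]
    linarith
  | u a => exact (labelWeight_le a).trans (by norm_num)
  | ut a => exact (labelWeight_le a).trans (by norm_num)

theorem eq_h_of_fieldWeight {φ : FieldComp} (h : fieldWeight φ = 2) : φ = .h 0 0 := by
  cases φ with
  | h a b =>
    have h1 := labelWeight_le a
    have h2 := labelWeight_le b
    simp only [fieldWeight] at h
    rw [eq_zero_of_labelWeight (a := a) (by linarith), eq_zero_of_labelWeight (a := b) (by linarith)]
  | u a =>
    have h1 := labelWeight_le a
    simp only [fieldWeight] at h
    linarith
  | ut a =>
    have h1 := labelWeight_le a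
    simp only [fieldWeight] at h
    linarith

/-- The space of vertices with three legs. -/
abbrev TripleSpace := FieldSpace ⊗[ℂ] (FieldSpace ⊗[ℂ] FieldSpace)

/-- The space spanned by the pairs of field components. -/
abbrev PairSpace := FieldComp × FieldComp →₀ ℂ

/-- The bilinear extension of the formation of pairs. -/
def pairUp : FieldSpace →ₗ[ℂ] FieldSpace →ₗ[ℂ] PairSpace :=
  Finsupp.linearCombination ℂ fun φ => Finsupp.linearCombination ℂ fun ψ => Finsupp.single (φ, ψ) 1

theorem pairUp_single (φ ψ : FieldComp) :
    pairUp (Finsupp.single φ 1) (Finsupp.single ψ 1) = Finsupp.single (φ, ψ) 1 := by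
  simp [pairUp]

/-- The contraction of the first two legs of two vertices. -/
def contrTriple : TripleSpace →ₗ[ℂ] TripleSpace →ₗ[ℂ] PairSpace :=
  (TensorProduct.map₂ twoPointL (TensorProduct.map₂ twoPointL pairUp)).compr₂
    ((TensorProduct.lid ℂ PairSpace).toLinearMap ∘ₗ
      LinearMap.lTensor ℂ (TensorProduct.lid ℂ PairSpace).toLinearMap)

theorem contrTriple_tmul (x y z x' y' z' : FieldSpace) :
    contrTriple (x ⊗ₜ (y ⊗ₜ z)) (x' ⊗ₜ (y' ⊗ₜ z')) =
      twoPointL x x' • twoPointL y y' • pairUp z z' := by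
  rw [smul_comm]
  simp [contrTriple]

/-- The vertex with three given field components with respect to a null frame. -/
def frameTriple (φ₁ φ₂ φ₃ : FieldComp) (F : NullFrame) : TripleSpace :=
  frameField F φ₁ ⊗ₜ (frameField F φ₂ ⊗ₜ frameField F φ₃)

/-- The vertices of boost weight two. -/
def weightTwo : Submodule ℂ (NullFrame → TripleSpace) :=
  Submodule.span ℂ {t | ∃ φ₁ φ₂ φ₃, fieldWeight φ₁ + fieldWeight φ₂ + fieldWeight φ₃ = 2 ∧
    t = frameTriple φ₁ φ₂ φ₃}

theorem frameTriple_mem {φ₁ φ₂ φ₃ : FieldComp}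
    (h : fieldWeight φ₁ + fieldWeight φ₂ + fieldWeight φ₃ = 2) :
    frameTriple φ₁ φ₂ φ₃ ∈ weightTwo :=
  Submodule.subset_span ⟨φ₁, φ₂, φ₃, h, rfl⟩

/-- Only the contribution with two gravitons of maximal weight survives the contraction of two
vertices of weight two. -/
theorem exists_contrTriple_eq {u v : NullFrame → TripleSpace} (hu : u ∈ weightTwo)
    (hv : v ∈ weightTwo) : ∃ c : ℂ, ∀ F, contrTriple (u F) (v F) =
      c • pairUp (frameField F (.h 0 0)) (frameField F (.h 0 0)) := by
  induction hu, hv using Submodule.span_induction₂ with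
  | mem_mem u v hu hv =>
    obtain ⟨φ₁, φ₂, φ₃, hφ, rfl⟩ := hu
    obtain ⟨ψ₁, ψ₂, ψ₃, hψ, rfl⟩ := hv
    by_cases h : frameTwoPoint φ₁ ψ₁ * frameTwoPoint φ₂ ψ₂ = 0
    · refine ⟨0, fun F => ?_⟩
      rw [frameTriple, frameTriple, contrTriple_tmul, twoPointL_frameField, twoPointL_frameField,
        smul_smul, h, zero_smul, zero_smul]
    -- The two vertices have total weight four and the contracted pairs carry none of it. The two
    -- free legs have weight at most two each, so both are maximal.
    · have h1 := frameTwoPoint_ne_zero (left_ne_zero_of_mul h)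
      have h2 := frameTwoPoint_ne_zero (right_ne_zero_of_mul h)
      have h3 := fieldWeight_le φ₃
      have h4 := fieldWeight_le ψ₃
      have h5 : φ₃ = .h 0 0 := eq_h_of_fieldWeight (by linarith)
      have h6 : ψ₃ = .h 0 0 := eq_h_of_fieldWeight (by linarith)
      refine ⟨frameTwoPoint φ₁ ψ₁ * frameTwoPoint φ₂ ψ₂, fun F => ?_⟩
      rw [frameTriple, frameTriple, contrTriple_tmul, twoPointL_frameField, twoPointL_frameField,
        smul_smul, h5, h6]
  | zero_left v hv => exact ⟨0, fun F => by simp⟩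
  | zero_right u hu => exact ⟨0, fun F => by simp⟩
  | add_left u u' v hu hu' hv h h' =>
    obtain ⟨c, hc⟩ := h
    obtain ⟨c', hc'⟩ := h'
    exact ⟨c + c', fun F => by
      rw [Pi.add_apply, map_add, LinearMap.add_apply, hc, hc', add_smul]⟩
  | add_right u v v' hu hv hv' h h' =>
    obtain ⟨c, hc⟩ := h
    obtain ⟨c', hc'⟩ := h'
    exact ⟨c + c', fun F => by rw [Pi.add_apply, map_add, hc, hc', add_smul]⟩
  | smul_left r u v hu hv h =>
    obtain ⟨c, hc⟩ := h
    exact ⟨r * c, fun F => by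
      rw [Pi.smul_apply, map_smul, LinearMap.smul_apply, hc, smul_smul]⟩
  | smul_right r u v hu hv h =>
    obtain ⟨c, hc⟩ := h
    exact ⟨r * c, fun F => by rw [Pi.smul_apply, map_smul, hc, smul_smul]⟩

/-! ### The vertices of Wick polynomials of degree three -/

/-- The first leg, the `i`-th factor of a word. -/
def legOne (i : ℕ) (w : Word) : Jet := w.getD i (uJ 0)

/-- The second leg, the `k`-th of the remaining factors. -/
def legTwo (i k : ℕ) (w : Word) : Jet := (w.eraseIdx i).getD k (uJ 0)

/-- The third leg, the remaining factor. -/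
def legThree (i k : ℕ) (w : Word) : Jet := ((w.eraseIdx i).eraseIdx k).getD 0 (uJ 0)

/-- The multi-index of all derivatives in a word. -/
def wordDeriv (w : Word) : Fin 4 →₀ ℕ := (w.map Jet.deriv).sum

/-- The value of a monomial at the momentum of a null frame. -/
def NullFrame.momPow (F : NullFrame) (α : Fin 4 →₀ ℕ) : ℂ :=
  MvPolynomial.eval F.mom (MvPolynomial.monomial α 1)

theorem NullFrame.momPow_zero (F : NullFrame) : F.momPow 0 = 1 := by simp [momPow]

theorem NullFrame.momPow_add (F : NullFrame) (α β : Fin 4 →₀ ℕ) :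
    F.momPow (α + β) = F.momPow α * F.momPow β := by
  rw [momPow, momPow, momPow, ← map_mul, MvPolynomial.monomial_mul, one_mul]

theorem NullFrame.momPow_single (F : NullFrame) (μ : Fin 4) :
    F.momPow (Finsupp.single μ 1) = F.mom μ := MvPolynomial.eval_X μ

/-- The vertex of a word, with its derivatives evaluated at the momentum of a null frame and its
legs ordered by `i` and `k`. -/
def wordVertex (F : NullFrame) (i k : ℕ) (w : Word) : TripleSpace :=
  F.momPow (wordDeriv w) • (Finsupp.single (legOne i w).field 1 ⊗ₜ
    (Finsupp.single (legTwo i k w).field 1 ⊗ₜ Finsupp.single (legThree i k w).field 1))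

/-- The linear extension of `wordVertex`. -/
def vertex (F : NullFrame) (i k : ℕ) : (Word →₀ ℂ) →ₗ[ℂ] TripleSpace :=
  Finsupp.linearCombination ℂ (wordVertex F i k)

theorem vertex_single (F : NullFrame) (i k : ℕ) (w : Word) (c : ℂ) :
    vertex F i k (Finsupp.single w c) = c • wordVertex F i k w := by
  simp [vertex]

/-- The parities and the numbers of derivatives of the factors of a word. -/
def shape (w : Word) : List (ℕ × ℕ) := w.map fun j => (j.field.parity, j.deriv.degree)

/-- The span of the words of a given shape. -/
def shapeSpan (s : List (ℕ × ℕ)) : Submodule ℂ (Word →₀ ℂ) :=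
  Submodule.span ℂ {x | ∃ w, shape w = s ∧ x = Finsupp.single w 1}

theorem single_mem_shapeSpan {s : List (ℕ × ℕ)} {w : Word} (h : shape w = s) (c : ℂ) :
    Finsupp.single w c ∈ shapeSpan s := by
  rw [← mul_one c, ← smul_eq_mul, ← Finsupp.smul_single]
  exact Submodule.smul_mem _ _ (Submodule.subset_span ⟨w, h, rfl⟩)

/-- The six choices of legs are permutations generated by two transpositions, and the total weight
is symmetric in the legs. Only one ordering of each vertex then has to be computed. -/
theorem exists_legPermutation {i k : ℕ} (hi : i < 3) (hk : k < 2) :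
    ∃ p : TripleSpace →ₗ[ℂ] TripleSpace,
      (∀ (F : NullFrame) (w : Word), w.length = 3 →
        wordVertex F i k w = p (wordVertex F 0 0 w)) ∧
      ∀ φ₁ φ₂ φ₃, fieldWeight φ₁ + fieldWeight φ₂ + fieldWeight φ₃ = 2 →
        (fun F => p (frameTriple φ₁ φ₂ φ₃ F)) ∈ weightTwo := by
  let c : TripleSpace →ₗ[ℂ] TripleSpace :=
    (TensorProduct.comm ℂ FieldSpace FieldSpace).toLinearMap.lTensor FieldSpace
  let l : TripleSpace →ₗ[ℂ] TripleSpace :=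
    (TensorProduct.leftComm ℂ FieldSpace FieldSpace FieldSpace).toLinearMap
  have hc (x y z : FieldSpace) : c (x ⊗ₜ (y ⊗ₜ z)) = x ⊗ₜ (z ⊗ₜ y) := rfl
  have hl (x y z : FieldSpace) : l (x ⊗ₜ (y ⊗ₜ z)) = y ⊗ₜ (x ⊗ₜ z) := rfl
  have hw (p : TripleSpace →ₗ[ℂ] TripleSpace)
      (h : ∀ (a b d : Jet) (F : NullFrame),
        wordVertex F i k [a, b, d] = p (wordVertex F 0 0 [a, b, d])) (F : NullFrame) (w : Word)
      (hw : w.length = 3) : wordVertex F i k w = p (wordVertex F 0 0 w) := by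
    obtain ⟨a, b, d, rfl⟩ := List.length_eq_three.mp hw
    exact h a b d F
  interval_cases i <;> interval_cases k
  · refine ⟨LinearMap.id, hw _ fun a b d F => rfl, fun φ₁ φ₂ φ₃ h => frameTriple_mem h⟩
  · refine ⟨c, hw _ fun a b d F => ?_, fun φ₁ φ₂ φ₃ h =>
      frameTriple_mem (φ₁ := φ₁) (φ₂ := φ₃) (φ₃ := φ₂) (by linarith)⟩
    rw [wordVertex, wordVertex, map_smul, hc]
    rfl
  · refine ⟨l, hw _ fun a b d F => ?_, fun φ₁ φ₂ φ₃ h =>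
      frameTriple_mem (φ₁ := φ₂) (φ₂ := φ₁) (φ₃ := φ₃) (by linarith)⟩
    rw [wordVertex, wordVertex, map_smul, hl]
    rfl
  · refine ⟨c ∘ₗ l, hw _ fun a b d F => ?_, fun φ₁ φ₂ φ₃ h =>
      frameTriple_mem (φ₁ := φ₂) (φ₂ := φ₃) (φ₃ := φ₁) (by linarith)⟩
    rw [wordVertex, wordVertex, map_smul, LinearMap.comp_apply, hl, hc]
    rfl
  · refine ⟨l ∘ₗ c, hw _ fun a b d F => ?_, fun φ₁ φ₂ φ₃ h =>
      frameTriple_mem (φ₁ := φ₃) (φ₂ := φ₁) (φ₃ := φ₂) (by linarith)⟩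
    rw [wordVertex, wordVertex, map_smul, LinearMap.comp_apply, hc, hl]
    rfl
  · refine ⟨l ∘ₗ c ∘ₗ l, hw _ fun a b d F => ?_, fun φ₁ φ₂ φ₃ h =>
      frameTriple_mem (φ₁ := φ₃) (φ₂ := φ₂) (φ₃ := φ₁) (by linarith)⟩
    rw [wordVertex, wordVertex, map_smul, LinearMap.comp_apply, LinearMap.comp_apply, hl, hc, hl]
    rfl

/-- The Wick polynomials of degree three whose vertices have weight two. -/
structure IsWeightTwo (s : List (ℕ × ℕ)) (T : Word →₀ ℂ) : Prop where
  mem_shapeSpan : T ∈ shapeSpan s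
  vertex_mem : (fun F => vertex F 0 0 T) ∈ weightTwo

theorem IsWeightTwo.vertex_mem' {s : List (ℕ × ℕ)} {T : Word →₀ ℂ} (hT : IsWeightTwo s T)
    (hs : s.length = 3) {i k : ℕ} (hi : i < 3) (hk : k < 2) :
    (fun F => vertex F i k T) ∈ weightTwo := by
  obtain ⟨p, hp, hp'⟩ := exists_legPermutation hi hk
  have h1 (F : NullFrame) : vertex F i k T = p (vertex F 0 0 T) := by
    have h := hT.mem_shapeSpan
    clear hT
    rw [shapeSpan] at h
    induction h using Submodule.span_induction with
    | mem x hx =>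
      obtain ⟨w, hw, rfl⟩ := hx
      have : w.length = 3 := by rw [← hs, ← hw, shape, List.length_map]
      rw [vertex_single, vertex_single, one_smul, one_smul, hp F w this]
    | zero => simp
    | add x y _ _ hx hy => rw [map_add, map_add, map_add, hx, hy]
    | smul c x _ hx => rw [map_smul, map_smul, map_smul, hx]
  simp only [h1]
  have h2 : weightTwo ≤ weightTwo.comap (LinearMap.compLeft p NullFrame) := by
    conv_lhs => rw [weightTwo]
    rw [Submodule.span_le]
    rintro _ ⟨φ₁, φ₂, φ₃, h, rfl⟩
    exact hp' φ₁ φ₂ φ₃ h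
  exact h2 hT.vertex_mem

/-- The contraction of two legs of two words, with its derivatives as a polynomial. -/
def contrWord (i k j l : ℕ) (a b : Word) : FieldComp × FieldComp →₀ DerivPoly :=
  Finsupp.single ((legThree i k a).field, (legThree j l b).field)
    ((twoPoint (legOne i a).field (legOne j b).field *
      twoPoint (legTwo i k a).field (legTwo j l b).field) •
        MvPolynomial.monomial (wordDeriv a + wordDeriv b) 1)

/-- The bilinear extension of `contrWord`. -/
def contrWordL (i k j l : ℕ) :
    (Word →₀ ℂ) →ₗ[ℂ] (Word →₀ ℂ) →ₗ[ℂ] (FieldComp × FieldComp →₀ DerivPoly) :=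
  Finsupp.linearCombination ℂ fun a => Finsupp.linearCombination ℂ fun b => contrWord i k j l a b

/-- The evaluation of the coefficients at the momentum of a null frame. -/
def evalPair (F : NullFrame) : (FieldComp × FieldComp →₀ DerivPoly) →ₗ[ℂ] PairSpace :=
  Finsupp.mapRange.linearMap (MvPolynomial.aeval F.mom).toLinearMap

theorem evalPair_apply (F : NullFrame) (S : FieldComp × FieldComp →₀ DerivPoly)
    (x : FieldComp × FieldComp) : evalPair F S x = MvPolynomial.eval F.mom (S x) := rfl

theorem evalPair_single (F : NullFrame) (x : FieldComp × FieldComp) (P : DerivPoly) :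
    evalPair F (Finsupp.single x P) = MvPolynomial.eval F.mom P • Finsupp.single x 1 := by
  rw [evalPair, Finsupp.mapRange.linearMap_apply, Finsupp.mapRange_single, Finsupp.smul_single,
    smul_eq_mul, mul_one]
  rfl

/-- With all derivatives evaluated at one momentum, the monomial of a contraction splits into the
monomials of the two words, so the contraction is a bilinear function of two separate vertices. -/
theorem evalPair_contrWordL (F : NullFrame) (i k j l : ℕ) (A B : Word →₀ ℂ) :
    evalPair F (contrWordL i k j l A B) = contrTriple (vertex F i k A) (vertex F j l B) := by
  have : (contrWordL i k j l).compr₂ (evalPair F) =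
      contrTriple.compl₁₂ (vertex F i k) (vertex F j l) := by
    refine Finsupp.lhom_ext' fun a => LinearMap.ext_ring ?_
    refine Finsupp.lhom_ext' fun b => LinearMap.ext_ring ?_
    simp only [contrWordL, LinearMap.comp_apply, LinearMap.compr₂_apply, LinearMap.compl₁₂_apply,
      Finsupp.lsingle_apply, Finsupp.linearCombination_single, one_smul, vertex_single]
    rw [contrWord, evalPair_single, wordVertex, wordVertex, map_smul contrTriple,
      LinearMap.smul_apply, map_smul (contrTriple _), contrTriple_tmul, twoPointL_single,
      twoPointL_single, pairUp_single, MvPolynomial.smul_eval, smul_smul, smul_smul, smul_smul]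
    congr 1
    change _ * F.momPow _ = _
    rw [NullFrame.momPow_add]
    ring
  exact LinearMap.congr_fun (LinearMap.congr_fun this A) B

/-! ### Contractions of vertices of weight two are relative coboundaries -/

/-- The linear extension of `pairClass`. -/
def pairClassL : (FieldComp × FieldComp →₀ DerivPoly) →ₗ[ℂ] Cochain ⧸ relCobound :=
  Finsupp.lsum ℂ fun x =>
    { toFun := fun P => pairClass P x.1 x.2
      map_add' := fun P Q => pairClass_add P Q _ _
      map_smul' := fun c P => pairClass_smul c P _ _ }

theorem pairClassL_single (x : FieldComp × FieldComp) (P : DerivPoly) :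
    pairClassL (Finsupp.single x P) = pairClass P x.1 x.2 := by
  rw [pairClassL, Finsupp.lsum_single]
  rfl

/-- Each coefficient vanishes on the null cone, hence is a multiple of the wave operator, and the
wave equation for the external fields applies. -/
theorem pairClassL_eq_zero {S : FieldComp × FieldComp →₀ DerivPoly}
    (hS : ∀ F, evalPair F S = 0) : pairClassL S = 0 := by
  rw [pairClassL, Finsupp.lsum_apply]
  refine Finset.sum_eq_zero fun x _ => pairClass_eq_zero (mem_span_boxPoly fun F => ?_) _ _
  rw [← evalPair_apply, hS]
  rfl

theorem pairUp_hVec (v w v' w' : Fin 4 → ℂ) : pairUp (hVec v w) (hVec v' w') =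
    ∑ μ, ∑ ν, ∑ ρ, ∑ σ, (v μ * w ν * (v' ρ * w' σ)) •
      Finsupp.single (FieldComp.h μ ν, FieldComp.h ρ σ) (1 : ℂ) := by
  rw [hVec_apply v w]
  simp only [map_sum, map_smul, LinearMap.sum_apply, LinearMap.smul_apply]
  simp only [hVec_apply, map_sum, map_smul, pairUp_single, Finset.smul_sum, mul_smul]

/-- The first frame vector is the momentum itself, so the right-hand side is c times the value of
the double divergence E of both gravitons. As c is the same for all frames, S - cE vanishes on the
whole null cone, and E is a relative coboundary. -/
theorem pairClassL_eq_zero_of_evalPair {S : FieldComp × FieldComp →₀ DerivPoly} {c : ℂ}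
    (hS : ∀ F, evalPair F S = c • pairUp (frameField F (.h 0 0)) (frameField F (.h 0 0))) :
    pairClassL S = 0 := by
  let E : FieldComp × FieldComp →₀ DerivPoly := ∑ μ, ∑ ν, ∑ ρ, ∑ σ, (ε μ * ε ν * ε ρ * ε σ) •
    Finsupp.single (FieldComp.h μ ν, FieldComp.h ρ σ) (MvPolynomial.X μ * MvPolynomial.X ν *
      MvPolynomial.X ρ * MvPolynomial.X σ)
  have hE : pairClassL E = 0 := by
    rw [← sum_pairClass_h_h_eq_zero]
    simp only [E, map_sum, map_smul, pairClassL_single]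
  have hE' (F : NullFrame) :
      evalPair F E = pairUp (frameField F (.h 0 0)) (frameField F (.h 0 0)) := by
    have e (μ : Fin 4) : F.vec 0 μ = ε μ * F.mom μ := by
      rw [NullFrame.mom, ← mul_assoc, ε_mul_ε, one_mul]
    rw [frameField, pairUp_hVec]
    simp only [E, map_sum, map_smul, evalPair_single, map_mul, MvPolynomial.eval_X, smul_smul, e]
    refine Finset.sum_congr rfl fun μ _ => Finset.sum_congr rfl fun ν _ =>
      Finset.sum_congr rfl fun ρ _ => Finset.sum_congr rfl fun σ _ => ?_
    congr 1
    ring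
  have h0 : pairClassL (S - c • E) = 0 := pairClassL_eq_zero fun F => by
    rw [map_sub, map_smul, hS, hE', sub_self]
  rwa [map_sub, map_smul, hE, smul_zero, sub_zero] at h0

theorem pairClassL_contrWordL {s s' : List (ℕ × ℕ)} {A B : Word →₀ ℂ} (hs : s.length = 3)
    (hs' : s'.length = 3) (hA : IsWeightTwo s A) (hB : IsWeightTwo s' B) {i k j l : ℕ}
    (hi : i < 3) (hk : k < 2) (hj : j < 3) (hl : l < 2) :
    pairClassL (contrWordL i k j l A B) = 0 := by
  obtain ⟨c, hc⟩ := exists_contrTriple_eq (hA.vertex_mem' hs hi hk) (hB.vertex_mem' hs' hj hl)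
  exact pairClassL_eq_zero_of_evalPair (c := c) fun F => by rw [evalPair_contrWordL, hc]

/-! ### The vertices of the Lagrangian have weight two -/

/-- The coordinate vectors. -/
def coordVec (μ : Fin 4) : Fin 4 → ℂ := Pi.single μ 1

theorem eq_sum_coordVec (v : Fin 4 → ℂ) : v = ∑ μ, v μ • coordVec μ := by
  funext ν
  simp [coordVec, Pi.single_apply]

theorem hVec_coordVec (μ ν : Fin 4) :
    hVec (coordVec μ) (coordVec ν) = Finsupp.single (FieldComp.h μ ν) 1 := by
  simp [hVec_apply, coordVec, Pi.single_apply]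

theorem uVec_coordVec (μ : Fin 4) : uVec (coordVec μ) = Finsupp.single (FieldComp.u μ) 1 := by
  simp [uVec_apply, coordVec, Pi.single_apply]

theorem utVec_coordVec (μ : Fin 4) : utVec (coordVec μ) = Finsupp.single (FieldComp.ut μ) 1 := by
  simp [utVec_apply, coordVec, Pi.single_apply]

/-- The contraction of two indices, in terms of a null frame. -/
theorem NullFrame.sum_contraction (F : NullFrame) {M : Type*} [AddCommMonoid M] [Module ℂ M]
    (Φ : (Fin 4 → ℂ) →ₗ[ℂ] (Fin 4 → ℂ) →ₗ[ℂ] M) :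
    ∑ μ, ε μ • Φ (coordVec μ) (coordVec μ) = ∑ a, Φ (F.vec a) (F.vec (nullDual a)) := by
  have h (v w : Fin 4 → ℂ) : Φ v w = ∑ μ, ∑ ν, (v μ * w ν) • Φ (coordVec μ) (coordVec ν) := by
    conv_lhs => rw [eq_sum_coordVec v]
    simp only [map_sum, map_smul, LinearMap.sum_apply, LinearMap.smul_apply]
    refine Finset.sum_congr rfl fun μ _ => ?_
    conv_lhs => rw [eq_sum_coordVec w]
    simp only [map_sum, map_smul, Finset.smul_sum, smul_smul]
  simp only [h (F.vec _)]
  rw [Finset.sum_comm]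
  refine Finset.sum_congr rfl fun μ _ => ?_
  rw [Finset.sum_comm]
  simp only [← Finset.sum_smul, F.complete]
  simp [η]

theorem smul_triple (a b c : ℂ) (x y z : FieldSpace) :
    (a * (b * c)) • (x ⊗ₜ[ℂ] (y ⊗ₜ[ℂ] z)) = (a • x) ⊗ₜ ((b • y) ⊗ₜ (c • z)) := by
  simp only [TensorProduct.tmul_smul, ← TensorProduct.smul_tmul', smul_smul]
  congr 1
  ring

theorem smul_triple_right (b c : ℂ) (x y z : FieldSpace) :
    (b * c) • (x ⊗ₜ[ℂ] (y ⊗ₜ[ℂ] z)) = x ⊗ₜ ((b • y) ⊗ₜ (c • z)) := by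
  simp only [TensorProduct.tmul_smul, ← TensorProduct.smul_tmul', smul_smul, mul_comm c]

theorem smul_triple_mid (a b c : ℂ) (x y z : FieldSpace) :
    (a * (b * c)) • (x ⊗ₜ[ℂ] (y ⊗ₜ[ℂ] z)) = (a • x) ⊗ₜ (b • (y ⊗ₜ (c • z))) := by
  simp only [TensorProduct.tmul_smul, ← TensorProduct.smul_tmul', smul_smul]
  congr 1
  ring

theorem NullFrame.momPow_wordDeriv (F : NullFrame) (a b c : Jet) :
    F.momPow (wordDeriv [a, b, c]) = F.momPow a.deriv * F.momPow b.deriv * F.momPow c.deriv := by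
  simp [wordDeriv, NullFrame.momPow_add, mul_assoc]

theorem wordVertex_triple (F : NullFrame) (a b c : Jet) :
    wordVertex F 0 0 [a, b, c] = (F.momPow a.deriv * F.momPow b.deriv * F.momPow c.deriv) •
      (Finsupp.single a.field 1 ⊗ₜ (Finsupp.single b.field 1 ⊗ₜ Finsupp.single c.field 1)) := by
  rw [wordVertex, F.momPow_wordDeriv]
  rfl

/-- The trace of the graviton field in a null frame. -/
theorem sum_h_trace (F : NullFrame) :
    ∑ ρ, ε ρ • (Finsupp.single (FieldComp.h ρ ρ) 1 : FieldSpace) =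
      ∑ a, frameField F (.h a (nullDual a)) := by
  simp only [← hVec_coordVec]
  exact F.sum_contraction hVec

theorem sum_h_h (F : NullFrame) :
    ∑ ρ, ∑ σ, (ε ρ * ε σ) • ((Finsupp.single (FieldComp.h ρ σ) 1 : FieldSpace) ⊗ₜ[ℂ]
      (Finsupp.single (FieldComp.h ρ σ) 1 : FieldSpace)) =
      ∑ a, ∑ b, frameField F (.h a b) ⊗ₜ[ℂ] frameField F (.h (nullDual a) (nullDual b)) := by
  simp only [← hVec_coordVec, mul_smul, ← Finset.smul_sum]
  have h (ρ : Fin 4) := F.sum_contraction ((TensorProduct.mk ℂ FieldSpace FieldSpace).compl₁₂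
    (hVec (coordVec ρ)) (hVec (coordVec ρ)))
  simp only [LinearMap.compl₁₂_apply, TensorProduct.mk_apply] at h
  simp only [h, Finset.smul_sum]
  rw [Finset.sum_comm, Finset.sum_comm (f := fun a b => frameField F (.h a b) ⊗ₜ[ℂ] _)]
  refine Finset.sum_congr rfl fun b _ => ?_
  have h' := F.sum_contraction ((TensorProduct.mk ℂ FieldSpace FieldSpace).compl₁₂
    (hVec.flip (F.vec b)) (hVec.flip (F.vec (nullDual b))))
  simp only [LinearMap.compl₁₂_apply, TensorProduct.mk_apply, LinearMap.flip_apply] at h'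
  exact h'

theorem NullFrame.sum_hVec_mom (F : NullFrame) (μ : Fin 4) :
    ∑ σ, (ε σ * F.mom σ) • (Finsupp.single (FieldComp.h μ σ) 1 : FieldSpace) =
      hVec (coordVec μ) (F.vec 0) := by
  conv_rhs => rw [eq_sum_coordVec (F.vec 0)]
  simp only [map_sum, map_smul, hVec_coordVec]
  refine Finset.sum_congr rfl fun σ _ => ?_
  rw [NullFrame.mom, ← mul_assoc, ε_mul_ε, one_mul]

theorem NullFrame.sum_hVec_mom_left (F : NullFrame) (μ : Fin 4) :
    ∑ σ, (ε σ * F.mom σ) • (Finsupp.single (FieldComp.h σ μ) 1 : FieldSpace) =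
      hVec (F.vec 0) (coordVec μ) := by
  conv_rhs => rw [eq_sum_coordVec (F.vec 0)]
  simp only [map_sum, map_smul, LinearMap.sum_apply, LinearMap.smul_apply, hVec_coordVec]
  refine Finset.sum_congr rfl fun σ _ => ?_
  rw [NullFrame.mom, ← mul_assoc, ε_mul_ε, one_mul]

theorem NullFrame.sum_hVec_mom_mom (F : NullFrame) :
    ∑ μ, ∑ ν, (ε μ * F.mom μ * (ε ν * F.mom ν)) •
      (Finsupp.single (FieldComp.h μ ν) 1 : FieldSpace) = frameField F (.h 0 0) := by
  have e (μ : Fin 4) : ε μ * F.mom μ = F.vec 0 μ := by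
    rw [NullFrame.mom, ← mul_assoc, ε_mul_ε, one_mul]
  simp only [e, frameField, hVec_apply]

theorem NullFrame.sum_uVec_mom (F : NullFrame) :
    ∑ μ, (ε μ * F.mom μ) • (Finsupp.single (FieldComp.u μ) 1 : FieldSpace) =
      frameField F (.u 0) := by
  rw [frameField, uVec_apply]
  refine Finset.sum_congr rfl fun σ _ => ?_
  rw [NullFrame.mom, ← mul_assoc, ε_mul_ε, one_mul]

/-- The divergence of the graviton field contracted with the antighost. -/
theorem sum_ut_h (F : NullFrame) :
    ∑ σ, ε σ • ((Finsupp.single (FieldComp.ut σ) 1 : FieldSpace) ⊗ₜ[ℂ]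
      hVec (F.vec 0) (coordVec σ)) =
      ∑ a, frameField F (.ut a) ⊗ₜ[ℂ] frameField F (.h 0 (nullDual a)) := by
  simp only [← utVec_coordVec]
  have h := F.sum_contraction ((TensorProduct.mk ℂ FieldSpace FieldSpace).compl₁₂
    utVec (hVec (F.vec 0)))
  simp only [LinearMap.compl₁₂_apply, TensorProduct.mk_apply] at h
  exact h

theorem labelWeight_add_nullDual (a : Fin 4) : labelWeight a + labelWeight (nullDual a) = 0 := by
  rw [labelWeight_nullDual, add_neg_cancel]

theorem labelWeight_zero : labelWeight 0 = 1 := rfl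

/-- At a common null momentum both derivatives contract the undifferentiated graviton with k, which
gives weight two. The traces are sums over dual pairs of labels and have weight zero. -/
theorem isWeightTwo_T₁ : IsWeightTwo [(0, 0), (0, 1), (0, 1)] T₁ := by
  refine ⟨?_, ?_⟩
  · refine sum_mem fun μ _ => sum_mem fun ν _ => sum_mem fun ρ _ => sum_mem fun σ _ =>
      single_mem_shapeSpan ?_ _
    simp [shape, hJ, dhJ, FieldComp.parity]
  · have h : (fun F => vertex F 0 0 T₁) =
        (-1 : ℂ) • ∑ a, ∑ b, frameTriple (.h 0 0) (.h a (nullDual a)) (.h b (nullDual b)) := by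
      funext F
      have e (μ ν ρ σ : Fin 4) :
          (-(ε μ * ε ν * ε ρ * ε σ)) • wordVertex F 0 0 [hJ μ ν, dhJ μ ρ ρ, dhJ ν σ σ] =
          (-1 : ℂ) • ((ε μ * F.mom μ * (ε ν * F.mom ν)) • Finsupp.single (FieldComp.h μ ν) (1 : ℂ))
            ⊗ₜ[ℂ] ((ε ρ • Finsupp.single (FieldComp.h ρ ρ) (1 : ℂ)) ⊗ₜ[ℂ]
              (ε σ • Finsupp.single (FieldComp.h σ σ) (1 : ℂ))) := by
        rw [← smul_triple, wordVertex_triple]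
        simp only [hJ, dhJ, F.momPow_zero, F.momPow_single, smul_smul]
        congr 1
        ring
      simp only [T₁, map_sum, vertex_single, e, ← Finset.smul_sum, ← TensorProduct.tmul_sum,
        ← TensorProduct.sum_tmul, sum_h_trace F, F.sum_hVec_mom_mom]
      rw [TensorProduct.sum_tmul, TensorProduct.tmul_sum]
      simp only [TensorProduct.tmul_sum, Pi.smul_apply, Finset.sum_apply, frameTriple]
    rw [h]
    refine Submodule.smul_mem _ _ (sum_mem fun a _ => sum_mem fun b _ => frameTriple_mem ?_)
    simp only [fieldWeight, labelWeight_add_nullDual, labelWeight_zero]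
    norm_num

/-- As for the preceding term, with the two traces replaced by two index contractions between the
differentiated gravitons. -/
theorem isWeightTwo_T₂ : IsWeightTwo [(0, 0), (0, 1), (0, 1)] T₂ := by
  refine ⟨?_, ?_⟩
  · refine sum_mem fun μ _ => sum_mem fun ν _ => sum_mem fun ρ _ => sum_mem fun σ _ =>
      single_mem_shapeSpan ?_ _
    simp [shape, hJ, dhJ, FieldComp.parity]
  · have h : (fun F => vertex F 0 0 T₂) =
        (2 : ℂ) • ∑ a, ∑ b, frameTriple (.h 0 0) (.h a b) (.h (nullDual a) (nullDual b)) := by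
      funext F
      have e (μ ν ρ σ : Fin 4) :
          (2 * (ε μ * ε ν * ε ρ * ε σ)) • wordVertex F 0 0 [hJ μ ν, dhJ μ ρ σ, dhJ ν ρ σ] =
          (2 : ℂ) • ((ε μ * F.mom μ * (ε ν * F.mom ν)) • Finsupp.single (FieldComp.h μ ν) (1 : ℂ))
            ⊗ₜ[ℂ] ((ε ρ * ε σ) • (Finsupp.single (FieldComp.h ρ σ) (1 : ℂ) ⊗ₜ[ℂ]
              Finsupp.single (FieldComp.h ρ σ) (1 : ℂ))) := by
        rw [TensorProduct.tmul_smul, ← TensorProduct.smul_tmul', wordVertex_triple]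
        simp only [hJ, dhJ, F.momPow_zero, F.momPow_single, smul_smul]
        congr 1
        ring
      simp only [T₂, map_sum, vertex_single, e, ← Finset.smul_sum, ← TensorProduct.tmul_sum,
        ← TensorProduct.sum_tmul, sum_h_h F, F.sum_hVec_mom_mom]
      simp only [TensorProduct.tmul_sum, Pi.smul_apply, Finset.sum_apply, frameTriple]
    rw [h]
    refine Submodule.smul_mem _ _ (sum_mem fun a _ => sum_mem fun b _ => frameTriple_mem ?_)
    simp only [fieldWeight, labelWeight_nullDual, labelWeight_zero]
    ring

theorem sum_h_hVec_hVec (F : NullFrame) :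
    ∑ μ, ∑ ν, (ε μ * ε ν) • ((Finsupp.single (FieldComp.h μ ν) 1 : FieldSpace) ⊗ₜ[ℂ]
      (hVec (coordVec μ) (F.vec 0) ⊗ₜ[ℂ] hVec (coordVec ν) (F.vec 0))) =
      ∑ a, ∑ b, frameTriple (.h a b) (.h (nullDual a) 0) (.h (nullDual b) 0) F := by
  simp only [← hVec_coordVec, mul_smul, ← Finset.smul_sum]
  have h (μ : Fin 4) := F.sum_contraction
    ((TensorProduct.mk ℂ FieldSpace (FieldSpace ⊗[ℂ] FieldSpace)).compl₁₂ (hVec (coordVec μ))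
      ((TensorProduct.mk ℂ FieldSpace FieldSpace (hVec (coordVec μ) (F.vec 0))) ∘ₗ
        hVec.flip (F.vec 0)))
  simp only [LinearMap.compl₁₂_apply, TensorProduct.mk_apply, LinearMap.comp_apply,
    LinearMap.flip_apply] at h
  simp only [h, Finset.smul_sum]
  rw [Finset.sum_comm, Finset.sum_comm (f := fun a b => frameTriple (.h a b) _ _ F)]
  refine Finset.sum_congr rfl fun b _ => ?_
  have h' := F.sum_contraction
    ((TensorProduct.mk ℂ FieldSpace (FieldSpace ⊗[ℂ] FieldSpace)).compl₁₂ (hVec.flip (F.vec b))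
      ((TensorProduct.mk ℂ FieldSpace FieldSpace).flip (hVec (F.vec (nullDual b)) (F.vec 0)) ∘ₗ
        hVec.flip (F.vec 0)))
  simp only [LinearMap.compl₁₂_apply, TensorProduct.mk_apply, LinearMap.comp_apply,
    LinearMap.flip_apply] at h'
  exact h'

/-- Each derivative is contracted with the other differentiated graviton, because at a common
momentum it no longer matters which field it acts on. Each differentiated graviton thus carries one
vector k, and the other indices are paired. -/
theorem isWeightTwo_T₃ : IsWeightTwo [(0, 0), (0, 1), (0, 1)] T₃ := by
  refine ⟨?_, ?_⟩
  · refine sum_mem fun μ _ => sum_mem fun ν _ => sum_mem fun ρ _ => sum_mem fun σ _ =>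
      single_mem_shapeSpan ?_ _
    simp [shape, hJ, dhJ, FieldComp.parity]
  · have h : (fun F => vertex F 0 0 T₃) =
        (4 : ℂ) • ∑ a, ∑ b, frameTriple (.h a b) (.h (nullDual a) 0) (.h (nullDual b) 0) := by
      funext F
      have e (μ ν ρ σ : Fin 4) :
          (4 * (ε μ * ε ν * ε ρ * ε σ)) • wordVertex F 0 0 [hJ μ ν, dhJ ρ μ σ, dhJ σ ν ρ] =
          (4 : ℂ) • ((ε μ * ε ν) • (Finsupp.single (FieldComp.h μ ν) (1 : ℂ)
            ⊗ₜ[ℂ] (((ε σ * F.mom σ) • Finsupp.single (FieldComp.h μ σ) (1 : ℂ)) ⊗ₜ[ℂ]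
              ((ε ρ * F.mom ρ) • Finsupp.single (FieldComp.h ν ρ) (1 : ℂ))))) := by
        rw [← smul_triple_right, wordVertex_triple]
        simp only [hJ, dhJ, F.momPow_zero, F.momPow_single, smul_smul]
        congr 1
        ring
      simp only [T₃, map_sum, vertex_single, e, ← Finset.smul_sum, ← TensorProduct.tmul_sum,
        ← TensorProduct.sum_tmul, F.sum_hVec_mom, sum_h_hVec_hVec]
      simp only [Pi.smul_apply, Finset.sum_apply]
    rw [h]
    refine Submodule.smul_mem _ _ (sum_mem fun a _ => sum_mem fun b _ => frameTriple_mem ?_)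
    simp only [fieldWeight, labelWeight_nullDual, labelWeight_zero]
    ring

/-- The two derivatives are contracted with each other, so the vertex contains k² = 0. -/
theorem isWeightTwo_T₄ : IsWeightTwo [(0, 0), (0, 1), (0, 1)] T₄ := by
  refine ⟨?_, ?_⟩
  · refine sum_mem fun μ _ => sum_mem fun ν _ => sum_mem fun ρ _ => sum_mem fun σ _ =>
      single_mem_shapeSpan ?_ _
    simp [shape, hJ, dhJ, FieldComp.parity]
  · have h : (fun F => vertex F 0 0 T₄) = 0 := by
      funext F
      have e (μ ν ρ σ : Fin 4) :
          (2 * (ε μ * ε ν * ε ρ * ε σ)) • wordVertex F 0 0 [hJ μ ν, dhJ ρ μ ν, dhJ ρ σ σ] =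
          (ε ρ * (F.mom ρ * F.mom ρ)) • ((2 * (ε μ * ε ν * ε σ)) •
            (Finsupp.single (FieldComp.h μ ν) (1 : ℂ) ⊗ₜ[ℂ]
              (Finsupp.single (FieldComp.h μ ν) (1 : ℂ) ⊗ₜ[ℂ]
                Finsupp.single (FieldComp.h σ σ) (1 : ℂ)))) := by
        rw [wordVertex_triple]
        simp only [hJ, dhJ, F.momPow_zero, F.momPow_single, smul_smul]
        congr 1
        ring
      simp only [T₄, map_sum, vertex_single, e]
      refine Finset.sum_eq_zero fun μ _ => Finset.sum_eq_zero fun ν _ => ?_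
      simp only [← Finset.smul_sum]
      rw [← Finset.sum_smul, F.sum_mom_sq, zero_smul]
    rw [h]
    exact zero_mem _

/-- Zero for the same reason: the contracted derivatives give k². -/
theorem isWeightTwo_T₅ : IsWeightTwo [(0, 0), (0, 1), (0, 1)] T₅ := by
  refine ⟨?_, ?_⟩
  · refine sum_mem fun μ _ => sum_mem fun ν _ => sum_mem fun ρ _ => sum_mem fun σ _ =>
      single_mem_shapeSpan ?_ _
    simp [shape, hJ, dhJ, FieldComp.parity]
  · have h : (fun F => vertex F 0 0 T₅) = 0 := by
      funext F
      have e (μ ν ρ σ : Fin 4) :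
          (-4 * (ε μ * ε ν * ε ρ * ε σ)) • wordVertex F 0 0 [hJ μ ν, dhJ ρ μ σ, dhJ ρ ν σ] =
          (ε ρ * (F.mom ρ * F.mom ρ)) • ((-4 * (ε μ * ε ν * ε σ)) •
            (Finsupp.single (FieldComp.h μ ν) (1 : ℂ) ⊗ₜ[ℂ]
              (Finsupp.single (FieldComp.h μ σ) (1 : ℂ) ⊗ₜ[ℂ]
                Finsupp.single (FieldComp.h ν σ) (1 : ℂ)))) := by
        rw [wordVertex_triple]
        simp only [hJ, dhJ, F.momPow_zero, F.momPow_single, smul_smul]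
        congr 1
        ring
      simp only [T₅, map_sum, vertex_single, e]
      refine Finset.sum_eq_zero fun μ _ => Finset.sum_eq_zero fun ν _ => ?_
      simp only [← Finset.smul_sum]
      rw [← Finset.sum_smul, F.sum_mom_sq, zero_smul]
    rw [h]
    exact zero_mem _

theorem ghost_mem_weightTwo (c : ℂ) :
    (c • ∑ a, frameTriple (.u 0) (.ut a) (.h 0 (nullDual a))) ∈ weightTwo := by
  refine Submodule.smul_mem _ _ (sum_mem fun a _ => frameTriple_mem ?_)
  simp only [fieldWeight, labelWeight_nullDual, labelWeight_zero]
  ring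

/-- One derivative contracts the ghost with k and the other contracts one graviton index with k. The
remaining graviton index is paired with the antighost. -/
theorem isWeightTwo_T₆ : IsWeightTwo [(1, 0), (1, 1), (0, 1)] T₆ := by
  refine ⟨?_, ?_⟩
  · refine sum_mem fun μ _ => sum_mem fun ρ _ => sum_mem fun σ _ => single_mem_shapeSpan ?_ _
    simp [shape, uJ, dutJ, dhJ, FieldComp.parity]
  · have h : (fun F => vertex F 0 0 T₆) =
        (-4 : ℂ) • ∑ a, frameTriple (.u 0) (.ut a) (.h 0 (nullDual a)) := by
      funext F
      have e (μ ρ σ : Fin 4) :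
          (-4 * (ε μ * ε ρ * ε σ)) • wordVertex F 0 0 [uJ μ, dutJ ρ σ, dhJ μ ρ σ] =
          (-4 : ℂ) • (((ε μ * F.mom μ) • Finsupp.single (FieldComp.u μ) (1 : ℂ)) ⊗ₜ[ℂ]
            (ε σ • (Finsupp.single (FieldComp.ut σ) (1 : ℂ) ⊗ₜ[ℂ]
              ((ε ρ * F.mom ρ) • Finsupp.single (FieldComp.h ρ σ) (1 : ℂ))))) := by
        rw [← smul_triple_mid, wordVertex_triple]
        simp only [uJ, dutJ, dhJ, F.momPow_zero, F.momPow_single, smul_smul]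
        congr 1
        ring
      simp only [T₆, map_sum, vertex_single, e, ← Finset.smul_sum, ← TensorProduct.tmul_sum,
        ← TensorProduct.sum_tmul, F.sum_uVec_mom]
      rw [Finset.sum_comm]
      simp only [← Finset.smul_sum, ← TensorProduct.tmul_sum, F.sum_hVec_mom_left, sum_ut_h]
      simp only [TensorProduct.tmul_sum, Pi.smul_apply, Finset.sum_apply, frameTriple]
    rw [h]
    exact ghost_mem_weightTwo _

/-- Here both derivatives are contracted with the graviton, and ghost and antighost are paired with
weight zero. -/
theorem isWeightTwo_T₇ : IsWeightTwo [(1, 1), (1, 1), (0, 0)] T₇ := by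
  refine ⟨?_, ?_⟩
  · refine sum_mem fun μ _ => sum_mem fun ν _ => sum_mem fun ρ _ => single_mem_shapeSpan ?_ _
    simp [shape, duJ, dutJ, hJ, FieldComp.parity]
  · have h : (fun F => vertex F 0 0 T₇) =
        (4 : ℂ) • ∑ a, frameTriple (.u a) (.ut (nullDual a)) (.h 0 0) := by
      funext F
      have e (μ ν ρ : Fin 4) :
          (4 * (ε μ * ε ν * ε ρ)) • wordVertex F 0 0 [duJ ν ρ, dutJ μ ρ, hJ μ ν] =
          (4 : ℂ) • (ε ρ • (Finsupp.single (FieldComp.u ρ) (1 : ℂ) ⊗ₜ[ℂ]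
            (Finsupp.single (FieldComp.ut ρ) (1 : ℂ) ⊗ₜ[ℂ]
              ((ε μ * F.mom μ * (ε ν * F.mom ν)) •
                Finsupp.single (FieldComp.h μ ν) (1 : ℂ))))) := by
        rw [TensorProduct.tmul_smul, TensorProduct.tmul_smul, wordVertex_triple]
        simp only [duJ, dutJ, hJ, F.momPow_zero, F.momPow_single, smul_smul]
        congr 1
        ring
      simp only [T₇, map_sum, vertex_single, e]
      rw [Finset.sum_comm_cycle]
      simp only [← Finset.smul_sum, ← TensorProduct.tmul_sum, F.sum_hVec_mom_mom]
      simp only [← uVec_coordVec, ← utVec_coordVec]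
      have h' := F.sum_contraction
        ((TensorProduct.mk ℂ FieldSpace (FieldSpace ⊗[ℂ] FieldSpace)).compl₁₂ uVec
          ((TensorProduct.mk ℂ FieldSpace FieldSpace).flip (frameField F (.h 0 0)) ∘ₗ utVec))
      simp only [LinearMap.compl₁₂_apply, TensorProduct.mk_apply, LinearMap.comp_apply,
        LinearMap.flip_apply] at h'
      rw [h']
      simp only [Pi.smul_apply, Finset.sum_apply, frameTriple, frameField]
    rw [h]
    refine Submodule.smul_mem _ _ (sum_mem fun a _ => frameTriple_mem ?_)
    simp only [fieldWeight, labelWeight_nullDual, labelWeight_zero]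
    ring

/-- The last two terms of the Lagrangian differ in which field carries which derivative, a
difference that disappears at a common momentum; up to the factor they have this same vertex. -/
theorem sum_ghost_vertex (F : NullFrame) (c : ℂ) :
    ∑ μ, ∑ ν, ∑ ρ, c • (((ε ρ * F.mom ρ) • Finsupp.single (FieldComp.u ρ) (1 : ℂ)) ⊗ₜ[ℂ]
      (ε ν • (Finsupp.single (FieldComp.ut ν) (1 : ℂ) ⊗ₜ[ℂ]
        ((ε μ * F.mom μ) • Finsupp.single (FieldComp.h μ ν) (1 : ℂ))))) =
      (c • ∑ a, frameTriple (.u 0) (.ut a) (.h 0 (nullDual a))) F := by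
  rw [Finset.sum_comm]
  simp only [← Finset.smul_sum, ← TensorProduct.sum_tmul, F.sum_uVec_mom]
  simp only [← TensorProduct.tmul_sum, ← Finset.smul_sum, F.sum_hVec_mom_left, sum_ut_h]
  simp only [TensorProduct.tmul_sum, Pi.smul_apply, Finset.sum_apply, frameTriple]

theorem isWeightTwo_T₈ : IsWeightTwo [(1, 1), (1, 1), (0, 0)] T₈ := by
  refine ⟨?_, ?_⟩
  · refine sum_mem fun μ _ => sum_mem fun ν _ => sum_mem fun ρ _ => single_mem_shapeSpan ?_ _
    simp [shape, duJ, dutJ, hJ, FieldComp.parity]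
  · have h : (fun F => vertex F 0 0 T₈) =
        (-4 : ℂ) • ∑ a, frameTriple (.u 0) (.ut a) (.h 0 (nullDual a)) := by
      funext F
      have e (μ ν ρ : Fin 4) :
          (-4 * (ε μ * ε ν * ε ρ)) • wordVertex F 0 0 [duJ ρ ρ, dutJ μ ν, hJ μ ν] =
          (-4 : ℂ) • (((ε ρ * F.mom ρ) • Finsupp.single (FieldComp.u ρ) (1 : ℂ)) ⊗ₜ[ℂ]
            (ε ν • (Finsupp.single (FieldComp.ut ν) (1 : ℂ) ⊗ₜ[ℂ]
              ((ε μ * F.mom μ) • Finsupp.single (FieldComp.h μ ν) (1 : ℂ))))) := by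
        rw [← smul_triple_mid, wordVertex_triple]
        simp only [duJ, dutJ, hJ, F.momPow_zero, F.momPow_single, smul_smul]
        congr 1
        ring
      simp only [T₈, map_sum, vertex_single, e]
      exact sum_ghost_vertex F _
    rw [h]
    exact ghost_mem_weightTwo _

theorem isWeightTwo_T₉ : IsWeightTwo [(1, 1), (1, 1), (0, 0)] T₉ := by
  refine ⟨?_, ?_⟩
  · refine sum_mem fun μ _ => sum_mem fun ν _ => sum_mem fun ρ _ => single_mem_shapeSpan ?_ _
    simp [shape, duJ, dutJ, hJ, FieldComp.parity]
  · have h : (fun F => vertex F 0 0 T₉) =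
        (4 : ℂ) • ∑ a, frameTriple (.u 0) (.ut a) (.h 0 (nullDual a)) := by
      funext F
      have e (μ ν ρ : Fin 4) :
          (4 * (ε μ * ε ν * ε ρ)) • wordVertex F 0 0 [duJ μ ρ, dutJ ρ ν, hJ μ ν] =
          (4 : ℂ) • (((ε ρ * F.mom ρ) • Finsupp.single (FieldComp.u ρ) (1 : ℂ)) ⊗ₜ[ℂ]
            (ε ν • (Finsupp.single (FieldComp.ut ν) (1 : ℂ) ⊗ₜ[ℂ]
              ((ε μ * F.mom μ) • Finsupp.single (FieldComp.h μ ν) (1 : ℂ))))) := by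
        rw [← smul_triple_mid, wordVertex_triple]
        simp only [duJ, dutJ, hJ, F.momPow_zero, F.momPow_single, smul_smul]
        congr 1
        ring
      simp only [T₉, map_sum, vertex_single, e]
      exact sum_ghost_vertex F _
    rw [h]
    exact ghost_mem_weightTwo _

/-! ### The loop of two vertices of weight two is a relative coboundary -/

/-- The sign in `contractionFactor`, in terms of the shapes of the words. -/
def shapeSign (s s' : List (ℕ × ℕ)) (i j : ℕ) : ℂ :=
  (-1) ^ ((s.getD i (0, 0)).1 * ((s.drop (i + 1)).map Prod.fst).sum +
      (s'.getD j (0, 0)).1 * ((s'.take j).map Prod.fst).sum) * (-1) ^ (s'.getD j (0, 0)).2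

theorem wordParity_eq_shape (w : Word) : wordParity w = ((shape w).map Prod.fst).sum := by
  simp [wordParity, shape, Function.comp_def]

theorem shape_drop (w : Word) (n : ℕ) : shape (w.drop n) = (shape w).drop n := List.map_drop

theorem shape_take (w : Word) (n : ℕ) : shape (w.take n) = (shape w).take n := List.map_take

theorem shape_eraseIdx (w : Word) (n : ℕ) : shape (w.eraseIdx n) = (shape w).eraseIdx n := by
  simp [shape, List.eraseIdx_map]

theorem shape_getD {w : Word} {n : ℕ} (hn : n < w.length) (j : Jet) :
    (shape w).getD n (0, 0) = ((w.getD n j).field.parity, (w.getD n j).deriv.degree) := by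
  simp [shape, List.getD, hn]

theorem get_eq_getD (w : Word) (i : Fin w.length) (j : Jet) : w.get i = w.getD i j := by
  simp [List.getD]

/-- The signs depend on the parities and the numbers of derivatives alone. They are constant on the
words of one term of the Lagrangian and can be taken out of its index sums. -/
theorem contractionFactor_eq (a b : Word) (i : Fin a.length) (j : Fin b.length) :
    contractionFactor a b i j = shapeSign (shape a) (shape b) i j *
      twoPoint (a.getD i (uJ 0)).field (b.getD j (uJ 0)).field := by
  have hdeg (α : Fin 4 →₀ ℕ) : ∑ μ, α μ = α.degree := (Finsupp.degree_eq_sum α).symm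
  rw [contractionFactor, hdeg, wordParity_eq_shape, wordParity_eq_shape, shape_drop, shape_take,
    get_eq_getD a i (uJ 0), get_eq_getD b j (uJ 0), shapeSign, shape_getD i.isLt (uJ 0),
    shape_getD j.isLt (uJ 0), mul_assoc]

/-- The numerical coefficient of a pair of contractions. -/
def loopCoeff (s s' : List (ℕ × ℕ)) (i k j l : ℕ) : ℂ :=
  shapeSign s s' i j * shapeSign (s.eraseIdx i) (s'.eraseIdx j) k l *
    (-1) ^ (((s.eraseIdx i).eraseIdx k).getD 0 (0, 0)).2 *
    loopMoment ((s.getD i (0, 0)).2 + (s'.getD j (0, 0)).2)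
      (((s.eraseIdx i).getD k (0, 0)).2 + ((s'.eraseIdx j).getD l (0, 0)).2) 0

theorem eraseIdx_eraseIdx_eq {w : Word} (hw : w.length = 3) {i k : ℕ} (hi : i < 3) (hk : k < 2) :
    (w.eraseIdx i).eraseIdx k = [legThree i k w] := by
  obtain ⟨a, b, c, rfl⟩ := List.length_eq_three.mp hw
  interval_cases i <;> interval_cases k <;> rfl

theorem wordDeriv_eq {w : Word} (hw : w.length = 3) {i k : ℕ} (hi : i < 3) (hk : k < 2) :
    wordDeriv w = (legOne i w).deriv + (legTwo i k w).deriv + (legThree i k w).deriv := by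
  obtain ⟨a, b, c, rfl⟩ := List.length_eq_three.mp hw
  interval_cases i <;> interval_cases k <;> simp [wordDeriv, legOne, legTwo, legThree] <;> abel

/-- In the quotient the correction terms of the loop polynomial, being multiples of the wave
operator, disappear, and the loop contributes only a number and its derivatives. -/
theorem pairClass_monomial_mul_loopPoly (δ γ₁ γ₂ : Fin 4 →₀ ℕ) (φ ψ : FieldComp) :
    pairClass (MvPolynomial.monomial δ 1 * loopPoly γ₁ γ₂) φ ψ =
      loopMoment γ₁.degree γ₂.degree 0 • pairClass (MvPolynomial.monomial (δ + (γ₁ + γ₂)) 1) φ ψ := by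
  have h := pairClass_eq_zero (Ideal.mul_mem_left _ (MvPolynomial.monomial δ 1)
    (loopPoly_sub_mem γ₁ γ₂)) φ ψ
  rw [mul_sub, mul_smul_comm, MvPolynomial.monomial_mul, one_mul, sub_eq_add_neg,
    ← neg_one_smul ℂ (loopMoment _ _ _ • _), smul_smul, pairClass_add, pairClass_smul, neg_one_mul,
    neg_smul, add_neg_eq_zero] at h
  exact h

/-- The collinear reduction: derivatives on contracted and on external fields merge into a single
monomial, as if every line carried the same null momentum, and the numerical factor sees only the
shapes of the two words. -/
theorem mkQ_loopTerm {a b : Word} (ha : a.length = 3) (hb : b.length = 3) (i : Fin a.length)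
    (j : Fin b.length) (k : Fin (a.eraseIdx i).length) (l : Fin (b.eraseIdx j).length) :
    relCobound.mkQ
      ((contractionFactor a b i j * contractionFactor (a.eraseIdx i) (b.eraseIdx j) k l) •
        (loopPoly ((a.get i).deriv + (b.get j).deriv)
            (((a.eraseIdx i).get k).deriv + ((b.eraseIdx j).get l).deriv) ⊗ₜ[ℂ]
          (wordAt 0 ((a.eraseIdx i).eraseIdx k) * wordAt 1 ((b.eraseIdx j).eraseIdx l)))) =
      loopCoeff (shape a) (shape b) i k j l • pairClassL (contrWord i k j l a b) := by
  have hi : (i : ℕ) < 3 := ha ▸ i.isLt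
  have hj : (j : ℕ) < 3 := hb ▸ j.isLt
  have hk : (k : ℕ) < 2 :=
    k.isLt.trans_eq ((List.length_eraseIdx_of_lt i.isLt).trans (by rw [ha]))
  have hl : (l : ℕ) < 2 :=
    l.isLt.trans_eq ((List.length_eraseIdx_of_lt j.isLt).trans (by rw [hb]))
  have ea := eraseIdx_eraseIdx_eq ha hi hk
  have eb := eraseIdx_eraseIdx_eq hb hj hl
  have hpair (P : DerivPoly) : P ⊗ₜ[ℂ]
      (wordAt 0 ((a.eraseIdx i).eraseIdx k) * wordAt 1 ((b.eraseIdx j).eraseIdx l)) =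
      pairTerm P (legThree i k a) (legThree j l b) := by
    rw [ea, eb, pairTerm]
    simp [wordAt]
  have hdeg : (((shape a).eraseIdx i).eraseIdx k).getD 0 (0, 0) =
      ((legThree i k a).field.parity, (legThree i k a).deriv.degree) := by
    rw [← shape_eraseIdx, ← shape_eraseIdx, ea]
    rfl
  rw [map_smul, hpair, mkQ_pairTerm, pairClass_monomial_mul_loopPoly, contrWord, pairClassL_single,
    pairClass_smul, contractionFactor_eq, contractionFactor_eq, get_eq_getD a i (uJ 0),
    get_eq_getD b j (uJ 0), get_eq_getD _ k (uJ 0), get_eq_getD _ l (uJ 0), loopCoeff, hdeg,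
    shape_getD i.isLt (uJ 0), shape_getD j.isLt (uJ 0), ← shape_eraseIdx, ← shape_eraseIdx,
    shape_getD k.isLt (uJ 0), shape_getD l.isLt (uJ 0), map_add, map_add, wordDeriv_eq ha hi hk,
    wordDeriv_eq hb hj hl, smul_smul, smul_smul, smul_smul]
  refine congrArg₂ (· • ·) ?_ (congrArg (fun α => pairClass (MvPolynomial.monomial α 1)
    (legThree i k a).field (legThree j l b).field) ?_)
  · simp only [legOne, legTwo]
    ring
  · simp only [legOne, legTwo]
    abel

theorem sum_fin_eq_sum_range {M : Type*} [AddCommMonoid M] {m n : ℕ} (h : m = n) (f : ℕ → M) :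
    ∑ i : Fin m, f i = ∑ i ∈ Finset.range n, f i := by
  subst h
  exact Fin.sum_univ_eq_sum_range f m

theorem mkQ_loopCochain {a b : Word} (ha : a.length = 3) (hb : b.length = 3) :
    relCobound.mkQ (loopCochain a b) = ∑ i ∈ Finset.range 3, ∑ j ∈ Finset.range 3,
      ∑ k ∈ Finset.range 2, ∑ l ∈ Finset.range 2,
        loopCoeff (shape a) (shape b) i k j l • pairClassL (contrWord i k j l a b) := by
  simp only [loopCochain, map_sum, mkQ_loopTerm ha hb]
  have ha' (i : Fin a.length) : (a.eraseIdx i).length = 2 := by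
    rw [List.length_eraseIdx_of_lt i.isLt, ha]
  have hb' (j : Fin b.length) : (b.eraseIdx j).length = 2 := by
    rw [List.length_eraseIdx_of_lt j.isLt, hb]
  let f : ℕ → ℕ → ℕ → ℕ → Cochain ⧸ relCobound := fun i j k l =>
    loopCoeff (shape a) (shape b) i k j l • pairClassL (contrWord i k j l a b)
  have h1 (i : Fin a.length) (j : Fin b.length) :
      ∑ k : Fin (a.eraseIdx i).length, ∑ l : Fin (b.eraseIdx j).length, f i j k l =
        ∑ k ∈ Finset.range 2, ∑ l ∈ Finset.range 2, f i j k l := by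
    rw [sum_fin_eq_sum_range (ha' i) fun k => ∑ l : Fin (b.eraseIdx j).length, f i j k l]
    exact Finset.sum_congr rfl fun k _ => sum_fin_eq_sum_range (hb' j) _
  change ∑ i : Fin a.length, ∑ j : Fin b.length, ∑ k : Fin (a.eraseIdx i).length,
    ∑ l : Fin (b.eraseIdx j).length, f i j k l = _
  simp only [h1]
  rw [sum_fin_eq_sum_range ha fun i => ∑ j : Fin b.length, ∑ k ∈ Finset.range 2,
    ∑ l ∈ Finset.range 2, f i j k l]
  exact Finset.sum_congr rfl fun i _ => sum_fin_eq_sum_range hb fun j => ∑ k ∈ Finset.range 2,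
    ∑ l ∈ Finset.range 2, f i j k l

/-- Because the coefficients are constant on a shape, the formula for single words extends
bilinearly. This allows the cancellations within a whole term T_j to be used before contracting. -/
theorem mkQ_loopCochainL {s s' : List (ℕ × ℕ)} (hs : s.length = 3) (hs' : s'.length = 3)
    {A B : Word →₀ ℂ} (hA : A ∈ shapeSpan s) (hB : B ∈ shapeSpan s') :
    relCobound.mkQ (loopCochainL A B) = ∑ i ∈ Finset.range 3, ∑ j ∈ Finset.range 3,
      ∑ k ∈ Finset.range 2, ∑ l ∈ Finset.range 2,
        loopCoeff s s' i k j l • pairClassL (contrWordL i k j l A B) := by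
  induction hA, hB using Submodule.span_induction₂ with
  | mem_mem u v hu hv =>
    obtain ⟨a, rfl, rfl⟩ := hu
    obtain ⟨b, rfl, rfl⟩ := hv
    have e (f : Word → Word → Cochain) : Finsupp.linearCombination ℂ
        (fun a => Finsupp.linearCombination ℂ fun b => f a b) (Finsupp.single a 1)
          (Finsupp.single b 1) = f a b := by simp
    rw [shape, List.length_map] at hs hs'
    simp only [loopCochainL, contrWordL, Finsupp.linearCombination_single, one_smul]
    exact mkQ_loopCochain hs hs'
  | zero_left v hv => simp
  | zero_right u hu => simp
  | add_left u u' v hu hu' hv h h' =>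
    simp only [map_add, LinearMap.add_apply, h, h', smul_add, Finset.sum_add_distrib]
  | add_right u v v' hu hv hv' h h' =>
    simp only [map_add, h, h', smul_add, Finset.sum_add_distrib]
  | smul_left r u v hu hv h =>
    simp only [map_smul, LinearMap.smul_apply, h, smul_comm _ r, Finset.smul_sum]
  | smul_right r u v hu hv h =>
    simp only [map_smul, h, smul_comm _ r, Finset.smul_sum]

theorem loopCochainL_mem_relCobound {s s' : List (ℕ × ℕ)} (hs : s.length = 3)
    (hs' : s'.length = 3) {A B : Word →₀ ℂ} (hA : IsWeightTwo s A) (hB : IsWeightTwo s' B) :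
    loopCochainL A B ∈ relCobound := by
  rw [← Submodule.Quotient.mk_eq_zero, ← Submodule.mkQ_apply,
    mkQ_loopCochainL hs hs' hA.mem_shapeSpan hB.mem_shapeSpan]
  refine Finset.sum_eq_zero fun i hi => Finset.sum_eq_zero fun j hj =>
    Finset.sum_eq_zero fun k hk => Finset.sum_eq_zero fun l hl => ?_
  rw [pairClassL_contrWordL hs hs' hA hB (Finset.mem_range.mp hi) (Finset.mem_range.mp hk)
    (Finset.mem_range.mp hj) (Finset.mem_range.mp hl), smul_zero]

/-- The span of the bosonic Wick polynomials of degree three with vertices of weight two. -/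
def evenWeightTwo : Submodule ℂ (Word →₀ ℂ) :=
  Submodule.span ℂ {T | ∃ s : List (ℕ × ℕ), s.length = 3 ∧ Even (s.map Prod.fst).sum ∧
    IsWeightTwo s T}

theorem lagrangian_mem (κ : ℝ) : lagrangian κ ∈ evenWeightTwo := by
  have h {s : List (ℕ × ℕ)} {T : Word →₀ ℂ} (hT : IsWeightTwo s T) (hs : s.length = 3)
      (he : Even (s.map Prod.fst).sum) : T ∈ evenWeightTwo :=
    Submodule.subset_span ⟨s, hs, he, hT⟩
  refine Submodule.smul_mem _ _ (add_mem (add_mem (add_mem (add_mem (add_mem (add_mem (add_mem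
    (add_mem ?_ ?_) ?_) ?_) ?_) ?_) ?_) ?_) ?_)
  · exact h isWeightTwo_T₁ rfl (by decide)
  · exact h isWeightTwo_T₂ rfl (by decide)
  · exact h isWeightTwo_T₃ rfl (by decide)
  · exact h isWeightTwo_T₄ rfl (by decide)
  · exact h isWeightTwo_T₅ rfl (by decide)
  · exact h isWeightTwo_T₆ rfl (by decide)
  · exact h isWeightTwo_T₇ rfl (by decide)
  · exact h isWeightTwo_T₈ rfl (by decide)
  · exact h isWeightTwo_T₉ rfl (by decide)

theorem loopCochainL_mem_of_evenWeightTwo {A B : Word →₀ ℂ} (hA : A ∈ evenWeightTwo)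
    (hB : B ∈ evenWeightTwo) : loopCochainL A B ∈ relCobound := by
  induction hA, hB using Submodule.span_induction₂ with
  | mem_mem u v hu hv =>
    obtain ⟨s, hs, -, hu⟩ := hu
    obtain ⟨s', hs', -, hv⟩ := hv
    exact loopCochainL_mem_relCobound hs hs' hu hv
  | zero_left v hv => rw [map_zero, LinearMap.zero_apply]; exact zero_mem _
  | zero_right u hu => rw [map_zero]; exact zero_mem _
  | add_left u u' v hu hu' hv h h' => rw [map_add, LinearMap.add_apply]; exact add_mem h h'
  | add_right u v v' hu hv hv' h h' => rw [map_add]; exact add_mem h h'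
  | smul_left r u v hu hv h =>
    rw [map_smul, LinearMap.smul_apply]
    exact Submodule.smul_mem _ _ h
  | smul_right r u v hu hv h => rw [map_smul]; exact Submodule.smul_mem _ _ h

/-! ### Symmetry of the causal commutator -/

theorem opSwap_opSwap (x : Op) : opSwap (opSwap x) = x := by
  have : opSwap ∘ₗ opSwap = LinearMap.id := TensorProduct.ext' fun d W => by
    rw [LinearMap.comp_apply, opSwap_tmul, opSwap_tmul, reflect_reflect, wickSwap_wickSwap]
    rfl
  exact LinearMap.congr_fun this x

/-- The span of the bosonic words. -/
def evenSpan : Submodule ℂ (Word →₀ ℂ) :=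
  Submodule.span ℂ {x | ∃ w, Even (wordParity w) ∧ x = Finsupp.single w 1}

theorem evenWeightTwo_le_evenSpan : evenWeightTwo ≤ evenSpan := by
  refine Submodule.span_le.mpr ?_
  rintro T ⟨s, -, he, hT⟩
  have h : shapeSpan s ≤ evenSpan := by
    refine Submodule.span_mono ?_
    rintro _ ⟨w, hw, rfl⟩
    exact ⟨w, by rwa [wordParity_eq_shape, hw], rfl⟩
  exact h hT.mem_shapeSpan

/-- For bosonic words the graded commutator is an ordinary one, hence antisymmetric. Together with
the oddness of d₂ this makes the formal expression of the commutator of T with itself symmetric. -/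
theorem opSwap_oneLoopCommutator {A B : Word →₀ ℂ} (hA : A ∈ evenSpan) (hB : B ∈ evenSpan) :
    opSwap (oneLoopCommutator A B) = -oneLoopCommutator B A := by
  induction hA, hB using Submodule.span_induction₂ with
  | mem_mem u v hu hv =>
    obtain ⟨a, ha, rfl⟩ := hu
    obtain ⟨b, hb, rfl⟩ := hv
    simp only [oneLoopCommutator, Finsupp.linearCombination_single, one_smul]
    rw [(ha.mul_right _).neg_one_pow, (hb.mul_right _).neg_one_pow, one_smul, one_smul, map_sub,
      opSwap_opSwap, neg_sub]
  | zero_left v hv => simp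
  | zero_right u hu => simp
  | add_left u u' v hu hu' hv h h' =>
    rw [map_add, LinearMap.add_apply, map_add, h, h', map_add, neg_add]
  | add_right u v v' hu hv hv' h h' =>
    rw [map_add, map_add, h, h', map_add, LinearMap.add_apply, neg_add]
  | smul_left r u v hu hv h =>
    rw [map_smul, LinearMap.smul_apply, map_smul, h, map_smul]
    exact smul_neg _ _
  | smul_right r u v hu hv h =>
    rw [map_smul, map_smul, h, map_smul, LinearMap.smul_apply]
    exact smul_neg _ _

theorem formalSwap_formalSwap (C : Cochain) : formalSwap (formalSwap C) = C := by
  have h : negX.comp negX = AlgHom.id ℂ DerivPoly := by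
    ext μ
    simp [negX]
  have : formalSwap ∘ₗ formalSwap = LinearMap.id := TensorProduct.ext' fun P W => by
    rw [LinearMap.comp_apply, formalSwap_tmul, formalSwap_tmul, wickSwap_wickSwap]
    exact congrArg (fun P => P ⊗ₜ[ℂ] W) (AlgHom.congr_fun h P)
  exact LinearMap.congr_fun this C

/-- A symmetric relative coboundary is of the form `d_Q B + ∑ (∂¹_μ Z^μ + (1 ↔ 2))`. -/
theorem exists_symmetric_of_mem_relCobound {C : Cochain} (hC : C ∈ relCobound)
    (hS : formalSwap C = C) : ∃ (B : Cochain) (Z : Fin 4 → Cochain),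
      C = formalBRST B + ((∑ μ, formalPartial 0 μ (Z μ)) +
        ∑ μ, formalPartial 1 μ (formalSwap (Z μ))) := by
  obtain ⟨b, X, Y, h⟩ := mem_relCobound.mp hC
  -- The average of the given representation and its image under the exchange, which turns
  -- derivatives at x₁ into derivatives at x₂.
  refine ⟨(1 / 2 : ℂ) • (b + formalSwap b), fun μ => (1 / 2 : ℂ) • (X μ + formalSwap (Y μ)), ?_⟩
  have h' := congrArg formalSwap h
  simp only [map_add, map_sum, formalSwap_formalBRST, formalSwap_formalPartial, hS,
    show (Fin.rev 0 : Fin 2) = 1 from rfl, show (Fin.rev 1 : Fin 2) = 0 from rfl] at h'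
  have h2 : C = (1 / 2 : ℂ) • (C + C) := by
    rw [← two_smul ℂ C, smul_smul]
    norm_num
  rw [h2]
  nth_rewrite 1 [h]
  rw [h']
  simp only [map_add, map_smul, formalSwap_formalSwap, ← Finset.smul_sum, ← smul_add,
    Finset.sum_add_distrib]
  congr 1
  abel

end MasslessGravity

end

theorem mainTheorem1 (κ : ℝ) :
    ∃ (B : Cochain) (B₁ B₂ : Fin 4 → Cochain),
      -- the causal commutator: `D = d_Q B + i [∂¹_μ B^μ - (1 ↔ 2)]`
      oneLoopCommutator (lagrangian κ) (lagrangian κ) =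
        opBRST (cochainAt d₂ B) +
          Complex.I • ((∑ μ, opPartial 0 μ (cochainAt d₂ (B₁ μ))) -
            opSwap (∑ μ, opPartial 0 μ (cochainAt d₂ (B₁ μ)))) ∧
      -- the component `B^{∅,μ}` of the cochain is minus the exchange of `B^{μ,∅}`
      (∀ μ, cochainAt d₂ (B₂ μ) = -opSwap (cochainAt d₂ (B₁ μ))) ∧
      -- the chronological products, with `d₂` replaced by a Feynman propagator everywhere
      ∀ dF : Distr, IsFeynman dF →
        (∃ t, IsOneLoopChronological (lagrangian κ) (lagrangian κ) dF t) ∧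
        ∀ t, IsOneLoopChronological (lagrangian κ) (lagrangian κ) dF t →
          t = opBRST (cochainAt dF B) +
            Complex.I • ((∑ μ, opPartial 0 μ (cochainAt dF (B₁ μ))) +
              ∑ μ, opPartial 1 μ (cochainAt dF (B₂ μ))) ∧
          (reflect dF = dF → ∀ μ, cochainAt dF (B₂ μ) = opSwap (cochainAt dF (B₁ μ))) := by
  have hL := lagrangian_mem κ
  set L := lagrangian κ
  set C := loopCochainL L L
  have hD : oneLoopCommutator L L = cochainAt d₂ C := oneLoopCommutator_eq L L
  -- Two minus signs cancel, one from the antisymmetry of the commutator and one from d₂ being odd.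
  -- Injectivity lifts the resulting identity from d₂ to the formal expressions.
  have hS : formalSwap C = C := by
    have h := opSwap_oneLoopCommutator (evenWeightTwo_le_evenSpan hL)
      (evenWeightTwo_le_evenSpan hL)
    rw [hD, opSwap_cochainAt_d₂, neg_inj] at h
    exact cochainAt_d₂_injective h
  obtain ⟨B, Z, hC⟩ :=
    exists_symmetric_of_mem_relCobound (loopCochainL_mem_of_evenWeightTwo hL hL) hS
  -- The factor -i in the choice of B^μ compensates the i in front of the bracket.
  have hZ (μ : Fin 4) : Complex.I • (-Complex.I) • Z μ = Z μ := by
    rw [smul_smul, mul_neg, Complex.I_mul_I, neg_neg, one_smul]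
  have hC' : C = formalBRST B + Complex.I • ((∑ μ, formalPartial 0 μ ((-Complex.I) • Z μ)) +
      ∑ μ, formalPartial 1 μ (formalSwap ((-Complex.I) • Z μ))) := by
    refine hC.trans ?_
    simp only [smul_add, Finset.smul_sum, ← map_smul, hZ]
  -- The formal identity is evaluated at an arbitrary distribution: at d₂ for the commutator, at a
  -- Feynman propagator for the chronological product.
  have hF (d : Distr) : cochainAt d C = opBRST (cochainAt d B) +
      Complex.I • ((∑ μ, opPartial 0 μ (cochainAt d ((-Complex.I) • Z μ))) +
        ∑ μ, opPartial 1 μ (cochainAt d (formalSwap ((-Complex.I) • Z μ)))) := by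
    rw [hC', map_add, map_smul, map_add, map_sum, map_sum, cochainAt_formalBRST]
    simp only [cochainAt_formalPartial]
  refine ⟨B, fun μ => (-Complex.I) • Z μ, fun μ => formalSwap ((-Complex.I) • Z μ), ?_, ?_, ?_⟩
  · have e : opSwap (∑ μ, opPartial 0 μ (cochainAt d₂ ((-Complex.I) • Z μ))) =
        -∑ μ, opPartial 1 μ (cochainAt d₂ (formalSwap ((-Complex.I) • Z μ))) := by
      simp only [← cochainAt_formalPartial]
      rw [← map_sum, opSwap_cochainAt_d₂, map_sum, map_sum]
      simp only [formalSwap_formalPartial, show (Fin.rev 0 : Fin 2) = 1 from rfl]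
    rw [hD, hF, e, sub_neg_eq_add]
  · intro μ
    rw [opSwap_cochainAt_d₂, neg_neg]
  · refine fun dF _ => ⟨⟨cochainAt dF C, C, hD, rfl⟩, ?_⟩
    rintro t ⟨C', hC₁, rfl⟩
    refine ⟨?_, fun hr μ => ?_⟩
    -- Any other formal expression of the commutator coincides with C, so the chronological product
    -- does not depend on how the commutator is written.
    · rw [← cochainAt_d₂_injective (hD.symm.trans hC₁)]
      exact hF dF
    · rw [opSwap_cochainAt, hr]
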